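/- **Setting.** Let $\Theta\subseteq\mathbb R^d$ be compact and convex with $\|w_1-w_2\|\le D$ for all $w_1,w_2\in\Theta$, $D>0$. There are $n$ clients $\mathcal I=\{1,\dots,n\}$; client $i$ has a probability distribution $\mathcal D_i$ on a measurable space $\mathcal Z$, measurable functions $f_i(w,\zeta),g_i(w,\zeta)\in\mathbb R$ and stochastic gradients $\nabla f_i(w,\zeta),\nabla g_i(w,\zeta)\in\mathbb R^d$. For $h\in\{f,g\}$ put $h_i(w)=\mathbb E_{\zeta\sim\mathcal D_i}[h_i(w,\zeta)]$, $\nabla h_i(w)=\mathbb E_{\zeta\sim\mathcal D_i}[\nabla h_i(w,\zeta)]$, and $F(w)=\max_i f_i(w)$, $G(w)=\max_i g_i(w)$. Let $w^*$ minimize $F$ over $\{w\in\Theta: G(w)\le 0\}$. **Assumptions.** There are $L,\sigma_\zeta,\sigma_g,\sigma>0$ such that for $h\in\{f,g\}$, all $i\in\mathcal I$ and all $w\in\Theta$: 1. $h_i$ is convex and $L$-Lipschitz on $\Theta$, and $\nabla h_i(w)$ is a subgradient of $h_i$ at $w$ (that is, $h_i(v)\ge h_i(w)+\langle\nabla h_i(w),v-w\rangle$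 for all $v\in\Theta$) with $\|\nabla h_i(w)\|\le L$; 2. $\mathbb E_{\zeta\sim\mathcal D_i}\exp\big((h_i(w,\zeta)-h_i(w))^2/\sigma_\zeta^2\big)\le 2$; 3. $\mathbb E_{\zeta\sim\mathcal D_i}\exp\big(\|\nabla h_i(w,\zeta)-\nabla h_i(w)\|^2/\sigma_g^2\big)\le 2$; 4. (uniformly bounded relative gap) for $i$ uniform on $\mathcal I$ and $U\sim\mathrm{Unif}[0,\sigma]$, $\Pr(\max_j h_j(w)-h_i(w)\ge t)\le\Pr(U\ge t)$ for all $t\in\mathbb R$. **Algorithm.** Let $K,E,B_\zeta,B_g\ge1$, $1\le m\le n$, and $w_0\in\Theta$. In round $k=0,\dots,K-1$ draw $\mathcal I_k$ uniformly among the subsets of $\mathcal I$ of size $m$ and, for $i\in\mathcal I_k$, let $\hat f_{k,i},\hat g_{k,i}$ be the averages of $f_i(w_k,\cdot),g_i(w_k,\cdot)$ over a common batch of $B_\zeta$ samples from $\mathcal D_i$. Let $p_k=\mathrm{softmax}(\alpha(\hat f_{k,i})_{i\in\mathcal I_k})$, $q_k=\mathrm{softmax}(\alpha(\hat g_{k,i})_{i\in\mathcal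 I_k})$. If $\sum_{i\in\mathcal I_k}q_{k,i}\hat g_{k,i}\le\epsilon/2$, put $k$ into $\mathcal S$ and set $r_k=p_k$, $h=f$; otherwise set $r_k=q_k$, $h=g$. Each $i\in\mathcal I_k$ sets $w_{k,0}^{(i)}=w_k$ and, for $\tau=0,\dots,E-1$, $w_{k,\tau+1}^{(i)}=w_{k,\tau}^{(i)}-\gamma v_{k,\tau}^{(i)}$, where $v_{k,\tau}^{(i)}$ is the average of $\nabla h_i(w_{k,\tau}^{(i)},\cdot)$ over a fresh batch of $B_g$ samples from $\mathcal D_i$, and returns $u_k^{(i)}=(w_{k,0}^{(i)}-w_{k,E}^{(i)})/(\gamma E)$. Then $w_{k+1}=w_k-\eta\sum_{i\in\mathcal I_k}r_{k,i}u_k^{(i)}$. All client sets and samples are independent. The output is $\overline w_K=\frac1{|\mathcal S|}\sum_{k\in\mathcal S}w_k$, and $\kappa=|\mathcal S|/K$. **Theorem.** Let $\delta\in(0,1)$, $r=m/n$, $\bar\sigma_g^2=\frac{\sigma_g^2/B_g}{L^2E}$, $\eta=\frac{D}{L\sqrt{8K}}$, $\gamma=\frac{D}{LE\sqrt{8K}}$,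 $$\epsilon'=\frac{DL}{\sqrt{K/32}}\Big[1+2\bar\sigma_g^2\Big(3+\frac{8\ln(8/\delta)}{K}\Big)+\bar\sigma_g\sqrt{8\ln(8/\delta)}\Big(1+\frac{E}{\sqrt{6K}}\Big)\Big],$$ $$\epsilon=\epsilon'+4\sigma_\zeta\sqrt{\frac{2\ln(24Km/\delta)}{B_\zeta}}+\frac{4\sigma}{|\ln(1-r)|\,n}\ln\frac{32}{\delta},\qquad \alpha\ge\frac{2\ln m}{\epsilon'},$$ where $\frac{1}{|\ln(1-r)|}$ is read as $0$ if $m=n$. Then, with probability at least $1-\delta$, the following holds: provided that all points at which the algorithm evaluates the functions ($w_k$ and $w_{k,\tau}^{(i)}$ for $0\le k<K$, $i\in\mathcal I_k$, $0\le\tau<E$) lie in $\Theta$, the set $\mathcal S$ is nonempty (so $\kappa\in(0,1]$) and $$F(\overline w_K)-F(w^*)\le\epsilon,\qquad G(\overline w_K)\le\epsilon+\frac{4\sigma\ln\frac1{2\kappa}}{|\ln(1-r)|\,n}.$$ -/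

import Mathlib

open MeasureTheory ProbabilityTheory

noncomputable section

/-! ### The federated constrained minimax problem -/

/-- The parameter space `ℝ^d` with its Euclidean norm. -/
abbrev Vec (d : ℕ) : Type := EuclideanSpace ℝ (Fin d)

/-- The data of the problem with clients `Fin n`: the parameter set `Θ`, the local data
distributions `𝒟 i`, the sampled objectives and constraints `f i w ζ`, `g i w ζ`, and the
stochastic first-order oracles `df i w ζ`, `dg i w ζ` (the sampled gradients).
The functions are total, but only their values at `w ∈ Θ` are constrained by the assumptions. -/
structure FedProblem (n d : ℕ) (Z : Type*) [MeasurableSpace Z] where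
  Θ : Set (Vec d)
  𝒟 : Fin n → Measure Z
  f : Fin n → Vec d → Z → ℝ
  g : Fin n → Vec d → Z → ℝ
  df : Fin n → Vec d → Z → Vec d
  dg : Fin n → Vec d → Z → Vec d

/-- `h_i(w) = E_{ζ ∼ 𝒟_i}[h_i(w, ζ)]`. -/
def meanValue {n d : ℕ} {Z : Type*} [MeasurableSpace Z] (𝒟 : Fin n → Measure Z)
    (h : Fin n → Vec d → Z → ℝ) (i : Fin n) (w : Vec d) : ℝ :=
  ∫ z, h i w z ∂(𝒟 i)

/-- `∇h_i(w) = E_{ζ ∼ 𝒟_i}[∇h_i(w, ζ)]`. -/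
def meanGrad {n d : ℕ} {Z : Type*} [MeasurableSpace Z] (𝒟 : Fin n → Measure Z)
    (dh : Fin n → Vec d → Z → Vec d) (i : Fin n) (w : Vec d) : Vec d :=
  ∫ z, dh i w z ∂(𝒟 i)

/-- `max_i h_i(w)` (a maximum over the finite set of clients). -/
def worstValue {n d : ℕ} {Z : Type*} [MeasurableSpace Z] (𝒟 : Fin n → Measure Z)
    (h : Fin n → Vec d → Z → ℝ) (w : Vec d) : ℝ :=
  ⨆ i : Fin n, meanValue 𝒟 h i w

/-- The worst-case objective `F(w) = max_i f_i(w)`. -/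
def FedProblem.F {n d : ℕ} {Z : Type*} [MeasurableSpace Z] (p : FedProblem n d Z) (w : Vec d) : ℝ :=
  worstValue p.𝒟 p.f w

/-- The worst-case constraint `G(w) = max_i g_i(w)`. -/
def FedProblem.G {n d : ℕ} {Z : Type*} [MeasurableSpace Z] (p : FedProblem n d Z) (w : Vec d) : ℝ :=
  worstValue p.𝒟 p.g w

/-- `wstar` minimizes `F` over the points of `Θ` with `G ≤ 0`, and is itself such a point. -/
def FedProblem.IsOptimal {n d : ℕ} {Z : Type*} [MeasurableSpace Z] (p : FedProblem n d Z)
    (wstar : Vec d) : Prop :=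
  wstar ∈ p.Θ ∧ p.G wstar ≤ 0 ∧ ∀ w ∈ p.Θ, p.G w ≤ 0 → p.F wstar ≤ p.F w

/-! ### Assumptions -/

/-- First-order stochastic dominance `X ⪯_st Y`: `Pr(X ≥ t) ≤ Pr(Y ≥ t)` for all real `t`. -/
def StochDominated {A B : Type*} [MeasurableSpace A] [MeasurableSpace B]
    (μ : Measure A) (X : A → ℝ) (ν : Measure B) (Y : B → ℝ) : Prop :=
  ∀ t : ℝ, μ {a | t ≤ X a} ≤ ν {b | t ≤ Y b}

/-- The assumptions on one of the two families (`h = f` or `h = g`, with oracle `dh`). -/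
structure FamilyAssumptions {n d : ℕ} {Z : Type*} [MeasurableSpace Z] (Θ : Set (Vec d))
    (𝒟 : Fin n → Measure Z) (h : Fin n → Vec d → Z → ℝ) (dh : Fin n → Vec d → Z → Vec d)
    (L σζ σg σ : ℝ) : Prop where
  measurable_value : ∀ i, Measurable fun q : Vec d × Z => h i q.1 q.2
  measurable_grad : ∀ i, Measurable fun q : Vec d × Z => dh i q.1 q.2
  /-- Convexity of the expected functions on `Θ`. -/
  convex : ∀ i, ConvexOn ℝ Θ (meanValue 𝒟 h i)
  /-- `L`-Lipschitz continuity of the expected functions on `Θ`. -/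
  lipschitz : ∀ i, ∀ w₁ ∈ Θ, ∀ w₂ ∈ Θ,
    |meanValue 𝒟 h i w₁ - meanValue 𝒟 h i w₂| ≤ L * ‖w₁ - w₂‖
  /-- The mean of the oracle is a subgradient. -/
  subgradient : ∀ i, ∀ w ∈ Θ, ∀ v ∈ Θ,
    meanValue 𝒟 h i w + inner ℝ (meanGrad 𝒟 dh i w) (v - w) ≤ meanValue 𝒟 h i v
  /-- The subgradient is one of an `L`-Lipschitz function, i.e. of norm at most `L`. At interior
  points of `Θ` this follows from the two previous fields; it excludes the arbitrarily long
  subgradients relative to `Θ` that exist at boundary points. -/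
  norm_subgradient : ∀ i, ∀ w ∈ Θ, ‖meanGrad 𝒟 dh i w‖ ≤ L
  /-- Sub-Gaussian function values. The integral is the Lebesgue integral in `[0, ∞]`. -/
  subGaussian_value : ∀ i, ∀ w ∈ Θ,
    ∫⁻ z, ENNReal.ofReal (Real.exp ((h i w z - meanValue 𝒟 h i w) ^ 2 / σζ ^ 2)) ∂(𝒟 i) ≤ 2
  /-- Sub-Gaussian stochastic gradients. -/
  subGaussian_grad : ∀ i, ∀ w ∈ Θ,
    ∫⁻ z, ENNReal.ofReal (Real.exp (‖dh i w z - meanGrad 𝒟 dh i w‖ ^ 2 / σg ^ 2)) ∂(𝒟 i) ≤ 2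
  /-- Uniformly bounded relative gap: for a uniformly random client `i`, the gap
  `max_j h_j(w) - h_i(w)` is stochastically dominated by `U ∼ Unif[0, σ]`. -/
  relative_gap : ∀ w ∈ Θ,
    StochDominated (uniformOn (Set.univ : Set (Fin n)))
      (fun i => worstValue 𝒟 h w - meanValue 𝒟 h i w)
      (ProbabilityTheory.cond (volume : Measure ℝ) (Set.Icc 0 σ)) (fun u => u)

/-! ### The algorithm -/

/-- Batch average `(1/B) ∑_s h(ζ_s)`. -/
def batchMean {B : ℕ} {Z V : Type*} [AddCommGroup V] [Module ℝ V] (h : Z → V)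
    (s : Fin B → Z) : V :=
  (B : ℝ)⁻¹ • ∑ b, h (s b)

/-- The softmax masked by the set `A` of participating clients. -/
def maskedSoftmax {n : ℕ} (A : Finset (Fin n)) (v : Fin n → ℝ) (i : Fin n) : ℝ :=
  (if i ∈ A then Real.exp (v i) else 0) / ∑ j ∈ A, Real.exp (v j)

/-- The randomness of one global round: the participating clients, the batches for function values
(client, position in the batch) and the batches for gradients (client, local step, position in the
batch). Batches of clients that do not participate are never used. -/
abbrev RoundSample (n E Bζ Bg : ℕ) (Z : Type*) : Type _ :=
  Finset (Fin n) × (Fin n → Fin Bζ → Z) × (Fin n → Fin E → Fin Bg → Z)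

/-- The law of one round: the set of clients is uniform among those of cardinality `m`, every sample
of client `i` has law `𝒟 i`, and all of these are independent. -/
def roundLaw {n : ℕ} {Z : Type*} [MeasurableSpace Z] (E Bζ Bg m : ℕ) (𝒟 : Fin n → Measure Z) :
    Measure (RoundSample n E Bζ Bg Z) :=
  (uniformOn (↑(Finset.powersetCard m (Finset.univ : Finset (Fin n))) : Set (Finset (Fin n)))).prod
    ((Measure.pi fun i => Measure.pi fun _ => 𝒟 i).prod
      (Measure.pi fun i => Measure.pi fun _ => Measure.pi fun _ => 𝒟 i))

/-- The rounds are independent and identically distributed with law `roundLaw`. -/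
structure IsIIDRounds {n E Bζ Bg : ℕ} {Z Ω : Type*} [MeasurableSpace Z] [MeasurableSpace Ω]
    (P : Measure Ω) (m : ℕ) (𝒟 : Fin n → Measure Z) (X : ℕ → Ω → RoundSample n E Bζ Bg Z) :
    Prop where
  measurable : ∀ k, Measurable (X k)
  indep : iIndepFun X P
  law : ∀ k, P.map (X k) = roundLaw E Bζ Bg m 𝒟

/-- Inputs of the algorithm: global and local step size, tolerance, softmax hyperparameter. -/
structure AlgParams where
  η : ℝ
  γ : ℝ
  ε : ℝ
  α : ℝ

namespace FedProblem

variable {n d E Bζ Bg : ℕ} {Z : Type*} [MeasurableSpace Z]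

/-- The estimates `f_i(w, ξ^{(i)})`. -/
def fEst (p : FedProblem n d Z) (x : RoundSample n E Bζ Bg Z) (w : Vec d) (i : Fin n) : ℝ :=
  batchMean (p.f i w) (x.2.1 i)

/-- The estimates `g_i(w, ξ^{(i)})`. -/
def gEst (p : FedProblem n d Z) (x : RoundSample n E Bζ Bg Z) (w : Vec d) (i : Fin n) : ℝ :=
  batchMean (p.g i w) (x.2.1 i)

/-- Softmax weights of the participating clients for the objective. -/
def pWeight (p : FedProblem n d Z) (a : AlgParams) (x : RoundSample n E Bζ Bg Z) (w : Vec d) :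
    Fin n → ℝ :=
  maskedSoftmax x.1 fun i => a.α * p.fEst x w i

/-- Softmax weights of the participating clients for the constraint. -/
def qWeight (p : FedProblem n d Z) (a : AlgParams) (x : RoundSample n E Bζ Bg Z) (w : Vec d) :
    Fin n → ℝ :=
  maskedSoftmax x.1 fun i => a.α * p.gEst x w i

/-- The constraint criterion: the softmax-weighted mean of the constraint estimates. -/
def constraintEst (p : FedProblem n d Z) (a : AlgParams) (x : RoundSample n E Bζ Bg Z)
    (w : Vec d) : ℝ :=
  ∑ i, p.qWeight a x w i * p.gEst x w i

/-- The oracle used in a round: the objective's if the constraint criterion is at most `ε / 2`, the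
constraint's otherwise. -/
def roundOracle (p : FedProblem n d Z) (a : AlgParams) (x : RoundSample n E Bζ Bg Z) (w : Vec d)
    (i : Fin n) : Vec d → Z → Vec d :=
  if p.constraintEst a x w ≤ a.ε / 2 then p.df i else p.dg i

/-- The aggregation weights used in a round. -/
def roundWeight (p : FedProblem n d Z) (a : AlgParams) (x : RoundSample n E Bζ Bg Z) (w : Vec d)
    (i : Fin n) : ℝ :=
  if p.constraintEst a x w ≤ a.ε / 2 then p.pWeight a x w i else p.qWeight a x w i

/-- The local iterates of client `i` in a round started at `w`; step `τ` uses the `τ`-th batch. Only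
the indices `0, …, E` are meaningful. -/
def localIterate (p : FedProblem n d Z) (a : AlgParams) (x : RoundSample n E Bζ Bg Z) (w : Vec d)
    (i : Fin n) : ℕ → Vec d
  | 0 => w
  | τ + 1 =>
    if h : τ < E then
      localIterate p a x w i τ -
        a.γ • batchMean (p.roundOracle a x w i (localIterate p a x w i τ)) (x.2.2 i ⟨τ, h⟩)
    else localIterate p a x w i τ

/-- The local update direction returned by client `i`. -/
def localDirection (p : FedProblem n d Z) (a : AlgParams) (x : RoundSample n E Bζ Bg Z)
    (w : Vec d) (i : Fin n) : Vec d :=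
  (a.γ * E)⁻¹ • (p.localIterate a x w i 0 - p.localIterate a x w i E)

/-- One global round. -/
def globalStep (p : FedProblem n d Z) (a : AlgParams) (x : RoundSample n E Bζ Bg Z) (w : Vec d) :
    Vec d :=
  w - a.η • ∑ i ∈ x.1, p.roundWeight a x w i • p.localDirection a x w i

/-- The global iterates `w_k`, from the initial point `w₀` and the samples of the rounds. -/
def iterate (p : FedProblem n d Z) (a : AlgParams) (w₀ : Vec d)
    (x : ℕ → RoundSample n E Bζ Bg Z) : ℕ → Vec d
  | 0 => w₀
  | k + 1 => p.globalStep a (x k) (iterate p a w₀ x k)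

/-- The set `𝒮` of constraint-satisfied rounds among `0, …, K - 1`. -/
def satisfiedRounds (p : FedProblem n d Z) (a : AlgParams) (w₀ : Vec d) (K : ℕ)
    (x : ℕ → RoundSample n E Bζ Bg Z) : Finset ℕ :=
  (Finset.range K).filter fun k => p.constraintEst a (x k) (p.iterate a w₀ x k) ≤ a.ε / 2

/-- The output `(1/|𝒮|) ∑_{k ∈ 𝒮} w_k`. -/
def output (p : FedProblem n d Z) (a : AlgParams) (w₀ : Vec d) (K : ℕ)
    (x : ℕ → RoundSample n E Bζ Bg Z) : Vec d :=
  ((p.satisfiedRounds a w₀ K x).card : ℝ)⁻¹ •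
    ∑ k ∈ p.satisfiedRounds a w₀ K x, p.iterate a w₀ x k

/-- The constraint-satisfied ratio `κ = |𝒮| / K`. -/
def satisfiedRatio (p : FedProblem n d Z) (a : AlgParams) (w₀ : Vec d) (K : ℕ)
    (x : ℕ → RoundSample n E Bζ Bg Z) : ℝ :=
  ((p.satisfiedRounds a w₀ K x).card : ℝ) / K

/-- All points at which the algorithm evaluates the functions (which live on `Θ`) belong to `Θ`. -/
def StaysIn (p : FedProblem n d Z) (a : AlgParams) (w₀ : Vec d) (K : ℕ)
    (x : ℕ → RoundSample n E Bζ Bg Z) : Prop :=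
  ∀ k < K, p.iterate a w₀ x k ∈ p.Θ ∧
    ∀ i ∈ (x k).1, ∀ τ < E, p.localIterate a (x k) (p.iterate a w₀ x k) i τ ∈ p.Θ

end FedProblem

/-! ### The constants -/

/-- `σ / (|ln(1 - m/n)| n)`, read as `0` under full participation `m = n`, where `|ln 0| = ∞`. -/
def samplingScale (σ : ℝ) (m n : ℕ) : ℝ :=
  if m = n then 0 else σ / (|Real.log (1 - (m : ℝ) / n)| * n)

/-- The square root of the effective variance `(σ_g² / B_g) / (L² E)`. -/
def effNoise (L σg : ℝ) (E Bg : ℕ) : ℝ :=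
  Real.sqrt (σg ^ 2 / Bg / (L ^ 2 * E))

/-- The optimization error `ε'`. -/
def optError (D L σg δ : ℝ) (K E Bg : ℕ) : ℝ :=
  D * L / Real.sqrt (K / 32) *
    (1 + 2 * effNoise L σg E Bg ^ 2 * (3 + 8 * Real.log (8 / δ) / K)
      + effNoise L σg E Bg * Real.sqrt (8 * Real.log (8 / δ)) * (1 + E / Real.sqrt (6 * K)))

/-- The tolerance `ε`: optimization, estimation and client sampling error. -/
def tolerance (D L σζ σg σ δ : ℝ) (K E Bζ Bg m n : ℕ) : ℝ :=
  optError D L σg δ K E Bg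
    + 4 * σζ * Real.sqrt (2 * Real.log (24 * K * m / δ) / Bζ)
    + 4 * samplingScale σ m n * Real.log (32 / δ)

end

/-! Once the weights of a round are fixed, the round is local SGD on a weighted mean of convex
functions. Since `η = γ E`, the new global iterate is the weighted mean of the final local iterates.
Expanding the squared distance to `v = w*` along the local steps and averaging over clients gives a
telescoping bound on the sum over all rounds of the weighted suboptimality `roundGap`, up to one
term linear and one quadratic in the gradient noise (`FedProblem.sum_roundGap_le`). When both noise
terms are controlled, this sum is at most `K ε' / 2` (`le_mul_optError`).

Let `e` bound the errors of the value estimates. A violated round has `roundGap > ε / 2 - e`, and `ε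
/ 2 - e ≥ ε' / 2`, so not every round can be violated. In a satisfied round `roundGap` dominates
`F(w_k) - F(w*)` up to softmax, estimation and sampling errors. The excess of the violated rounds
over `ε' / 2` helps to pay for the sampling errors of the objective, so that the bound on `F` does
not degrade as `κ` decreases. The bound on `G` comes from the criterion itself
(`FedProblem.output_guarantee`).

The distance from the worst client to the best sampled one has an exponential tail, because a
uniform `m`-set avoids `k` given clients with probability at most `(1 - m/n)^k`. The set `𝒮` is
random, so the sum over rounds of exponentials of the gaps is bounded once by Markov; Jensen then
controls the average gap over any subset of rounds. This is the origin of the logarithm of `1/κ`.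

Conditioning on the past is done throughout by integrating out one coordinate of a product measure
(`lintegral_pi_resample`), for samples in a batch, batches in a local run, and rounds. Noise and
gaps are set to `0` outside `Θ`, so their moment bounds hold unconditionally; that the trajectory
stays in `Θ` is used only pathwise, where the truncation is inactive. -/

noncomputable section

/-! ### Centered sub-Gaussian vectors -/

/-- A measurable centered random vector whose norm has a squared-exponential moment. -/
structure CenteredSubGaussian {R V : Type*} [MeasurableSpace R] [NormedAddCommGroup V]
    [InnerProductSpace ℝ V] [MeasurableSpace V] (ν : Measure R) (ξ : R → V) (s : ℝ) : Prop where
  measurable : Measurable ξ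
  integral_eq_zero : ∫ r, ξ r ∂ν = 0
  lintegral_exp_le : ∫⁻ r, ENNReal.ofReal (Real.exp (‖ξ r‖ ^ 2 / s ^ 2)) ∂ν ≤ 2

theorem lintegral_ofReal_le_of_integral_le {R : Type*} [MeasurableSpace R] {ν : Measure R}
    {φ ψ : R → ℝ} {c : ℝ} (hφ : ∀ r, 0 ≤ φ r) (hle : ∀ r, φ r ≤ ψ r) (hψ : Integrable ψ ν)
    (hc : ∫ r, ψ r ∂ν ≤ c) : ∫⁻ r, ENNReal.ofReal (φ r) ∂ν ≤ ENNReal.ofReal c := by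
  calc ∫⁻ r, ENNReal.ofReal (φ r) ∂ν ≤ ∫⁻ r, ENNReal.ofReal (ψ r) ∂ν :=
        lintegral_mono fun r => ENNReal.ofReal_le_ofReal (hle r)
    _ = ENNReal.ofReal (∫ r, ψ r ∂ν) :=
        (ofReal_integral_eq_lintegral_ofReal hψ
          (Filter.Eventually.of_forall fun r => (hφ r).trans (hle r))).symm
    _ ≤ ENNReal.ofReal c := ENNReal.ofReal_le_ofReal hc

theorem integrable_and_integral_le_of_lintegral_le {R : Type*} [MeasurableSpace R] {ν : Measure R}
    {φ : R → ℝ} {c : ℝ} (hm : Measurable φ) (hφ : ∀ r, 0 ≤ φ r) (hc0 : 0 ≤ c)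
    (h : ∫⁻ r, ENNReal.ofReal (φ r) ∂ν ≤ ENNReal.ofReal c) :
    Integrable φ ν ∧ ∫ r, φ r ∂ν ≤ c := by
  have hfin : ∫⁻ r, ENNReal.ofReal (φ r) ∂ν ≠ ⊤ := (h.trans_lt ENNReal.ofReal_lt_top).ne
  have hint : Integrable φ ν :=
    (lintegral_ofReal_ne_top_iff_integrable hm.aestronglyMeasurable
      (Filter.Eventually.of_forall hφ)).1 hfin
  refine ⟨hint, ?_⟩
  rw [integral_eq_lintegral_of_nonneg_ae (Filter.Eventually.of_forall hφ)
    hm.aestronglyMeasurable]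
  exact ENNReal.toReal_le_of_le_ofReal hc0 h

/-- For a centered variable the linear term integrates to zero and only a squared-exponential moment
remains. This converts the assumption into a bound on the moment generating function. -/
theorem Real.exp_le_self_add_exp_sq (x : ℝ) : Real.exp x ≤ x + Real.exp (x ^ 2) := by
  rcases le_or_gt |x| 1 with h | h
  · have h1 := (abs_le.1 (Real.abs_exp_sub_one_sub_id_le h)).2
    linarith [Real.add_one_le_exp (x ^ 2)]
  · rcases lt_abs.1 h with h | h
    · have : Real.exp x ≤ Real.exp (x ^ 2) := Real.exp_le_exp.2 (by nlinarith)
      linarith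
    · have h1 : Real.exp x ≤ 1 := Real.exp_le_one_iff.2 (by linarith)
      nlinarith [Real.add_one_le_exp (x ^ 2)]

/-- The chord of `exp` between `0` and `z`. It passes from the exponential moment of `z` to that of
a fraction of `z`. -/
theorem Real.exp_mul_le_one_add {p : ℝ} (hp0 : 0 ≤ p) (hp1 : p ≤ 1) (z : ℝ) :
    Real.exp (p * z) ≤ 1 + p * (Real.exp z - 1) := by
  have := convexOn_exp.2 (Set.mem_univ z) (Set.mem_univ 0) hp0 (sub_nonneg.2 hp1) (by ring)
  simp only [smul_eq_mul, mul_zero, add_zero, Real.exp_zero, mul_one] at this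
  linarith

theorem integral_one_add_mul_sub_one {R : Type*} [MeasurableSpace R] {ν : Measure R}
    [IsProbabilityMeasure ν] {f : R → ℝ} (hf : Integrable f ν) (p : ℝ) :
    Integrable (fun r => 1 + p * (f r - 1)) ν ∧
      ∫ r, (1 + p * (f r - 1)) ∂ν = 1 + p * (∫ r, f r ∂ν - 1) := by
  have h1 : Integrable (fun r => p * (f r - 1)) ν := (hf.sub (integrable_const 1)).const_mul p
  refine ⟨(integrable_const 1).add h1, ?_⟩
  rw [integral_add (integrable_const 1) h1, integral_const_mul,
    integral_sub hf (integrable_const 1)]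
  simp

namespace CenteredSubGaussian

theorem integrable_exp {R V : Type*} [MeasurableSpace R] [NormedAddCommGroup V]
    [InnerProductSpace ℝ V] [MeasurableSpace V] [BorelSpace V] {ν : Measure R} {ξ : R → V}
    {s : ℝ} (h : CenteredSubGaussian ν ξ s) :
    Integrable (fun r => Real.exp (‖ξ r‖ ^ 2 / s ^ 2)) ν ∧
      ∫ r, Real.exp (‖ξ r‖ ^ 2 / s ^ 2) ∂ν ≤ 2 := by
  have hm := h.measurable
  refine integrable_and_integral_le_of_lintegral_le (by fun_prop) (fun r => (Real.exp_pos _).le)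
    (by norm_num) ?_
  simpa using h.lintegral_exp_le

theorem integrable {R V : Type*} [MeasurableSpace R] [NormedAddCommGroup V]
    [InnerProductSpace ℝ V] [MeasurableSpace V] [BorelSpace V] [SecondCountableTopology V]
    {ν : Measure R} {ξ : R → V} {s : ℝ} (h : CenteredSubGaussian ν ξ s) (hs : 0 < s) : Integrable ξ ν := by
  have hm := h.measurable
  refine Integrable.mono' ((h.integrable_exp.1.const_mul s)) hm.aestronglyMeasurable
    (Filter.Eventually.of_forall fun r => ?_)
  have h1 := Real.add_one_le_exp (‖ξ r‖ ^ 2 / s ^ 2)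
  rw [← div_le_iff₀' hs]
  rw [← div_pow] at h1
  rw [← div_pow]
  nlinarith [sq_nonneg (‖ξ r‖ / s - 1), sq_nonneg (‖ξ r‖ / s)]

variable {R V : Type*} [MeasurableSpace R] [NormedAddCommGroup V] [InnerProductSpace ℝ V]
  [MeasurableSpace V] [BorelSpace V] [SecondCountableTopology V] [CompleteSpace V]
  {ν : Measure R} [IsProbabilityMeasure ν] {ξ : R → V} {s : ℝ}

/-- The moment generating function of a centered sub-Gaussian vector. -/
theorem lintegral_exp_inner_le (h : CenteredSubGaussian ν ξ s) (hs : 0 < s) (x : V) :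
    ∫⁻ r, ENNReal.ofReal (Real.exp (inner ℝ x (ξ r))) ∂ν ≤
      ENNReal.ofReal (Real.exp (‖x‖ ^ 2 * s ^ 2)) := by
  obtain ⟨hi, hle⟩ := h.integrable_exp
  have hξ := h.integrable hs
  have hinner : Integrable (fun r => inner ℝ x (ξ r)) ν := hξ.const_inner x
  have hzero : ∫ r, inner ℝ x (ξ r) ∂ν = 0 := by
    rw [integral_inner hξ, h.integral_eq_zero, inner_zero_right]
  set p := ‖x‖ ^ 2 * s ^ 2 with hp
  have hp0 : 0 ≤ p := by positivity
  have hpz : ∀ r, p * (‖ξ r‖ ^ 2 / s ^ 2) = (‖x‖ * ‖ξ r‖) ^ 2 := fun r => by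
    rw [hp]; field_simp
  have habs : ∀ r, |inner ℝ x (ξ r)| ≤ ‖x‖ * ‖ξ r‖ := fun r => abs_real_inner_le_norm _ _
  -- Write `y` for the inner product and `z = ‖ξ‖² / s²`. For `p ≤ 1`, `exp y ≤ y + exp (y²)` with
  -- `y² ≤ p z` gives the mean bound `1 + p ≤ exp p`. For `p > 1`, Young gives `y ≤ p/2 + z/2`, and
  -- the mean is at most `(3/2) exp (p/2) ≤ exp p`.
  rcases le_or_gt p 1 with h1 | h1
  · refine lintegral_ofReal_le_of_integral_le
      (ψ := fun r => inner ℝ x (ξ r) + (1 + p * (Real.exp (‖ξ r‖ ^ 2 / s ^ 2) - 1)))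
      (fun r => (Real.exp_pos _).le) (fun r => ?_) ?_ ?_
    · refine (Real.exp_le_self_add_exp_sq _).trans (add_le_add_right ?_ _)
      refine le_trans (Real.exp_le_exp.2 ?_) (Real.exp_mul_le_one_add hp0 h1 _)
      rw [hpz, ← sq_abs]
      exact pow_le_pow_left₀ (abs_nonneg _) (habs r) 2
    · exact hinner.add (integral_one_add_mul_sub_one hi p).1
    · rw [integral_add hinner (integral_one_add_mul_sub_one hi p).1, hzero,
        (integral_one_add_mul_sub_one hi p).2]
      nlinarith [Real.add_one_le_exp p]
  · refine lintegral_ofReal_le_of_integral_le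
      (ψ := fun r => Real.exp (p / 2) * ((1 + Real.exp (‖ξ r‖ ^ 2 / s ^ 2)) / 2))
      (fun r => (Real.exp_pos _).le) (fun r => ?_) ?_ ?_
    · have h2 : inner ℝ x (ξ r) ≤ p / 2 + (1 / 2) * (‖ξ r‖ ^ 2 / s ^ 2) := by
        refine (le_abs_self _).trans ((habs r).trans ?_)
        have : ‖x‖ * ‖ξ r‖ = (‖x‖ * s) * (‖ξ r‖ / s) := by field_simp
        rw [this, ← div_pow, hp, ← mul_pow]
        nlinarith [sq_nonneg (‖x‖ * s - ‖ξ r‖ / s)]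
      refine (Real.exp_le_exp.2 h2).trans ?_
      rw [Real.exp_add]
      refine mul_le_mul_of_nonneg_left ?_ (Real.exp_pos _).le
      linarith [Real.exp_mul_le_one_add (by norm_num : (0 : ℝ) ≤ 1 / 2) (by norm_num)
        (‖ξ r‖ ^ 2 / s ^ 2)]
    · exact (((integrable_const _).add hi).div_const 2).const_mul _
    · rw [integral_const_mul, integral_div, integral_add (integrable_const _) hi]
      simp only [integral_const, probReal_univ, smul_eq_mul, mul_one]
      have h3 : Real.exp p = Real.exp (p / 2) * Real.exp (p / 2) := by
        rw [← Real.exp_add]; ring_nf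
      rw [h3]
      refine mul_le_mul_of_nonneg_left ?_ (Real.exp_pos _).le
      linarith [Real.add_one_le_exp (p / 2)]

/-- Adding a centered sub-Gaussian vector to a fixed one inside a squared-exponential moment. -/
theorem lintegral_exp_norm_add_sq_le (h : CenteredSubGaussian ν ξ s) (hs : 0 < s) (x : V) {a : ℝ}
    (ha : 0 ≤ a) (has : 2 * a * s ^ 2 ≤ 1) :
    ∫⁻ r, ENNReal.ofReal (Real.exp (a * ‖x + ξ r‖ ^ 2)) ∂ν ≤
      ENNReal.ofReal (Real.exp (a * (1 + 8 * a * s ^ 2) * ‖x‖ ^ 2 + a * s ^ 2)) := by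
  obtain ⟨hi, hle⟩ := h.integrable_exp
  have hm := h.measurable
  -- `P` and `Q` bound the log-moments of the doubled exponents `4a⟨x, ξ⟩` and `2a‖ξ‖²`.
  -- Cauchy–Schwarz would give `exp ((P + Q) / 2)` for the cross terms; the weights `c₁`, `c₂` below
  -- give the same value pointwise through a balanced AM–GM.
  set P := 16 * a ^ 2 * ‖x‖ ^ 2 * s ^ 2 with hP
  set Q := 2 * a * s ^ 2 with hQ
  have hQ0 : 0 ≤ Q := by positivity
  have h1 : ∫⁻ r, ENNReal.ofReal (Real.exp (inner ℝ ((4 * a) • x) (ξ r))) ∂ν ≤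
      ENNReal.ofReal (Real.exp P) := by
    refine (h.lintegral_exp_inner_le hs ((4 * a) • x)).trans_eq ?_
    rw [norm_smul, Real.norm_of_nonneg (by positivity), hP]
    ring_nf
  have h2 : ∫⁻ r, ENNReal.ofReal (Real.exp (2 * a * ‖ξ r‖ ^ 2)) ∂ν ≤
      ENNReal.ofReal (Real.exp Q) := by
    refine lintegral_ofReal_le_of_integral_le
      (ψ := fun r => 1 + Q * (Real.exp (‖ξ r‖ ^ 2 / s ^ 2) - 1))
      (fun r => (Real.exp_pos _).le) (fun r => ?_) ?_ ?_
    · have : 2 * a * ‖ξ r‖ ^ 2 = Q * (‖ξ r‖ ^ 2 / s ^ 2) := by rw [hQ]; field_simp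
      rw [this]
      exact Real.exp_mul_le_one_add hQ0 has _
    · exact (integral_one_add_mul_sub_one hi Q).1
    · rw [(integral_one_add_mul_sub_one hi Q).2]
      nlinarith [Real.add_one_le_exp Q]
  set c₁ := Real.exp (a * ‖x‖ ^ 2 + (Q - P) / 2) / 2 with hc₁
  set c₂ := Real.exp (a * ‖x‖ ^ 2 + (P - Q) / 2) / 2 with hc₂
  have hc₁0 : 0 ≤ c₁ := by positivity
  have hc₂0 : 0 ≤ c₂ := by positivity
  have hpt : ∀ r, Real.exp (a * ‖x + ξ r‖ ^ 2) ≤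
      c₁ * Real.exp (inner ℝ ((4 * a) • x) (ξ r)) + c₂ * Real.exp (2 * a * ‖ξ r‖ ^ 2) := by
    intro r
    set u := 2 * a * inner ℝ x (ξ r) with hu
    set v := a * ‖ξ r‖ ^ 2 with hv
    have e1 : a * ‖x + ξ r‖ ^ 2 = a * ‖x‖ ^ 2 + u + v := by
      rw [norm_add_sq_real]; ring
    have e2 : (inner ℝ ((4 * a) • x) (ξ r) : ℝ) = 2 * u := by
      rw [real_inner_smul_left]; ring
    have e3 : 2 * a * ‖ξ r‖ ^ 2 = 2 * v := by ring
    rw [e1, e2, e3, hc₁, hc₂, div_mul_eq_mul_div, div_mul_eq_mul_div, ← Real.exp_add,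
      ← Real.exp_add]
    have e4 : Real.exp (a * ‖x‖ ^ 2 + (Q - P) / 2 + 2 * u) =
        Real.exp (a * ‖x‖ ^ 2 / 2 + (Q - P) / 4 + u) ^ 2 := by
      rw [← Real.exp_nat_mul]; congr 1; push_cast; ring
    have e5 : Real.exp (a * ‖x‖ ^ 2 + (P - Q) / 2 + 2 * v) =
        Real.exp (a * ‖x‖ ^ 2 / 2 + (P - Q) / 4 + v) ^ 2 := by
      rw [← Real.exp_nat_mul]; congr 1; push_cast; ring
    have e6 : Real.exp (a * ‖x‖ ^ 2 + u + v) =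
        Real.exp (a * ‖x‖ ^ 2 / 2 + (Q - P) / 4 + u) *
          Real.exp (a * ‖x‖ ^ 2 / 2 + (P - Q) / 4 + v) := by
      rw [← Real.exp_add]; congr 1; ring
    rw [e4, e5, e6]
    nlinarith [sq_nonneg (Real.exp (a * ‖x‖ ^ 2 / 2 + (Q - P) / 4 + u) -
      Real.exp (a * ‖x‖ ^ 2 / 2 + (P - Q) / 4 + v))]
  calc ∫⁻ r, ENNReal.ofReal (Real.exp (a * ‖x + ξ r‖ ^ 2)) ∂ν
      ≤ ∫⁻ r, (ENNReal.ofReal c₁ * ENNReal.ofReal (Real.exp (inner ℝ ((4 * a) • x) (ξ r))) +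
          ENNReal.ofReal c₂ * ENNReal.ofReal (Real.exp (2 * a * ‖ξ r‖ ^ 2))) ∂ν := by
        refine lintegral_mono fun r => ?_
        rw [← ENNReal.ofReal_mul hc₁0, ← ENNReal.ofReal_mul hc₂0,
          ← ENNReal.ofReal_add (by positivity) (by positivity)]
        exact ENNReal.ofReal_le_ofReal (hpt r)
    _ = ENNReal.ofReal c₁ * ∫⁻ r, ENNReal.ofReal (Real.exp (inner ℝ ((4 * a) • x) (ξ r))) ∂ν +
          ENNReal.ofReal c₂ * ∫⁻ r, ENNReal.ofReal (Real.exp (2 * a * ‖ξ r‖ ^ 2)) ∂ν := by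
        rw [lintegral_add_left (by fun_prop), lintegral_const_mul _ (by fun_prop),
          lintegral_const_mul _ (by fun_prop)]
    _ ≤ ENNReal.ofReal c₁ * ENNReal.ofReal (Real.exp P) +
          ENNReal.ofReal c₂ * ENNReal.ofReal (Real.exp Q) := by gcongr
    _ = ENNReal.ofReal (Real.exp (a * (1 + 8 * a * s ^ 2) * ‖x‖ ^ 2 + a * s ^ 2)) := by
        rw [← ENNReal.ofReal_mul hc₁0, ← ENNReal.ofReal_mul hc₂0,
          ← ENNReal.ofReal_add (by positivity) (by positivity), hc₁, hc₂, div_mul_eq_mul_div,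
          div_mul_eq_mul_div, ← Real.exp_add, ← Real.exp_add]
        have e1 : a * ‖x‖ ^ 2 + (Q - P) / 2 + P =
            a * (1 + 8 * a * s ^ 2) * ‖x‖ ^ 2 + a * s ^ 2 := by rw [hP, hQ]; ring
        have e2 : a * ‖x‖ ^ 2 + (P - Q) / 2 + Q =
            a * (1 + 8 * a * s ^ 2) * ‖x‖ ^ 2 + a * s ^ 2 := by rw [hP, hQ]; ring
        rw [e1, e2, add_halves]

end CenteredSubGaussian

/-! ### Resampling one coordinate of a product measure -/

/-- The substitute for conditional expectation: the inner integral averages over one coordinate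
while all others are frozen. Applied to the newest coordinate it handles adapted processes without a
filtration. -/
theorem lintegral_pi_resample {N : ℕ} {R : Type*} [MeasurableSpace R] (μ : Measure R)
    [IsProbabilityMeasure μ] {f : (Fin N → R) → ENNReal} (hf : Measurable f) (i : Fin N) :
    ∫⁻ s, f s ∂(Measure.pi fun _ => μ) =
      ∫⁻ s, ∫⁻ r, f (Function.update s i r) ∂μ ∂(Measure.pi fun _ => μ) := by
  classical
  rcases isEmpty_or_nonempty (Fin N → R) with hE | ⟨⟨x₀⟩⟩
  · simp [lintegral_of_isEmpty]
  have hg : Measurable fun s : Fin N → R => ∫⁻ r, f (Function.update s i r) ∂μ := by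
    have := hf.lmarginal (μ := fun _ => μ) (s := {i})
    rwa [lmarginal_singleton] at this
  rw [lintegral_eq_lmarginal_univ x₀, lintegral_eq_lmarginal_univ x₀,
    lmarginal_erase' _ hf (Finset.mem_univ i), lmarginal_erase' _ hg (Finset.mem_univ i)]
  simp

/-- A supermartingale induction. That `V t` reads only the first `t` coordinates need not be said
separately: the step inequality for every `s` suffices. -/
theorem lintegral_pi_le_pow_mul {N : ℕ} {R : Type*} [MeasurableSpace R] (μ : Measure R)
    [IsProbabilityMeasure μ] (V : ℕ → (Fin N → R) → ENNReal) (hV : ∀ t, Measurable (V t))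
    (c : ENNReal)
    (hstep : ∀ t (ht : t < N) s, ∫⁻ r, V (t + 1) (Function.update s ⟨t, ht⟩ r) ∂μ ≤ c * V t s) :
    ∀ T ≤ N, ∫⁻ s, V T s ∂(Measure.pi fun _ => μ) ≤
      c ^ T * ∫⁻ s, V 0 s ∂(Measure.pi fun _ => μ) := by
  intro T
  induction T with
  | zero => simp
  | succ T ih =>
    intro hT
    rw [lintegral_pi_resample μ (hV (T + 1)) ⟨T, hT⟩]
    calc _ ≤ ∫⁻ s, c * V T s ∂(Measure.pi fun _ => μ) := lintegral_mono fun s => hstep T hT s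
      _ = c * ∫⁻ s, V T s ∂(Measure.pi fun _ => μ) := lintegral_const_mul _ (hV T)
      _ ≤ c * (c ^ T * ∫⁻ s, V 0 s ∂(Measure.pi fun _ => μ)) := by
          gcongr; exact ih (by omega)
      _ = _ := by rw [pow_succ]; ring

/-- Exponential moments of an adapted sum of scalars. -/
theorem lintegral_exp_adapted_sum_le {N : ℕ} {R : Type*} [MeasurableSpace R] (μ : Measure R)
    [IsProbabilityMeasure μ] (S : ℕ → (Fin N → R) → ℝ) (hS : ∀ t, Measurable (S t))
    (h0 : ∀ s, S 0 s = 0) {c : ℝ}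
    (hstep : ∀ t (ht : t < N) s, ∃ ξ : R → ℝ,
      ∫⁻ r, ENNReal.ofReal (Real.exp (ξ r)) ∂μ ≤ ENNReal.ofReal (Real.exp c) ∧
      ∀ r, S (t + 1) (Function.update s ⟨t, ht⟩ r) = S t s + ξ r) :
    ∫⁻ s, ENNReal.ofReal (Real.exp (S N s)) ∂(Measure.pi fun _ => μ) ≤
      ENNReal.ofReal (Real.exp (N * c)) := by
  have := lintegral_pi_le_pow_mul μ (fun t s => ENNReal.ofReal (Real.exp (S t s)))
    (fun t => by have := hS t; fun_prop) (ENNReal.ofReal (Real.exp c)) (fun t ht s => by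
      obtain ⟨ξ, hξ, hu⟩ := hstep t ht s
      simp only [hu, Real.exp_add, ENNReal.ofReal_mul (Real.exp_pos _).le]
      rw [lintegral_const_mul' _ _ ENNReal.ofReal_ne_top, mul_comm]
      gcongr) N le_rfl
  refine this.trans_eq ?_
  simp only [h0, Real.exp_zero, ENNReal.ofReal_one, lintegral_const, measure_univ, mul_one]
  rw [← ENNReal.ofReal_pow (Real.exp_pos _).le, Real.exp_nat_mul]

/-- Squared-exponential moments of an adapted sum of centered sub-Gaussian vectors. -/
theorem lintegral_exp_norm_sq_adapted_sum_le {N : ℕ} {R V : Type*} [MeasurableSpace R]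
    [NormedAddCommGroup V] [InnerProductSpace ℝ V] [MeasurableSpace V] [BorelSpace V]
    [SecondCountableTopology V] [CompleteSpace V] (μ : Measure R) [IsProbabilityMeasure μ]
    (S : ℕ → (Fin N → R) → V) (hS : ∀ t, Measurable (S t)) (h0 : ∀ s, S 0 s = 0) {σ : ℝ}
    (hσ : 0 < σ)
    (hstep : ∀ t (ht : t < N) s, ∃ ξ : R → V, CenteredSubGaussian μ ξ σ ∧
      ∀ r, S (t + 1) (Function.update s ⟨t, ht⟩ r) = S t s + ξ r)
    {T : ℕ} (hT : T ≤ N) (hN : 1 ≤ N) :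
    ∫⁻ s, ENNReal.ofReal (Real.exp (‖S T s‖ ^ 2 / (16 * N * σ ^ 2))) ∂(Measure.pi fun _ => μ) ≤
      ENNReal.ofReal (Real.exp (1 / 8)) := by
  have hN' : (1 : ℝ) ≤ N := by exact_mod_cast hN
  -- Each new summand inflates the coefficient of `‖S‖²` by the factor `1 + 8aσ²`. Coefficients
  -- decreasing from `1/(8Nσ²)` to `1/(16Nσ²)` absorb this because `(N+t)(N+t+2) ≤ (N+t+1)²`, and
  -- the additive terms `aσ² ≤ 1/(8N)` total at most `1/8`.
  set a : ℕ → ℝ := fun t => 1 / (8 * σ ^ 2 * (N + t)) with ha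
  have ha0 : ∀ t, 0 ≤ a t := fun t => by rw [ha]; positivity
  have hale : ∀ t, a t * σ ^ 2 ≤ 1 / (8 * N) := fun t => by
    have : a t * σ ^ 2 = 1 / (8 * (N + t)) := by rw [ha]; field_simp
    rw [this]
    apply one_div_le_one_div_of_le (by positivity)
    have : (0 : ℝ) ≤ t := by positivity
    linarith
  have hN8 : (1 : ℝ) / (8 * N) ≤ 1 / 8 := one_div_le_one_div_of_le (by norm_num) (by linarith)
  have hrec : ∀ t : ℕ, a (t + 1) * (1 + 8 * a (t + 1) * σ ^ 2) ≤ a t := fun t => by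
    have ht : (0 : ℝ) ≤ t := by positivity
    have e : a (t + 1) * (1 + 8 * a (t + 1) * σ ^ 2) =
        (N + t + 2) / (8 * σ ^ 2 * (N + t + 1) ^ 2) := by
      simp only [ha]; push_cast; field_simp; ring
    rw [e]
    simp only [ha]
    rw [div_le_div_iff₀ (by positivity) (by positivity)]
    have : 0 < σ ^ 2 := by positivity
    nlinarith
  have := lintegral_pi_le_pow_mul μ (fun t s => ENNReal.ofReal (Real.exp (a t * ‖S t s‖ ^ 2)))
    (fun t => by have := hS t; fun_prop) (ENNReal.ofReal (Real.exp (1 / (8 * N))))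
    (fun t ht s => by
      obtain ⟨ξ, hξ, hu⟩ := hstep t ht s
      simp only [hu]
      refine (hξ.lintegral_exp_norm_add_sq_le hσ (S t s) (ha0 (t + 1)) ?_).trans ?_
      · linarith [hale (t + 1)]
      · rw [← ENNReal.ofReal_mul (Real.exp_pos _).le, ← Real.exp_add]
        refine ENNReal.ofReal_le_ofReal (Real.exp_le_exp.2 ?_)
        have := mul_le_mul_of_nonneg_right (hrec t) (sq_nonneg ‖S t s‖)
        linarith [hale (t + 1)]) T hT
  simp only [h0, norm_zero, ne_eq, OfNat.ofNat_ne_zero, not_false_eq_true, zero_pow, mul_zero,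
    Real.exp_zero, ENNReal.ofReal_one, lintegral_const, measure_univ, mul_one] at this
  rw [← ENNReal.ofReal_pow (Real.exp_pos _).le, ← Real.exp_nat_mul] at this
  have hTN : (T : ℝ) ≤ N := by exact_mod_cast hT
  refine (lintegral_mono fun s => ?_).trans (this.trans ?_)
  · refine ENNReal.ofReal_le_ofReal (Real.exp_le_exp.2 ?_)
    rw [div_eq_mul_one_div, mul_comm]
    refine mul_le_mul_of_nonneg_right ?_ (sq_nonneg _)
    exact one_div_le_one_div_of_le (by positivity) (by nlinarith [sq_nonneg σ])
  · refine ENNReal.ofReal_le_ofReal (Real.exp_le_exp.2 ?_)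
    rw [mul_one_div, div_le_div_iff₀ (by positivity) (by norm_num)]
    linarith


/-! ### Batch averages -/

/-- The sum of `ξ` over the first `t` samples of a batch. -/
def partialSum {B : ℕ} {Z V : Type*} [AddCommMonoid V] (ξ : Z → V) (t : ℕ) (s : Fin B → Z) : V :=
  ∑ b : Fin B, if b.val < t then ξ (s b) else 0

theorem partialSum_update {B : ℕ} {Z V : Type*} [AddCommMonoid V] (ξ : Z → V) {t : ℕ} (ht : t < B)
    (s : Fin B → Z) (r : Z) :
    partialSum ξ (t + 1) (Function.update s ⟨t, ht⟩ r) = partialSum ξ t s + ξ r := by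
  have : ∀ b : Fin B, (if b.val < t + 1 then ξ (Function.update s ⟨t, ht⟩ r b) else 0) =
      (if b.val < t then ξ (s b) else 0) + if b = ⟨t, ht⟩ then ξ r else 0 := by
    intro b
    rcases lt_trichotomy b.val t with h | h | h
    · have hb : b ≠ ⟨t, ht⟩ := fun e => by simp [e] at h
      simp [h, hb, h.trans (Nat.lt_succ_self t)]
    · have hb : b = ⟨t, ht⟩ := Fin.ext h
      subst hb; simp
    · have hb : b ≠ ⟨t, ht⟩ := fun e => by simp [e] at h
      simp [hb, not_lt.2 h.le, not_lt.2 (Nat.succ_le_of_lt h)]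
  simp only [partialSum, this, Finset.sum_add_distrib, Finset.sum_ite_eq', Finset.mem_univ,
    if_true]

theorem partialSum_zero {B : ℕ} {Z V : Type*} [AddCommMonoid V] (ξ : Z → V) (s : Fin B → Z) :
    partialSum ξ 0 s = 0 := by
  simp [partialSum]

theorem batchMean_eq_partialSum {B : ℕ} {Z V : Type*} [AddCommGroup V] [Module ℝ V] (ξ : Z → V)
    (s : Fin B → Z) : batchMean ξ s = (B : ℝ)⁻¹ • partialSum ξ B s := by
  simp [batchMean, partialSum]

theorem measurable_partialSum {B : ℕ} {Z V : Type*} [MeasurableSpace Z] [AddCommMonoid V]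
    [MeasurableSpace V] [MeasurableAdd₂ V] {ξ : Z → V} (hξ : Measurable ξ) (t : ℕ) :
    Measurable (partialSum ξ t : (Fin B → Z) → V) := by
  refine Finset.measurable_sum _ fun b _ => ?_
  split_ifs
  · exact hξ.comp (measurable_pi_apply b)
  · exact measurable_const

theorem batchMean_sub_const {B : ℕ} (hB : 1 ≤ B) {Z V : Type*} [AddCommGroup V] [Module ℝ V]
    (f : Z → V) (c : V) (s : Fin B → Z) : batchMean (fun z => f z - c) s = batchMean f s - c := by
  have : (B : ℝ) ≠ 0 := by positivity
  simp only [batchMean, Finset.sum_sub_distrib, smul_sub, Finset.sum_const, Finset.card_univ,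
    Fintype.card_fin]
  rw [← Nat.cast_smul_eq_nsmul ℝ, smul_smul, inv_mul_cancel₀ this, one_smul]

theorem Real.exp_one_eighth_le_two : Real.exp (1 / 8) ≤ 2 := by
  have h : Real.exp (1 / 8) ≤ Real.exp (Real.log 2) :=
    Real.exp_le_exp.2 (by linarith [Real.log_two_gt_d9])
  rwa [Real.exp_log (by norm_num)] at h

/-- The batch average of a centered sub-Gaussian vector. -/
theorem CenteredSubGaussian.batchMean {Z V : Type*} [MeasurableSpace Z] [NormedAddCommGroup V]
    [InnerProductSpace ℝ V] [MeasurableSpace V] [BorelSpace V] [SecondCountableTopology V]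
    [CompleteSpace V] {ν : Measure Z} [IsProbabilityMeasure ν] {ξ : Z → V} {σ : ℝ}
    (h : CenteredSubGaussian ν ξ σ) (hσ : 0 < σ) {B : ℕ} (hB : 1 ≤ B) :
    CenteredSubGaussian (Measure.pi fun _ : Fin B => ν) (fun s => _root_.batchMean ξ s)
      (4 * σ / Real.sqrt B) where
  measurable := by
    simp only [batchMean_eq_partialSum]
    exact (measurable_partialSum h.measurable B).const_smul _
  integral_eq_zero := by
    have hp := fun b : Fin B => measurePreserving_eval (fun _ : Fin B => ν) b
    have hint : ∀ b : Fin B, Integrable (fun s : Fin B → Z => ξ (s b))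
        (Measure.pi fun _ : Fin B => ν) := fun b =>
      (hp b).integrable_comp_of_integrable (h.integrable hσ)
    simp only [_root_.batchMean]
    rw [integral_smul, integral_finsetSum _ fun b _ => hint b]
    have : ∀ b : Fin B, ∫ s : Fin B → Z, ξ (s b) ∂(Measure.pi fun _ : Fin B => ν) = 0 := fun b => by
      have := integral_map (μ := Measure.pi fun _ : Fin B => ν)
        (hp b).measurable.aemeasurable (f := ξ) h.measurable.aestronglyMeasurable
      rw [(hp b).map_eq, h.integral_eq_zero] at this
      exact this.symm
    simp [this]
  lintegral_exp_le := by
    have hB' : (0 : ℝ) < B := by exact_mod_cast hB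
    have := lintegral_exp_norm_sq_adapted_sum_le ν (partialSum ξ : ℕ → (Fin B → Z) → V)
      (measurable_partialSum h.measurable) (partialSum_zero ξ) hσ
      (fun t ht s => ⟨ξ, h, partialSum_update ξ ht s⟩) le_rfl hB
    -- The scale `4σ/√B` is the one that turns the normalized square of the mean into that of the
    -- sum, with the constant `16Bσ²` of the adapted-sum bound.
    have e : ∀ s : Fin B → Z, ‖_root_.batchMean ξ s‖ ^ 2 / (4 * σ / Real.sqrt B) ^ 2 =
        ‖partialSum ξ B s‖ ^ 2 / (16 * B * σ ^ 2) := fun s => by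
      rw [batchMean_eq_partialSum, norm_smul, Real.norm_of_nonneg (by positivity), mul_pow,
        div_pow, Real.sq_sqrt hB'.le]
      field_simp
      norm_num
    simp only [e]
    refine this.trans ?_
    exact (ENNReal.ofReal_le_ofReal Real.exp_one_eighth_le_two).trans_eq (by simp)

theorem measure_le_of_lintegral_exp_le {R : Type*} [MeasurableSpace R] {ν : Measure R}
    {φ : R → ℝ} (hφ : Measurable φ) {c : ℝ}
    (h : ∫⁻ r, ENNReal.ofReal (Real.exp (φ r)) ∂ν ≤ ENNReal.ofReal (Real.exp c)) (t : ℝ) :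
    ν {r | t ≤ φ r} ≤ ENNReal.ofReal (Real.exp (c - t)) := by
  have h1 : {r | t ≤ φ r} =
      {r | ENNReal.ofReal (Real.exp t) ≤ ENNReal.ofReal (Real.exp (φ r))} := by
    ext r
    simp [ENNReal.ofReal_le_ofReal_iff (Real.exp_pos _).le]
  rw [h1]
  refine (meas_ge_le_lintegral_div (by fun_prop) ?_ ENNReal.ofReal_ne_top).trans ?_
  · simp [Real.exp_pos]
  · rw [Real.exp_sub, ENNReal.ofReal_div_of_pos (Real.exp_pos _)]
    gcongr

/-- Two-sided tail of the batch average of a centered sub-Gaussian scalar. -/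
theorem CenteredSubGaussian.measure_abs_batchMean_ge_le {Z : Type*} [MeasurableSpace Z]
    {ν : Measure Z} [IsProbabilityMeasure ν] {ξ : Z → ℝ} {σ : ℝ}
    (h : CenteredSubGaussian ν ξ σ) (hσ : 0 < σ) {B : ℕ} (hB : 1 ≤ B) {t : ℝ} (ht : 0 ≤ t) :
    (Measure.pi fun _ : Fin B => ν) {s | t ≤ |_root_.batchMean ξ s|} ≤
      ENNReal.ofReal (2 * Real.exp (-(B * t ^ 2 / (4 * σ ^ 2)))) := by
  have hB' : (0 : ℝ) < B := by exact_mod_cast hB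
  have key : ∀ l : ℝ, ∫⁻ s : Fin B → Z, ENNReal.ofReal (Real.exp (l * partialSum ξ B s))
      ∂(Measure.pi fun _ : Fin B => ν) ≤ ENNReal.ofReal (Real.exp (B * (l ^ 2 * σ ^ 2))) := by
    intro l
    refine lintegral_exp_adapted_sum_le ν (fun t s => l * partialSum ξ t s)
      (fun t => (measurable_partialSum h.measurable t).const_mul l)
      (fun s => by simp [partialSum_zero]) fun t ht s => ⟨fun r => l * ξ r, ?_, fun r => ?_⟩
    · have := h.lintegral_exp_inner_le hσ l
      simpa [mul_comm, Real.norm_eq_abs] using this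
    · simp only [partialSum_update ξ ht]; ring
  have hm : Measurable (partialSum ξ B : (Fin B → Z) → ℝ) := measurable_partialSum h.measurable B
  -- The minimizer of the Chernoff exponent `B l² σ² - l B t`.
  set l := t / (2 * σ ^ 2) with hl
  have hsub : {s : Fin B → Z | t ≤ |_root_.batchMean ξ s|} ⊆
      {s | l * (B * t) ≤ l * partialSum ξ B s} ∪ {s | l * (B * t) ≤ (-l) * partialSum ξ B s} := by
    intro s hs
    have hl0 : 0 ≤ l := by positivity
    simp only [Set.mem_ofPred_eq, batchMean_eq_partialSum, smul_eq_mul] at hs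
    have : B * t ≤ |partialSum ξ B s| := by
      rw [abs_mul, abs_of_pos (inv_pos.2 hB'), ← div_eq_inv_mul, le_div_iff₀ hB'] at hs
      linarith
    rcases le_abs.1 this with h1 | h1
    · exact Or.inl (mul_le_mul_of_nonneg_left h1 hl0)
    · refine Or.inr ?_
      simp only [Set.mem_ofPred_eq]
      nlinarith
  have e : B * (l ^ 2 * σ ^ 2) - l * (B * t) = -(B * t ^ 2 / (4 * σ ^ 2)) := by
    rw [hl]; field_simp; ring
  refine (measure_mono hsub).trans ?_
  refine (measure_union_le _ _).trans ?_
  rw [two_mul, ENNReal.ofReal_add (Real.exp_pos _).le (Real.exp_pos _).le]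
  refine add_le_add ?_ ?_
  · rw [← e]
    exact measure_le_of_lintegral_exp_le (hm.const_mul l) (key l) _
  · rw [← e, ← neg_sq l]
    exact measure_le_of_lintegral_exp_le (hm.const_mul (-l)) (key (-l)) _

/-! ### Local steps -/

section LocalPath

variable {d E B : ℕ} {Z : Type*}

/-- The local iterates of stochastic gradient descent with oracle `dh`. -/
def localPath (dh : Vec d → Z → Vec d) (γ : ℝ) (w : Vec d) (s : Fin E → Fin B → Z) : ℕ → Vec d
  | 0 => w
  | τ + 1 =>
    if h : τ < E then
      localPath dh γ w s τ - γ • batchMean (dh (localPath dh γ w s τ)) (s ⟨τ, h⟩)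
    else localPath dh γ w s τ

open scoped Classical in
/-- The deviation of the `τ`-th batch gradient from its mean `g`, set to `0` outside `Θ`. -/
def localNoise (Θ : Set (Vec d)) (dh : Vec d → Z → Vec d) (g : Vec d → Vec d) (γ : ℝ) (w : Vec d)
    (s : Fin E → Fin B → Z) (τ : ℕ) : Vec d :=
  if h : τ < E then
    if localPath dh γ w s τ ∈ Θ then
      batchMean (dh (localPath dh γ w s τ)) (s ⟨τ, h⟩) - g (localPath dh γ w s τ)
    else 0
  else 0

/-- Adaptedness: the iterates up to time `t` read only the batches before the `t`-th. -/
theorem localPath_update (dh : Vec d → Z → Vec d) (γ : ℝ) (w : Vec d) (s : Fin E → Fin B → Z)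
    {t : ℕ} (ht : t < E) (r : Fin B → Z) :
    ∀ j ≤ t, localPath dh γ w (Function.update s ⟨t, ht⟩ r) j = localPath dh γ w s j := by
  intro j
  induction j with
  | zero => intro _; rfl
  | succ j ih =>
    intro hj
    have hne : (⟨j, by omega⟩ : Fin E) ≠ ⟨t, ht⟩ := fun e => by
      have := congrArg Fin.val e; simp at this; omega
    simp only [localPath, ih (by omega), Function.update_of_ne hne]

theorem localNoise_update_of_lt (Θ : Set (Vec d)) (dh : Vec d → Z → Vec d) (g : Vec d → Vec d)
    (γ : ℝ) (w : Vec d) (s : Fin E → Fin B → Z) {t : ℕ} (ht : t < E) (r : Fin B → Z) {j : ℕ}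
    (hj : j < t) :
    localNoise Θ dh g γ w (Function.update s ⟨t, ht⟩ r) j = localNoise Θ dh g γ w s j := by
  have hne : (⟨j, hj.trans ht⟩ : Fin E) ≠ ⟨t, ht⟩ := fun e => by
    have := congrArg Fin.val e; simp at this; omega
  have e := localPath_update dh γ w s ht r j hj.le
  classical
  simp only [localNoise, e, hj.trans ht, dite_true, Function.update_of_ne hne]

open scoped Classical in
theorem localNoise_update_self (Θ : Set (Vec d)) (dh : Vec d → Z → Vec d) (g : Vec d → Vec d)
    (γ : ℝ) (w : Vec d) (s : Fin E → Fin B → Z) {t : ℕ} (ht : t < E) (r : Fin B → Z) :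
    localNoise Θ dh g γ w (Function.update s ⟨t, ht⟩ r) t =
      if localPath dh γ w s t ∈ Θ then
        batchMean (dh (localPath dh γ w s t)) r - g (localPath dh γ w s t) else 0 := by
  simp only [localNoise, localPath_update dh γ w s ht r t le_rfl, ht, dite_true,
    Function.update_self]

variable [MeasurableSpace Z]

theorem measurable_batchMean {V W : Type*} [MeasurableSpace W] [AddCommGroup V] [Module ℝ V]
    [MeasurableSpace V] [MeasurableAdd₂ V] [MeasurableConstSMul ℝ V] {h : W → Z → V}
    (hh : Measurable fun q : W × Z => h q.1 q.2) :
    Measurable fun q : W × (Fin B → Z) => batchMean (h q.1) q.2 := by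
  refine (Finset.measurable_sum _ fun b _ => ?_).const_smul _
  exact hh.comp (measurable_fst.prodMk ((measurable_pi_apply b).comp measurable_snd))

theorem measurable_localPath {dh : Vec d → Z → Vec d}
    (hdh : Measurable fun q : Vec d × Z => dh q.1 q.2) (γ : ℝ) (τ : ℕ) :
    Measurable fun q : Vec d × (Fin E → Fin B → Z) => localPath dh γ q.1 q.2 τ := by
  induction τ with
  | zero => exact measurable_fst
  | succ τ ih =>
    simp only [localPath]
    split_ifs with h
    · refine ih.sub (Measurable.const_smul ?_ γ)
      exact (measurable_batchMean hdh).comp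
        (ih.prodMk ((measurable_pi_apply _).comp measurable_snd))
    · exact ih

theorem measurable_localNoise {Θ : Set (Vec d)} (hΘ : MeasurableSet Θ) {dh : Vec d → Z → Vec d}
    (hdh : Measurable fun q : Vec d × Z => dh q.1 q.2) {g : Vec d → Vec d} (hg : Measurable g)
    (γ : ℝ) (τ : ℕ) :
    Measurable fun q : Vec d × (Fin E → Fin B → Z) => localNoise Θ dh g γ q.1 q.2 τ := by
  have hp := measurable_localPath (E := E) (B := B) hdh γ τ
  simp only [localNoise]
  split_ifs with h
  · refine Measurable.ite (hp hΘ) ?_ measurable_const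
    exact ((measurable_batchMean hdh).comp
      (hp.prodMk ((measurable_pi_apply _).comp measurable_snd))).sub (hg.comp hp)
  · exact measurable_const

theorem CenteredSubGaussian.zero {R V : Type*} [MeasurableSpace R] [NormedAddCommGroup V]
    [InnerProductSpace ℝ V] [MeasurableSpace V] {ν : Measure R} [IsProbabilityMeasure ν] (s : ℝ) :
    CenteredSubGaussian ν (fun _ => (0 : V)) s where
  measurable := measurable_const
  integral_eq_zero := by simp
  lintegral_exp_le := by simp

/-- An oracle whose deviation from its mean `g` is sub-Gaussian on `Θ`. -/
structure SubGaussianOracle (Θ : Set (Vec d)) (ν : Measure Z) (dh : Vec d → Z → Vec d)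
    (g : Vec d → Vec d) (σ : ℝ) : Prop where
  measurable_set : MeasurableSet Θ
  measurable_oracle : Measurable fun q : Vec d × Z => dh q.1 q.2
  measurable_mean : Measurable g
  subGaussian : ∀ w ∈ Θ, CenteredSubGaussian ν (fun z => dh w z - g w) σ

theorem SubGaussianOracle.measurable_noise {d E B : ℕ} {Z : Type*} [MeasurableSpace Z]
    {Θ : Set (Vec d)} {ν : Measure Z} {dh : Vec d → Z → Vec d} {g : Vec d → Vec d} {σ : ℝ}
    (h : SubGaussianOracle Θ ν dh g σ) (γ : ℝ) (w : Vec d)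
    (τ : ℕ) : Measurable fun s : Fin E → Fin B → Z => localNoise Θ dh g γ w s τ :=
  (measurable_localNoise h.measurable_set h.measurable_oracle h.measurable_mean γ τ).comp
    measurable_prodMk_left

variable {Θ : Set (Vec d)} {ν : Measure Z} [IsProbabilityMeasure ν] {dh : Vec d → Z → Vec d}
  {g : Vec d → Vec d} {σ : ℝ}

/-- With the other batches frozen, the iterate at time `t` is a fixed point: the new noise is a
centered batch average if that point is in `Θ` and vanishes identically otherwise. Truncation thus
makes the bound valid for every `s`, with no conditioning on staying in `Θ`. -/
theorem SubGaussianOracle.localNoise_update (h : SubGaussianOracle Θ ν dh g σ) (hσ : 0 < σ)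
    (hB : 1 ≤ B) (γ : ℝ) (w : Vec d) (s : Fin E → Fin B → Z) {t : ℕ} (ht : t < E) :
    CenteredSubGaussian (Measure.pi fun _ : Fin B => ν)
      (fun r => localNoise Θ dh g γ w (Function.update s ⟨t, ht⟩ r) t) (4 * σ / Real.sqrt B) := by
  classical
  simp only [localNoise_update_self]
  by_cases hw : localPath dh γ w s t ∈ Θ
  · simp only [hw, if_true]
    simp only [← batchMean_sub_const hB]
    exact (h.subGaussian _ hw).batchMean hσ hB
  · simp only [hw, if_false]
    exact CenteredSubGaussian.zero _

theorem SubGaussianOracle.lintegral_exp_norm_noise_le (h : SubGaussianOracle Θ ν dh g σ)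
    (hσ : 0 < σ) (hB : 1 ≤ B) (γ : ℝ) (w : Vec d) {τ : ℕ} (hτ : τ < E) :
    ∫⁻ s : Fin E → Fin B → Z, ENNReal.ofReal
        (Real.exp (‖localNoise Θ dh g γ w s τ‖ ^ 2 / (4 * σ / Real.sqrt B) ^ 2))
      ∂(Measure.pi fun _ => Measure.pi fun _ => ν) ≤ 2 := by
  have hm := h.measurable_noise (E := E) (B := B) γ w τ
  rw [lintegral_pi_resample _ (by fun_prop) ⟨τ, hτ⟩]
  refine (lintegral_mono fun s => (h.localNoise_update hσ hB γ w s hτ).lintegral_exp_le).trans ?_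
  simp

theorem SubGaussianOracle.lintegral_exp_norm_sum_noise_le (h : SubGaussianOracle Θ ν dh g σ)
    (hσ : 0 < σ) (hB : 1 ≤ B) (γ : ℝ) (w : Vec d) {τ : ℕ} (hτ : τ < E) :
    ∫⁻ s : Fin E → Fin B → Z, ENNReal.ofReal
        (Real.exp (‖∑ j ∈ Finset.range τ, localNoise Θ dh g γ w s j‖ ^ 2 /
          (16 * E * (4 * σ / Real.sqrt B) ^ 2)))
      ∂(Measure.pi fun _ => Measure.pi fun _ => ν) ≤ 2 := by
  have hm := h.measurable_noise (E := E) (B := B) γ w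
  have hB' : (0 : ℝ) < B := by exact_mod_cast hB
  refine (lintegral_exp_norm_sq_adapted_sum_le (Measure.pi fun _ : Fin B => ν)
    (fun t s => ∑ j ∈ Finset.range t, localNoise Θ dh g γ w s j)
    (fun t => Finset.measurable_sum _ fun j _ => hm j) (fun s => by simp)
    (σ := 4 * σ / Real.sqrt B) (by positivity)
    (fun t ht s => ⟨_, h.localNoise_update hσ hB γ w s ht, fun r => ?_⟩) hτ.le (by omega)).trans ?_
  · rw [Finset.sum_range_succ]
    congr 1
    exact Finset.sum_congr rfl fun j hj =>
      localNoise_update_of_lt Θ dh g γ w s ht r (Finset.mem_range.1 hj)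
  · exact (ENNReal.ofReal_le_ofReal Real.exp_one_eighth_le_two).trans_eq (by simp)

/-- Each term is linear in a fresh centered vector with a frozen coefficient, so it adds at most `l²
D² (4σ/√B)²` to the exponent. The distance to `v` is known to be at most `D` only in `Θ`; elsewhere
the noise is `0`. -/
theorem SubGaussianOracle.lintegral_exp_sum_inner_noise_le (h : SubGaussianOracle Θ ν dh g σ)
    (hσ : 0 < σ) (hB : 1 ≤ B) (γ : ℝ) (w : Vec d) {v : Vec d} {D : ℝ}
    (hD : ∀ w ∈ Θ, ‖v - w‖ ≤ D) (l : ℝ) :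
    ∫⁻ s : Fin E → Fin B → Z, ENNReal.ofReal
        (Real.exp (l * ∑ τ ∈ Finset.range E,
          inner ℝ (v - localPath dh γ w s τ) (localNoise Θ dh g γ w s τ)))
      ∂(Measure.pi fun _ => Measure.pi fun _ => ν) ≤
      ENNReal.ofReal (Real.exp (E * (l ^ 2 * D ^ 2 * (4 * σ / Real.sqrt B) ^ 2))) := by
  have hm := h.measurable_noise (E := E) (B := B) γ w
  have hp : ∀ τ, Measurable fun s : Fin E → Fin B → Z => localPath dh γ w s τ := fun τ =>
    (measurable_localPath h.measurable_oracle γ τ).comp measurable_prodMk_left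
  have hB' : (0 : ℝ) < B := by exact_mod_cast hB
  refine lintegral_exp_adapted_sum_le (Measure.pi fun _ : Fin B => ν)
    (fun t s => l * ∑ τ ∈ Finset.range t,
      inner ℝ (v - localPath dh γ w s τ) (localNoise Θ dh g γ w s τ))
    (fun t => (Finset.measurable_sum _ fun j _ =>
      (measurable_const.sub (hp j)).inner (hm j)).const_mul l) (fun s => by simp)
    (fun t ht s => ⟨fun r => inner ℝ (l • (v - localPath dh γ w s t))
      (localNoise Θ dh g γ w (Function.update s ⟨t, ht⟩ r) t), ?_, fun r => ?_⟩)
  · by_cases hw : localPath dh γ w s t ∈ Θ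
    · refine ((h.localNoise_update hσ hB γ w s ht).lintegral_exp_inner_le (by positivity) _).trans ?_
      refine ENNReal.ofReal_le_ofReal (Real.exp_le_exp.2 ?_)
      rw [norm_smul, mul_pow, Real.norm_eq_abs, sq_abs]
      gcongr
      exact hD _ hw
    · simp only [localNoise_update_self, hw, if_false, inner_zero_right, Real.exp_zero,
        lintegral_const, measure_univ, mul_one]
      exact ENNReal.ofReal_le_ofReal (Real.one_le_exp (by positivity))
  · beta_reduce
    rw [Finset.sum_range_succ, mul_add, real_inner_smul_left, localPath_update dh γ w s ht r t le_rfl]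
    congr 2
    refine Finset.sum_congr rfl fun j hj => ?_
    rw [localNoise_update_of_lt Θ dh g γ w s ht r (Finset.mem_range.1 hj),
      localPath_update dh γ w s ht r j (Finset.mem_range.1 hj).le]

end LocalPath


/-! ### Client sampling -/

theorem samplingScale_pos {σ : ℝ} {m n : ℕ} (hσ : 0 < σ) (hm : 1 ≤ m) (hmn : m < n) :
    0 < samplingScale σ m n := by
  have hn0 : (0 : ℝ) < n := by exact_mod_cast (by omega : 0 < n)
  have h1 : (0 : ℝ) < 1 - m / n := by rw [sub_pos, div_lt_one hn0]; exact_mod_cast hmn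
  have h2 : (1 : ℝ) - m / n < 1 := by
    have : (0 : ℝ) < m := by exact_mod_cast hm
    have : (0 : ℝ) < m / n := by positivity
    linarith
  have := abs_pos.2 (Real.log_neg h1 h2).ne
  rw [samplingScale, if_neg hmn.ne]
  positivity

/-- Passing from an `(N+1)`-set to an `N`-set multiplies the number of `m`-subsets by `1 - m/(N+1)`
(by `0` in case this is negative), which is at most `1 - m/n`. Iterated, this bounds the chance that
a uniform `m`-set avoids `k` given elements. -/
theorem choose_sub_mul_pow_le (n m : ℕ) :
    ∀ k ≤ n, (n - k).choose m * n ^ k ≤ n.choose m * (n - m) ^ k := by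
  intro k
  induction k with
  | zero => simp
  | succ k ih =>
    intro hk
    have h1 : (n - (k + 1)).choose m * n ≤ (n - k).choose m * (n - m) := by
      obtain ⟨N, hN⟩ : ∃ N, n = N + 1 + k := ⟨n - k - 1, by omega⟩
      have e1 : n - (k + 1) = N := by omega
      have e2 : n - k = N + 1 := by omega
      rw [e1, e2]
      refine Nat.le_of_mul_le_mul_right (c := N + 1) ?_ (Nat.succ_pos N)
      calc N.choose m * n * (N + 1) = (N.choose m * (N + 1)) * n := by ring
        _ = (N + 1).choose m * ((N + 1 - m) * n) := by rw [Nat.choose_mul_succ_eq]; ring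
        _ ≤ (N + 1).choose m * ((n - m) * (N + 1)) := by
            refine Nat.mul_le_mul_left _ ?_
            rcases le_or_gt m (N + 1) with h | h
            · zify [h, (by omega : m ≤ n)]
              have : (N : ℤ) + 1 ≤ n := by omega
              nlinarith [Int.natCast_nonneg m]
            · rw [Nat.sub_eq_zero_of_le h.le]; simp
        _ = _ := by ring
    calc (n - (k + 1)).choose m * n ^ (k + 1) = ((n - (k + 1)).choose m * n) * n ^ k := by ring
      _ ≤ ((n - k).choose m * (n - m)) * n ^ k := Nat.mul_le_mul_right _ h1
      _ = ((n - k).choose m * n ^ k) * (n - m) := by ring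
      _ ≤ (n.choose m * (n - m) ^ k) * (n - m) := Nat.mul_le_mul_right _ (ih (by omega))
      _ = _ := by ring

/-- The smallest gap between the largest value of `v` and its values on the sampled set `A`. -/
def samplingGap {n : ℕ} (v : Fin n → ℝ) (A : Finset (Fin n)) : ℝ :=
  ⨅ i : A, ((⨆ j, v j) - v i)

theorem samplingGap_nonneg {n : ℕ} (v : Fin n → ℝ) (A : Finset (Fin n)) : 0 ≤ samplingGap v A :=
  Real.iInf_nonneg fun i => sub_nonneg.2 (le_ciSup (Set.finite_range v).bddAbove i.1)

theorem le_samplingGap_iff {n : ℕ} (v : Fin n → ℝ) {A : Finset (Fin n)} (hA : A.Nonempty) (t : ℝ) :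
    t ≤ samplingGap v A ↔ ∀ i ∈ A, t ≤ (⨆ j, v j) - v i := by
  have : Nonempty A := hA.to_subtype
  rw [samplingGap, le_ciInf_iff (Set.finite_range _).bddBelow]
  simp

theorem exists_samplingGap_eq {n : ℕ} (v : Fin n → ℝ) {A : Finset (Fin n)} (hA : A.Nonempty) :
    ∃ i ∈ A, ⨆ j, v j = v i + samplingGap v A := by
  have : Nonempty A := hA.to_subtype
  obtain ⟨i, hi⟩ := exists_eq_ciInf_of_finite (f := fun i : A => (⨆ j, v j) - v i)
  exact ⟨i, i.2, by rw [samplingGap, ← hi]; ring⟩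

theorem samplingGap_univ {n : ℕ} (hn : 1 ≤ n) (v : Fin n → ℝ) :
    samplingGap v Finset.univ = 0 := by
  have : Nonempty (Fin n) := ⟨⟨0, hn⟩⟩
  refine le_antisymm ?_ (samplingGap_nonneg v _)
  obtain ⟨i, hi⟩ := exists_eq_ciSup_of_finite (f := v)
  have h := (le_samplingGap_iff v Finset.univ_nonempty _).1 le_rfl i (Finset.mem_univ i)
  rw [hi] at h
  simpa using h

theorem measurable_samplingGap {n : ℕ} {W : Type*} [MeasurableSpace W] {v : W → Fin n → ℝ}
    (hv : ∀ i, Measurable fun w => v w i) (A : Finset (Fin n)) :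
    Measurable fun w => samplingGap (v w) A :=
  Measurable.iInf fun i => (Measurable.iSup hv).sub (hv i)

theorem samplingScale_nonneg {σ : ℝ} (hσ : 0 ≤ σ) (m n : ℕ) : 0 ≤ samplingScale σ m n := by
  unfold samplingScale; split_ifs <;> positivity

/-- The tail of the sampling gap of values that are dominated by a uniform variable. -/
theorem uniformOn_samplingGap_ge_le {n m : ℕ} (hm : 1 ≤ m) (hmn : m < n) {σ : ℝ} (hσ : 0 < σ)
    (v : Fin n → ℝ)
    (hv : StochDominated (uniformOn (Set.univ : Set (Fin n))) (fun i => (⨆ j, v j) - v i)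
      (ProbabilityTheory.cond (volume : Measure ℝ) (Set.Icc 0 σ)) (fun u => u))
    {t : ℝ} (ht : 0 < t) :
    uniformOn (↑(Finset.powersetCard m (Finset.univ : Finset (Fin n))) : Set (Finset (Fin n)))
        {A | t ≤ samplingGap v A} ≤
      ENNReal.ofReal (Real.exp (-(t / samplingScale σ m n))) := by
  classical
  set N : Finset (Fin n) := Finset.univ.filter fun i => t ≤ (⨆ j, v j) - v i with hN
  have hn0 : (0 : ℝ) < n := by exact_mod_cast (by omega : 0 < n)
  have hcard : N.card ≤ n := (Finset.card_le_univ N).trans_eq (Fintype.card_fin n)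
  have hset : uniformOn (↑(Finset.powersetCard m (Finset.univ : Finset (Fin n))) :
      Set (Finset (Fin n))) {A | t ≤ samplingGap v A} =
      ENNReal.ofReal ((N.card.choose m : ℝ) / n.choose m) := by
    rw [← uniformOn_inter_self (Finset.finite_toSet _)]
    have e : (↑(Finset.powersetCard m (Finset.univ : Finset (Fin n))) : Set (Finset (Fin n))) ∩
        {A | t ≤ samplingGap v A} = ↑(Finset.powersetCard m N) := by
      ext A
      simp only [Set.mem_inter_iff, Finset.mem_coe, Finset.mem_powersetCard, Set.mem_ofPred_eq,
        Finset.subset_univ, true_and]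
      constructor
      · rintro ⟨h1, h2⟩
        have hA : A.Nonempty := Finset.card_pos.1 (by omega)
        exact ⟨fun i hi => by simpa [hN] using (le_samplingGap_iff v hA t).1 h2 i hi, h1⟩
      · rintro ⟨h1, h2⟩
        have hA : A.Nonempty := Finset.card_pos.1 (by omega)
        exact ⟨h2, (le_samplingGap_iff v hA t).2 fun i hi => by simpa [hN] using h1 hi⟩
    have e2 : Finset.powersetCard m (Finset.univ : Finset (Fin n)) ∩ Finset.powersetCard m N =
        Finset.powersetCard m N :=
      Finset.inter_eq_right.2 (Finset.powersetCard_mono (Finset.subset_univ N))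
    rw [e, uniformOn_apply_finset, e2, Finset.card_powersetCard, Finset.card_powersetCard,
      Finset.card_univ, Fintype.card_fin, ENNReal.ofReal_div_of_pos
        (by exact_mod_cast Nat.choose_pos hmn.le), ENNReal.ofReal_natCast, ENNReal.ofReal_natCast]
  have hfrac : ENNReal.ofReal ((N.card : ℝ) / n) ≤ ENNReal.ofReal ((σ - t) / σ) := by
    have h := hv t
    have e1 : uniformOn (Set.univ : Set (Fin n)) {i | t ≤ (⨆ j, v j) - v i} =
        ENNReal.ofReal ((N.card : ℝ) / n) := by
      have : {i | t ≤ (⨆ j, v j) - v i} = (↑N : Set (Fin n)) := by ext i; simp [hN]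
      rw [this, uniformOn_univ, Measure.count_apply_finset, ENNReal.ofReal_div_of_pos hn0,
        ENNReal.ofReal_natCast, ENNReal.ofReal_natCast, Fintype.card_fin]
    have e2 : Set.Icc 0 σ ∩ {u | t ≤ u} = Set.Icc t σ := by
      ext u
      simp only [Set.mem_inter_iff, Set.mem_Icc, Set.mem_ofPred_eq]
      exact ⟨fun h => ⟨h.2, h.1.2⟩, fun h => ⟨⟨ht.le.trans h.1, h.2⟩, h.1⟩⟩
    rw [e1, cond_apply measurableSet_Icc, e2, Real.volume_Icc, Real.volume_Icc, sub_zero] at h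
    rwa [ENNReal.ofReal_div_of_pos hσ, ENNReal.div_eq_inv_mul]
  have hr0 : (0 : ℝ) < 1 - m / n := by
    rw [sub_pos, div_lt_one hn0]; exact_mod_cast hmn
  have hr1 : (1 : ℝ) - m / n < 1 := by
    have : (0 : ℝ) < m := by exact_mod_cast hm
    have : (0 : ℝ) < m / n := by positivity
    linarith
  rw [hset]
  refine ENNReal.ofReal_le_ofReal ?_
  rcases Nat.eq_zero_or_pos N.card with h0 | h0
  · rw [h0, Nat.choose_eq_zero_of_lt (by omega)]
    simp only [Nat.cast_zero, zero_div]
    exact (Real.exp_pos _).le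
  have hpos : (0 : ℝ) < N.card / n := by
    have : (0 : ℝ) < N.card := by exact_mod_cast h0
    positivity
  -- `ENNReal.ofReal` clips the right-hand side at `0` when `t ≥ σ`. In that range the inequality
  -- would force `N` to be empty, which has been excluded.
  have hlin : (N.card : ℝ) / n ≤ (σ - t) / σ := by
    rcases le_or_gt ((σ - t) / σ) 0 with h | h
    · rw [ENNReal.ofReal_of_nonpos h, nonpos_iff_eq_zero, ENNReal.ofReal_eq_zero] at hfrac
      linarith
    · exact (ENNReal.ofReal_le_ofReal_iff h.le).1 hfrac
  have hpow : ((N.card.choose m : ℝ) / n.choose m) ≤ (1 - m / n) ^ (n - N.card) := by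
    have h := choose_sub_mul_pow_le n m (n - N.card) (Nat.sub_le _ _)
    rw [Nat.sub_sub_self hcard] at h
    have h' : (N.card.choose m : ℝ) * n ^ (n - N.card) ≤
        n.choose m * ((n : ℝ) - m) ^ (n - N.card) := by
      have := (Nat.cast_le (α := ℝ)).2 h
      push_cast [Nat.cast_sub hmn.le] at this
      exact this
    have hc : (0 : ℝ) < n.choose m := by exact_mod_cast Nat.choose_pos hmn.le
    have e : (1 : ℝ) - m / n = (n - m) / n := by field_simp
    rw [e, div_pow, div_le_div_iff₀ hc (by positivity)]
    linarith
  refine hpow.trans ?_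
  have hlog : Real.log (1 - m / n) < 0 := Real.log_neg hr0 hr1
  have hscale : samplingScale σ m n = σ / (-Real.log (1 - m / n) * n) := by
    rw [samplingScale, if_neg hmn.ne, abs_of_neg hlog]
  rw [← Real.exp_log hr0, ← Real.exp_nat_mul, Nat.cast_sub hcard]
  refine Real.exp_le_exp.2 ?_
  rw [hscale, div_div_eq_mul_div]
  -- Domination by the uniform law leaves at least `tn/σ` clients outside `N`, all of which the
  -- sample must miss. The power of `1 - m/n` with this exponent is the stated exponential tail.
  have h3 : t * n / σ ≤ (n : ℝ) - N.card := by
    rw [div_le_iff₀ hn0, div_mul_eq_mul_div, le_div_iff₀ hσ] at hlin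
    rw [div_le_iff₀ hσ]
    linarith
  have e3 : t * (-Real.log (1 - m / n) * n) / σ = (t * n / σ) * -Real.log (1 - m / n) := by ring
  rw [e3]
  nlinarith

/-- The exponential moment of the sampling gap. -/
theorem lintegral_exp_samplingGap_le {n m : ℕ} (hm : 1 ≤ m) (hmn : m ≤ n) {σ : ℝ} (hσ : 0 < σ)
    (v : Fin n → ℝ)
    (hv : StochDominated (uniformOn (Set.univ : Set (Fin n))) (fun i => (⨆ j, v j) - v i)
      (ProbabilityTheory.cond (volume : Measure ℝ) (Set.Icc 0 σ)) (fun u => u)) :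
    ∫⁻ A, ENNReal.ofReal (Real.exp (samplingGap v A / (2 * samplingScale σ m n)))
      ∂(uniformOn (↑(Finset.powersetCard m (Finset.univ : Finset (Fin n))) :
        Set (Finset (Fin n)))) ≤ 2 := by
  set μ := uniformOn (↑(Finset.powersetCard m (Finset.univ : Finset (Fin n))) :
        Set (Finset (Fin n))) with hμ
  have hprob : IsProbabilityMeasure μ := isProbabilityMeasure_uniformOn (Finset.finite_toSet _)
    (by rw [Finset.coe_nonempty, Finset.powersetCard_nonempty]; simpa using hmn)
  rcases hmn.eq_or_lt with rfl | hlt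
  -- Under full participation the scale is `0`, the quotient is `0` by convention, and the integrand
  -- is `1`.
  · simp [samplingScale]
  set c := samplingScale σ m n with hc
  have hc0 : 0 < c := samplingScale_pos hσ hm hlt
  -- Layer cake for `exp (x/(2c)) - 1`. Taking half the rate of the tail `exp (-t/c)` makes the
  -- resulting integral of `(2c)⁻¹ exp (-t/(2c))` equal to `1`, so the total is `2`.
  have hlayer := lintegral_comp_eq_lintegral_meas_le_mul (f := samplingGap v)
    (g := fun t => 1 / (2 * c) * Real.exp (t / (2 * c))) μ
    (Filter.Eventually.of_forall fun A => samplingGap_nonneg v A)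
    (measurable_of_countable _).aemeasurable
    (fun t _ => (by fun_prop : Continuous fun t => 1 / (2 * c) * Real.exp (t / (2 * c))).intervalIntegrable _ _)
    (Filter.Eventually.of_forall fun t => by positivity)
  have hint : ∀ x : ℝ, ∫ t in (0 : ℝ)..x, 1 / (2 * c) * Real.exp (t / (2 * c)) =
      Real.exp (x / (2 * c)) - 1 := fun x => by
    rw [intervalIntegral.integral_const_mul, intervalIntegral.integral_comp_div _ (by positivity),
      integral_exp, zero_div, Real.exp_zero, smul_eq_mul]
    field_simp
  simp only [hint] at hlayer
  have htail : ∫⁻ t in Set.Ioi (0 : ℝ), μ {A | t ≤ samplingGap v A} *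
      ENNReal.ofReal (1 / (2 * c) * Real.exp (t / (2 * c))) ≤ 1 := by
    calc _ ≤ ∫⁻ t in Set.Ioi (0 : ℝ),
          ENNReal.ofReal (1 / (2 * c) * Real.exp (-(1 / (2 * c)) * t)) := by
          refine setLIntegral_mono (by fun_prop) fun t ht => ?_
          have h := uniformOn_samplingGap_ge_le hm hlt hσ v hv (Set.mem_Ioi.1 ht)
          refine (mul_le_mul_left h _).trans_eq ?_
          rw [← ENNReal.ofReal_mul (Real.exp_pos _).le]
          congr 1
          rw [mul_left_comm, ← Real.exp_add]
          congr 2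
          rw [← hc]; field_simp; ring
      _ = ENNReal.ofReal (∫ t in Set.Ioi (0 : ℝ), 1 / (2 * c) * Real.exp (-(1 / (2 * c)) * t)) := by
          rw [ofReal_integral_eq_lintegral_ofReal]
          · exact (integrableOn_exp_mul_Ioi (by rw [neg_lt_zero]; positivity) 0).const_mul _
          · exact Filter.Eventually.of_forall fun t => by positivity
      _ = 1 := by
          rw [integral_const_mul, integral_exp_mul_Ioi (by rw [neg_lt_zero]; positivity), mul_zero,
            Real.exp_zero]
          rw [neg_div_neg_eq, mul_one_div_cancel (by positivity), ENNReal.ofReal_one]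
  calc _ = ∫⁻ A, (1 + ENNReal.ofReal (Real.exp (samplingGap v A / (2 * c)) - 1)) ∂μ := by
        refine lintegral_congr fun A => ?_
        have h1 : 0 ≤ Real.exp (samplingGap v A / (2 * c)) - 1 :=
          sub_nonneg.2 (Real.one_le_exp (div_nonneg (samplingGap_nonneg v A) (by positivity)))
        rw [← ENNReal.ofReal_one, ← ENNReal.ofReal_add zero_le_one h1]
        ring_nf
    _ = 1 + ∫⁻ A, ENNReal.ofReal (Real.exp (samplingGap v A / (2 * c)) - 1) ∂μ := by
        rw [lintegral_add_left measurable_const]; simp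
    _ ≤ 1 + 1 := by rw [hlayer]; gcongr
    _ = 2 := one_add_one_eq_two


/-! ### Independent rounds -/

section Chain

variable {R S Ω : Type*} {N : ℕ}

/-- A sequence that extends a nonempty tuple. -/
def extendTuple (hN : 0 < N) (s : Fin N → R) (k : ℕ) : R :=
  if h : k < N then s ⟨k, h⟩ else s ⟨0, hN⟩

theorem extendTuple_update_self (hN : 0 < N) (s : Fin N → R) {t : ℕ} (ht : t < N) (r : R) :
    extendTuple hN (Function.update s ⟨t, ht⟩ r) t = r := by
  simp [extendTuple, ht]

theorem extendTuple_update_of_lt (hN : 0 < N) (s : Fin N → R) {t : ℕ} (ht : t < N) (r : R) {j : ℕ}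
    (hj : j < t) :
    extendTuple hN (Function.update s ⟨t, ht⟩ r) j = extendTuple hN s j := by
  have hne : (⟨j, hj.trans ht⟩ : Fin N) ≠ ⟨t, ht⟩ := fun e => by
    have := congrArg Fin.val e; simp at this; omega
  simp [extendTuple, hj.trans ht, Function.update_of_ne hne]

/-- The state before round `k` reads only earlier samples, so replacing the sample of round `k`
leaves it unchanged. -/
theorem recursion_congr {T : R → S → S} {it : (ℕ → R) → ℕ → S} {s₀ : S} (h0 : ∀ x, it x 0 = s₀)
    (hsucc : ∀ x k, it x (k + 1) = T (x k) (it x k)) {x y : ℕ → R} {k : ℕ}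
    (h : ∀ j < k, x j = y j) : it x k = it y k := by
  induction k with
  | zero => rw [h0, h0]
  | succ k ih =>
    rw [hsucc, hsucc, ih fun j hj => h j (hj.trans (Nat.lt_succ_self k)), h k (Nat.lt_succ_self k)]

variable [MeasurableSpace R] [MeasurableSpace S] [MeasurableSpace Ω]

theorem measurable_extendTuple (hN : 0 < N) (k : ℕ) :
    Measurable fun s : Fin N → R => extendTuple hN s k := by
  unfold extendTuple
  split_ifs <;> exact measurable_pi_apply _

theorem measurable_recursion_extendTuple (hN : 0 < N) {T : R → S → S}
    (hT : Measurable fun q : S × R => T q.2 q.1) {it : (ℕ → R) → ℕ → S} {s₀ : S}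
    (h0 : ∀ x, it x 0 = s₀) (hsucc : ∀ x k, it x (k + 1) = T (x k) (it x k)) (k : ℕ) :
    Measurable fun s : Fin N → R => it (extendTuple hN s) k := by
  induction k with
  | zero => simp only [h0]; exact measurable_const
  | succ k ih =>
    simp only [hsucc]
    exact hT.comp (ih.prodMk (measurable_extendTuple hN k))

theorem lintegral_comp_iid {P : Measure Ω} [IsProbabilityMeasure P] {μ : Measure R}
    {X : ℕ → Ω → R} (hm : ∀ k, Measurable (X k)) (hi : iIndepFun X P)
    (hl : ∀ k, P.map (X k) = μ) {f : (Fin N → R) → ENNReal} (hf : Measurable f) :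
    ∫⁻ ω, f (fun k => X k ω) ∂P = ∫⁻ s, f s ∂(Measure.pi fun _ : Fin N => μ) := by
  have h1 : iIndepFun (fun k : Fin N => X k) P := hi.precomp Fin.val_injective
  have h2 := (iIndepFun_iff_map_fun_eq_pi_map fun k : Fin N => (hm k).aemeasurable).1 h1
  simp only [hl] at h2
  rw [← h2, lintegral_map hf (measurable_pi_lambda _ fun k => hm k)]

variable {P : Measure Ω} [IsProbabilityMeasure P] {μ : Measure R} [IsProbabilityMeasure μ]
  {X : ℕ → Ω → R} {T : R → S → S} {it : (ℕ → R) → ℕ → S} {s₀ : S} {φ : S × R → ENNReal}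
  {C : ENNReal}

/-- Resampling coordinate `k` keeps the state before round `k` fixed, so the inner integral is the
one-round bound at a frozen state. -/
theorem lintegral_recursion_le (hm : ∀ k, Measurable (X k)) (hi : iIndepFun X P)
    (hl : ∀ k, P.map (X k) = μ) (hT : Measurable fun q : S × R => T q.2 q.1)
    (h0 : ∀ x, it x 0 = s₀) (hsucc : ∀ x k, it x (k + 1) = T (x k) (it x k))
    (hφ : Measurable φ) (hC : ∀ w, ∫⁻ r, φ (w, r) ∂μ ≤ C) (k : ℕ) :
    ∫⁻ ω, φ (it (fun j => X j ω) k, X k ω) ∂P ≤ C := by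
  have hN : 0 < k + 1 := Nat.succ_pos k
  have hf : Measurable fun s : Fin (k + 1) → R =>
      φ (it (extendTuple hN s) k, extendTuple hN s k) :=
    hφ.comp ((measurable_recursion_extendTuple hN hT h0 hsucc k).prodMk
      (measurable_extendTuple hN k))
  calc ∫⁻ ω, φ (it (fun j => X j ω) k, X k ω) ∂P
      = ∫⁻ ω, φ (it (extendTuple hN fun j => X j ω) k, extendTuple hN (fun j => X j ω) k) ∂P := by
        refine lintegral_congr fun ω => ?_
        congr 2
        · refine recursion_congr h0 hsucc fun j hj => ?_
          simp [extendTuple, hj.trans (Nat.lt_succ_self k)]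
        · simp [extendTuple]
    _ = ∫⁻ s, φ (it (extendTuple hN s) k, extendTuple hN s k)
          ∂(Measure.pi fun _ : Fin (k + 1) => μ) := lintegral_comp_iid hm hi hl hf
    _ ≤ ∫⁻ _, C ∂(Measure.pi fun _ : Fin (k + 1) => μ) := by
        rw [lintegral_pi_resample μ hf ⟨k, Nat.lt_succ_self k⟩]
        refine lintegral_mono fun s => ?_
        refine (lintegral_congr fun r => ?_).trans_le (hC (it (extendTuple hN s) k))
        rw [extendTuple_update_self]
        congr 2
        exact recursion_congr h0 hsucc fun j hj => extendTuple_update_of_lt hN s _ r hj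
    _ = C := by simp

/-- The factor of the newest round is integrated at a frozen state while the earlier factors are
constants. With exponential factors this is the moment bound for a sum over rounds. -/
theorem lintegral_prod_recursion_le (hm : ∀ k, Measurable (X k)) (hi : iIndepFun X P)
    (hl : ∀ k, P.map (X k) = μ) (hT : Measurable fun q : S × R => T q.2 q.1)
    (h0 : ∀ x, it x 0 = s₀) (hsucc : ∀ x k, it x (k + 1) = T (x k) (it x k))
    (hφ : Measurable φ) (hC : ∀ w, ∫⁻ r, φ (w, r) ∂μ ≤ C) (hN : 0 < N) :
    ∫⁻ ω, ∏ k ∈ Finset.range N, φ (it (fun j => X j ω) k, X k ω) ∂P ≤ C ^ N := by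
  set V : ℕ → (Fin N → R) → ENNReal := fun t s =>
    ∏ k ∈ Finset.range t, φ (it (extendTuple hN s) k, extendTuple hN s k) with hV
  have hVm : ∀ t, Measurable (V t) := fun t => Finset.measurable_prod _ fun k _ =>
    hφ.comp ((measurable_recursion_extendTuple hN hT h0 hsucc k).prodMk
      (measurable_extendTuple hN k))
  calc ∫⁻ ω, ∏ k ∈ Finset.range N, φ (it (fun j => X j ω) k, X k ω) ∂P
      = ∫⁻ ω, V N (fun j => X j ω) ∂P := by
        refine lintegral_congr fun ω => Finset.prod_congr rfl fun k hk => ?_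
        have hk' := Finset.mem_range.1 hk
        congr 2
        · refine recursion_congr h0 hsucc fun j hj => ?_
          simp [extendTuple, hj.trans hk']
        · simp [extendTuple, hk']
    _ = ∫⁻ s, V N s ∂(Measure.pi fun _ : Fin N => μ) := lintegral_comp_iid hm hi hl (hVm N)
    _ ≤ C ^ N * ∫⁻ s, V 0 s ∂(Measure.pi fun _ : Fin N => μ) := by
        refine lintegral_pi_le_pow_mul μ V hVm C (fun t ht s => ?_) N le_rfl
        have e : ∀ r, V (t + 1) (Function.update s ⟨t, ht⟩ r) =
            V t s * φ (it (extendTuple hN s) t, r) := fun r => by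
          simp only [hV]
          rw [Finset.prod_range_succ, extendTuple_update_self]
          congr 1
          · refine Finset.prod_congr rfl fun k hk => ?_
            have hk' := Finset.mem_range.1 hk
            rw [extendTuple_update_of_lt hN s ht r hk']
            congr 2
            exact recursion_congr h0 hsucc fun j hj =>
              extendTuple_update_of_lt hN s ht r (hj.trans hk')
          · congr 2
            exact recursion_congr h0 hsucc fun j hj => extendTuple_update_of_lt hN s ht r hj
        simp only [e]
        rw [lintegral_const_mul (f := fun r => φ (it (extendTuple hN s) t, r)) _
          (hφ.comp measurable_prodMk_left), mul_comm]
        gcongr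
        exact hC _
    _ = C ^ N := by simp [hV]

end Chain

/-! ### Sub-Gaussian deviations from the mean -/

/-- Integrability of `f` is not assumed. If it failed, the Bochner integral would be `0` by
convention, the moment bound would concern `f` itself, and `f` would be integrable after all. -/
theorem CenteredSubGaussian.sub_integral {R V : Type*} [MeasurableSpace R] [NormedAddCommGroup V]
    [InnerProductSpace ℝ V] [MeasurableSpace V] [BorelSpace V] [SecondCountableTopology V]
    {ν : Measure R} [IsProbabilityMeasure ν] {f : R → V} {s : ℝ} (hf : Measurable f) (hs : 0 < s)
    (h : ∫⁻ r, ENNReal.ofReal (Real.exp (‖f r - ∫ z, f z ∂ν‖ ^ 2 / s ^ 2)) ∂ν ≤ 2) :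
    CenteredSubGaussian ν (fun r => f r - ∫ z, f z ∂ν) s := by
  by_cases hint : Integrable f ν
  · refine ⟨hf.sub_const _, ?_, h⟩
    by_cases hV : CompleteSpace V
    · rw [integral_sub hint (integrable_const _)]
      simp
    · simp [integral, hV]
  · have h0 : ∫ z, f z ∂ν = 0 := integral_undef hint
    simp only [h0, sub_zero] at h
    exact absurd (CenteredSubGaussian.integrable ⟨hf, h0, h⟩ hs) hint

theorem measurable_meanValue {n d : ℕ} {Z : Type*} [MeasurableSpace Z] {𝒟 : Fin n → Measure Z}
    [∀ i, IsProbabilityMeasure (𝒟 i)] {h : Fin n → Vec d → Z → ℝ} {i : Fin n}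
    (hh : Measurable fun q : Vec d × Z => h i q.1 q.2) : Measurable (meanValue 𝒟 h i) :=
  (hh.stronglyMeasurable.integral_prod_right' (ν := 𝒟 i)).measurable

theorem measurable_meanGrad {n d : ℕ} {Z : Type*} [MeasurableSpace Z] {𝒟 : Fin n → Measure Z}
    [∀ i, IsProbabilityMeasure (𝒟 i)] {dh : Fin n → Vec d → Z → Vec d} {i : Fin n}
    (hh : Measurable fun q : Vec d × Z => dh i q.1 q.2) : Measurable (meanGrad 𝒟 dh i) :=
  (hh.stronglyMeasurable.integral_prod_right' (ν := 𝒟 i)).measurable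

namespace FamilyAssumptions

variable {n d : ℕ} {Z : Type*} [MeasurableSpace Z] {Θ : Set (Vec d)} {𝒟 : Fin n → Measure Z}
  [∀ i, IsProbabilityMeasure (𝒟 i)] {h : Fin n → Vec d → Z → ℝ} {dh : Fin n → Vec d → Z → Vec d}
  {L σζ σg σ : ℝ}

theorem centeredSubGaussian_value (H : FamilyAssumptions Θ 𝒟 h dh L σζ σg σ) (hσ : 0 < σζ)
    (i : Fin n) {w : Vec d} (hw : w ∈ Θ) :
    CenteredSubGaussian (𝒟 i) (fun z => h i w z - meanValue 𝒟 h i w) σζ := by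
  refine CenteredSubGaussian.sub_integral ((H.measurable_value i).comp measurable_prodMk_left) hσ ?_
  have h1 := H.subGaussian_value i w hw
  simp only [meanValue] at h1
  simpa only [Real.norm_eq_abs, sq_abs] using h1

theorem subGaussianOracle (H : FamilyAssumptions Θ 𝒟 h dh L σζ σg σ) (hσ : 0 < σg)
    (hΘ : MeasurableSet Θ) (i : Fin n) :
    SubGaussianOracle Θ (𝒟 i) (dh i) (meanGrad 𝒟 dh i) σg where
  measurable_set := hΘ
  measurable_oracle := H.measurable_grad i
  measurable_mean := measurable_meanGrad (H.measurable_grad i)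
  subGaussian w hw := CenteredSubGaussian.sub_integral
    ((H.measurable_grad i).comp measurable_prodMk_left) hσ (H.subGaussian_grad i w hw)

end FamilyAssumptions


/-! ### One round -/

theorem maskedSoftmax_nonneg {n : ℕ} (A : Finset (Fin n)) (v : Fin n → ℝ) (i : Fin n) :
    0 ≤ maskedSoftmax A v i := by
  unfold maskedSoftmax
  refine div_nonneg ?_ (Finset.sum_nonneg fun j _ => (Real.exp_pos _).le)
  split_ifs
  · exact (Real.exp_pos _).le
  · exact le_rfl

theorem maskedSoftmax_of_notMem {n : ℕ} {A : Finset (Fin n)} (v : Fin n → ℝ) {i : Fin n}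
    (hi : i ∉ A) : maskedSoftmax A v i = 0 := by
  simp [maskedSoftmax, hi]

theorem sum_maskedSoftmax {n : ℕ} {A : Finset (Fin n)} (hA : A.Nonempty) (v : Fin n → ℝ) :
    ∑ i ∈ A, maskedSoftmax A v i = 1 := by
  have hpos : 0 < ∑ j ∈ A, Real.exp (v j) := Finset.sum_pos (fun j _ => Real.exp_pos _) hA
  have : ∀ i ∈ A, maskedSoftmax A v i = Real.exp (v i) / ∑ j ∈ A, Real.exp (v j) := fun i hi => by
    simp [maskedSoftmax, hi]
  rw [Finset.sum_congr rfl this, ← Finset.sum_div, div_self hpos.ne']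

theorem ae_card_eq_of_uniformOn_powersetCard (n m : ℕ) :
    ∀ᵐ A ∂(uniformOn (↑(Finset.powersetCard m (Finset.univ : Finset (Fin n))) :
        Set (Finset (Fin n)))), A.card = m := by
  have := ae_cond_mem (μ := Measure.count) (Finset.measurableSet
    (Finset.powersetCard m (Finset.univ : Finset (Fin n))))
  filter_upwards [this] with A hA
  simpa using hA

theorem isProbabilityMeasure_uniformOn_powersetCard {n m : ℕ} (hmn : m ≤ n) :
    IsProbabilityMeasure (uniformOn (↑(Finset.powersetCard m (Finset.univ : Finset (Fin n))) :
        Set (Finset (Fin n)))) :=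
  isProbabilityMeasure_uniformOn (Finset.finite_toSet _)
    (by rw [Finset.coe_nonempty, Finset.powersetCard_nonempty]; simpa using hmn)

/-- Measurability may be checked for each set of participating clients. -/
theorem measurable_of_forall_clients {n E Bζ Bg : ℕ} {Z W V : Type*} [MeasurableSpace Z]
    [MeasurableSpace W] [MeasurableSpace V] {F : W → RoundSample n E Bζ Bg Z → V}
    (h : ∀ A, Measurable fun q : W × ((Fin n → Fin Bζ → Z) × (Fin n → Fin E → Fin Bg → Z)) =>
      F q.1 (A, q.2)) :
    Measurable fun q : W × RoundSample n E Bζ Bg Z => F q.1 q.2 := by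
  have h1 : Measurable fun q : (W × ((Fin n → Fin Bζ → Z) × (Fin n → Fin E → Fin Bg → Z))) ×
      Finset (Fin n) => F q.1.1 (q.2, q.1.2) :=
    measurable_from_prod_countable_left fun A => h A
  exact h1.comp ((measurable_fst.prodMk measurable_snd.snd).prodMk measurable_snd.fst)

namespace FedProblem

variable {n d E Bζ Bg : ℕ} {Z : Type*} [MeasurableSpace Z]

/-- The oracle of a round is determined by the sampled clients and the value batches. Once it is
fixed, the local run is SGD driven by gradient batches alone, to which the noise bounds apply. -/
theorem localIterate_eq_localPath (p : FedProblem n d Z) (a : AlgParams)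
    (x : RoundSample n E Bζ Bg Z) (w : Vec d) (i : Fin n) (τ : ℕ) :
    p.localIterate a x w i τ = localPath (p.roundOracle a x w i) a.γ w (x.2.2 i) τ := by
  induction τ with
  | zero => rfl
  | succ τ ih => simp only [localIterate, localPath, ih]

/-- The weighted mean over the participating clients of `Φf` or `Φg`, according to whether the
round is constraint-satisfied. -/
def clientMix (p : FedProblem n d Z) (a : AlgParams) {V : Type*} [AddCommGroup V] [Module ℝ V]
    (Φf Φg : Fin n → Vec d → (Fin E → Fin Bg → Z) → V) (w : Vec d)
    (x : RoundSample n E Bζ Bg Z) : V :=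
  ∑ i ∈ x.1, p.roundWeight a x w i •
    (if p.constraintEst a x w ≤ a.ε / 2 then Φf i w (x.2.2 i) else Φg i w (x.2.2 i))

variable {p : FedProblem n d Z} {a : AlgParams}

theorem roundWeight_nonneg (x : RoundSample n E Bζ Bg Z) (w : Vec d) (i : Fin n) :
    0 ≤ p.roundWeight a x w i := by
  unfold roundWeight pWeight qWeight
  split_ifs <;> exact maskedSoftmax_nonneg _ _ _

theorem sum_roundWeight {x : RoundSample n E Bζ Bg Z} (hx : x.1.Nonempty) (w : Vec d) :
    ∑ i ∈ x.1, p.roundWeight a x w i = 1 := by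
  unfold roundWeight pWeight qWeight
  split_ifs <;> exact sum_maskedSoftmax hx _

theorem measurable_est {h : Fin n → Vec d → Z → ℝ}
    (hh : ∀ i, Measurable fun q : Vec d × Z => h i q.1 q.2) (i : Fin n) :
    Measurable fun q : Vec d × ((Fin n → Fin Bζ → Z) × (Fin n → Fin E → Fin Bg → Z)) =>
      batchMean (h i q.1) (q.2.1 i) :=
  (measurable_batchMean (hh i)).comp
    (measurable_fst.prodMk ((measurable_pi_apply i).comp measurable_snd.fst))

theorem measurable_maskedSoftmax {n : ℕ} {W : Type*} [MeasurableSpace W] (A : Finset (Fin n))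
    {v : W → Fin n → ℝ} (hv : ∀ i, Measurable fun w => v w i) (i : Fin n) :
    Measurable fun w => maskedSoftmax A (v w) i := by
  unfold maskedSoftmax
  refine Measurable.div ?_ (Finset.measurable_sum _ fun j _ => (hv j).exp)
  split_ifs
  · exact (hv i).exp
  · exact measurable_const

theorem measurable_constraintEst
    (hg : ∀ i, Measurable fun q : Vec d × Z => p.g i q.1 q.2) (A : Finset (Fin n)) :
    Measurable fun q : Vec d × ((Fin n → Fin Bζ → Z) × (Fin n → Fin E → Fin Bg → Z)) =>
      p.constraintEst a (A, q.2) q.1 :=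
  Finset.measurable_sum _ fun i _ =>
    (measurable_maskedSoftmax A (fun j => (measurable_est hg j).const_mul a.α) i).mul
      (measurable_est hg i)

theorem measurable_roundWeight
    (hf : ∀ i, Measurable fun q : Vec d × Z => p.f i q.1 q.2)
    (hg : ∀ i, Measurable fun q : Vec d × Z => p.g i q.1 q.2) (A : Finset (Fin n)) (i : Fin n) :
    Measurable fun q : Vec d × ((Fin n → Fin Bζ → Z) × (Fin n → Fin E → Fin Bg → Z)) =>
      p.roundWeight a (A, q.2) q.1 i :=
  Measurable.ite (measurableSet_le (measurable_constraintEst hg A) measurable_const)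
    (measurable_maskedSoftmax A (fun j => (measurable_est hf j).const_mul a.α) i)
    (measurable_maskedSoftmax A (fun j => (measurable_est hg j).const_mul a.α) i)

theorem measurable_clientMix {V : Type*} [NormedAddCommGroup V] [NormedSpace ℝ V]
    [MeasurableSpace V] [BorelSpace V] [SecondCountableTopology V]
    (hf : ∀ i, Measurable fun q : Vec d × Z => p.f i q.1 q.2)
    (hg : ∀ i, Measurable fun q : Vec d × Z => p.g i q.1 q.2)
    {Φf Φg : Fin n → Vec d → (Fin E → Fin Bg → Z) → V}
    (hΦf : ∀ i, Measurable fun q : Vec d × (Fin E → Fin Bg → Z) => Φf i q.1 q.2)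
    (hΦg : ∀ i, Measurable fun q : Vec d × (Fin E → Fin Bg → Z) => Φg i q.1 q.2) :
    Measurable fun q : Vec d × RoundSample n E Bζ Bg Z => p.clientMix a Φf Φg q.1 q.2 := by
  refine measurable_of_forall_clients fun A => Finset.measurable_sum _ fun i _ => ?_
  have hs : Measurable fun q : Vec d × ((Fin n → Fin Bζ → Z) × (Fin n → Fin E → Fin Bg → Z)) =>
      (q.1, q.2.2 i) :=
    measurable_fst.prodMk ((measurable_pi_apply i).comp measurable_snd.snd)
  exact (measurable_roundWeight hf hg A i).smul
    (Measurable.ite (measurableSet_le (measurable_constraintEst hg A) measurable_const)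
      ((hΦf i).comp hs) ((hΦg i).comp hs))

/-- An exponential moment of a weighted mean over clients is bounded by the largest one. -/
theorem lintegral_exp_clientMix_le {m : ℕ} (hmn : m ≤ n) [∀ i, IsProbabilityMeasure (p.𝒟 i)]
    (hf : ∀ i, Measurable fun q : Vec d × Z => p.f i q.1 q.2)
    (hg : ∀ i, Measurable fun q : Vec d × Z => p.g i q.1 q.2)
    {Φf Φg : Fin n → Vec d → (Fin E → Fin Bg → Z) → ℝ}
    (hΦf : ∀ i, Measurable fun q : Vec d × (Fin E → Fin Bg → Z) => Φf i q.1 q.2)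
    (hΦg : ∀ i, Measurable fun q : Vec d × (Fin E → Fin Bg → Z) => Φg i q.1 q.2)
    {C : ENNReal} (hC : 1 ≤ C) (w : Vec d)
    (hCf : ∀ i, ∫⁻ s, ENNReal.ofReal (Real.exp (Φf i w s))
      ∂(Measure.pi fun _ => Measure.pi fun _ => p.𝒟 i) ≤ C)
    (hCg : ∀ i, ∫⁻ s, ENNReal.ofReal (Real.exp (Φg i w s))
      ∂(Measure.pi fun _ => Measure.pi fun _ => p.𝒟 i) ≤ C) :
    ∫⁻ x, ENNReal.ofReal (Real.exp (p.clientMix a Φf Φg w x)) ∂(roundLaw E Bζ Bg m p.𝒟) ≤ C := by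
  have hU := isProbabilityMeasure_uniformOn_powersetCard hmn
  have hmeas : Measurable fun x : RoundSample n E Bζ Bg Z =>
      ENNReal.ofReal (Real.exp (p.clientMix a Φf Φg w x)) :=
    ((measurable_clientMix hf hg hΦf hΦg).comp measurable_prodMk_left).exp.ennreal_ofReal
  rw [roundLaw, lintegral_prod _ hmeas.aemeasurable]
  refine (lintegral_mono (g := fun _ => C) fun A => ?_).trans_eq (by simp)
  have hmeas2 : Measurable fun y : (Fin n → Fin Bζ → Z) × (Fin n → Fin E → Fin Bg → Z) =>
      ENNReal.ofReal (Real.exp (p.clientMix a Φf Φg w (A, y))) :=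
    hmeas.comp (measurable_prodMk_left (x := A))
  rw [lintegral_prod _ hmeas2.aemeasurable]
  refine (lintegral_mono (g := fun _ => C) fun ζ => ?_).trans_eq (by simp)
  -- With no clients the mixture is `0` and its exponential is `1`; this is where `1 ≤ C` is needed.
  rcases A.eq_empty_or_nonempty with rfl | hA
  · simpa [clientMix] using hC
  -- The weights and the choice between objective and constraint read only `A` and the value batches
  -- `ζ`. They are therefore constants in the integral over the gradient batches, and Jensen applies
  -- with fixed weights.
  set r : Fin n → ℝ := fun i =>
    if ∑ j, maskedSoftmax A (fun i => a.α * batchMean (p.g i w) (ζ i)) j *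
      batchMean (p.g j w) (ζ j) ≤ a.ε / 2
    then maskedSoftmax A (fun i => a.α * batchMean (p.f i w) (ζ i)) i
    else maskedSoftmax A (fun i => a.α * batchMean (p.g i w) (ζ i)) i with hr
  have hr0 : ∀ i, 0 ≤ r i := fun i => by
    simp only [hr]; split_ifs <;> exact maskedSoftmax_nonneg _ _ _
  have hr1 : ∑ i ∈ A, r i = 1 := by
    simp only [hr]; split_ifs <;> exact sum_maskedSoftmax hA _
  set Ψ : Fin n → (Fin E → Fin Bg → Z) → ℝ := fun i s =>
    if ∑ j, maskedSoftmax A (fun i => a.α * batchMean (p.g i w) (ζ i)) j *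
      batchMean (p.g j w) (ζ j) ≤ a.ε / 2 then Φf i w s else Φg i w s with hΨ
  have hΨm : ∀ i, Measurable (Ψ i) := fun i => by
    simp only [hΨ]; split_ifs
    · exact (hΦf i).comp measurable_prodMk_left
    · exact (hΦg i).comp measurable_prodMk_left
  have hΨC : ∀ i, ∫⁻ s, ENNReal.ofReal (Real.exp (Ψ i s))
      ∂(Measure.pi fun _ => Measure.pi fun _ => p.𝒟 i) ≤ C := fun i => by
    simp only [hΨ]; split_ifs
    · exact hCf i
    · exact hCg i
  have hmix : ∀ ξ, p.clientMix a Φf Φg w (A, ζ, ξ) = ∑ i ∈ A, r i • Ψ i (ξ i) := fun ξ => rfl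
  calc ∫⁻ ξ, ENNReal.ofReal (Real.exp (p.clientMix a Φf Φg w (A, ζ, ξ)))
        ∂(Measure.pi fun i => Measure.pi fun _ => Measure.pi fun _ => p.𝒟 i)
      ≤ ∫⁻ ξ, ∑ i ∈ A, ENNReal.ofReal (r i) * ENNReal.ofReal (Real.exp (Ψ i (ξ i)))
        ∂(Measure.pi fun i => Measure.pi fun _ => Measure.pi fun _ => p.𝒟 i) := by
        refine lintegral_mono fun ξ => ?_
        simp only [← ENNReal.ofReal_mul (hr0 _)]
        rw [← ENNReal.ofReal_sum_of_nonneg fun i _ => mul_nonneg (hr0 i) (Real.exp_pos _).le, hmix]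
        exact ENNReal.ofReal_le_ofReal
          (convexOn_exp.map_sum_le (fun i _ => hr0 i) hr1 fun i _ => Set.mem_univ _)
    _ = ∑ i ∈ A, ENNReal.ofReal (r i) * ∫⁻ s, ENNReal.ofReal (Real.exp (Ψ i s))
          ∂(Measure.pi fun _ => Measure.pi fun _ => p.𝒟 i) := by
        have hm : ∀ i, Measurable fun s => ENNReal.ofReal (Real.exp (Ψ i s)) := fun i =>
          (hΨm i).exp.ennreal_ofReal
        have hme : ∀ i, Measurable fun ξ : Fin n → Fin E → Fin Bg → Z =>
            ENNReal.ofReal (Real.exp (Ψ i (ξ i))) := fun i =>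
          (hm i).comp (measurable_pi_apply i)
        rw [lintegral_finsetSum _ fun i _ => (hme i).const_mul _]
        refine Finset.sum_congr rfl fun i _ => ?_
        rw [lintegral_const_mul _ (hme i)]
        congr 1
        exact (measurePreserving_eval (fun i => Measure.pi fun _ : Fin E =>
          Measure.pi fun _ : Fin Bg => p.𝒟 i) i).lintegral_comp (hm i)
    _ ≤ ∑ i ∈ A, ENNReal.ofReal (r i) * C := by gcongr with i; exact hΨC i
    _ = C := by
        rw [← Finset.sum_mul, ← ENNReal.ofReal_sum_of_nonneg fun i _ => hr0 i, hr1]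
        simp

/-- The global step is the mean of the final local iterates when `η = γ E`. -/
theorem globalStep_eq_clientMix (hγ : a.γ * E ≠ 0) (hη : a.η = a.γ * E)
    {x : RoundSample n E Bζ Bg Z} (hx : x.1.Nonempty) (w : Vec d) :
    p.globalStep a x w = ∑ i ∈ x.1, p.roundWeight a x w i • p.localIterate a x w i E := by
  have h1 : ∀ i, p.localIterate a x w i 0 = w := fun i => rfl
  simp only [globalStep, localDirection, h1, smul_comm _ (a.γ * (E : ℝ))⁻¹]
  rw [← Finset.smul_sum, smul_smul, hη, mul_inv_cancel₀ hγ, one_smul]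
  simp only [smul_sub, Finset.sum_sub_distrib]
  rw [← Finset.sum_smul, sum_roundWeight hx, one_smul, sub_sub_cancel]

theorem measurable_globalStep
    (hf : ∀ i, Measurable fun q : Vec d × Z => p.f i q.1 q.2)
    (hg : ∀ i, Measurable fun q : Vec d × Z => p.g i q.1 q.2)
    (hdf : ∀ i, Measurable fun q : Vec d × Z => p.df i q.1 q.2)
    (hdg : ∀ i, Measurable fun q : Vec d × Z => p.dg i q.1 q.2) :
    Measurable fun q : Vec d × RoundSample n E Bζ Bg Z => p.globalStep a q.2 q.1 := by
  have h := (measurable_clientMix (a := a) (Bζ := Bζ) (E := E) (Bg := Bg) hf hg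
    (Φf := fun i w s => (a.γ * E)⁻¹ • (w - localPath (p.df i) a.γ w s E))
    (Φg := fun i w s => (a.γ * E)⁻¹ • (w - localPath (p.dg i) a.γ w s E))
    (fun i => (measurable_fst.sub (measurable_localPath (hdf i) a.γ E)).const_smul (a.γ * (E : ℝ))⁻¹)
    (fun i => (measurable_fst.sub (measurable_localPath (hdg i) a.γ E)).const_smul (a.γ * (E : ℝ))⁻¹))
  have e : (fun q : Vec d × RoundSample n E Bζ Bg Z => p.globalStep a q.2 q.1) = fun q =>
      q.1 - a.η • p.clientMix a
        (fun i w s => (a.γ * E)⁻¹ • (w - localPath (p.df i) a.γ w s E))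
        (fun i w s => (a.γ * E)⁻¹ • (w - localPath (p.dg i) a.γ w s E)) q.1 q.2 := by
    funext q
    simp only [globalStep, clientMix, localDirection, localIterate_eq_localPath, roundOracle]
    split_ifs <;> rfl
  rw [e]
  exact measurable_fst.sub (h.const_smul a.η)

end FedProblem


/-! ### Noise functionals of a client -/

section ClientNoise

variable {n d E B : ℕ} {Z : Type*} [MeasurableSpace Z]

/-- The gradient noise of client `i` paired with the distances of its iterates to `v`. -/
def clientLin (Θ : Set (Vec d)) (𝒟 : Fin n → Measure Z) (dh : Fin n → Vec d → Z → Vec d) (γ : ℝ)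
    (v : Vec d) (i : Fin n) (w : Vec d) (s : Fin E → Fin B → Z) : ℝ :=
  ∑ τ ∈ Finset.range E, inner ℝ (v - localPath (dh i) γ w s τ)
    (localNoise Θ (dh i) (meanGrad 𝒟 dh i) γ w s τ)

/-- The normalized squares of the gradient noise of client `i` and of its partial sums. -/
def clientQuad (Θ : Set (Vec d)) (𝒟 : Fin n → Measure Z) (dh : Fin n → Vec d → Z → Vec d) (γ κ : ℝ)
    (i : Fin n) (w : Vec d) (s : Fin E → Fin B → Z) : ℝ :=
  ∑ τ ∈ Finset.range E,
    (1 / 2 * (‖localNoise Θ (dh i) (meanGrad 𝒟 dh i) γ w s τ‖ ^ 2 / κ ^ 2) +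
      1 / 2 * (‖∑ j ∈ Finset.range τ, localNoise Θ (dh i) (meanGrad 𝒟 dh i) γ w s j‖ ^ 2 /
        (16 * E * κ ^ 2)))

variable {Θ : Set (Vec d)} {𝒟 : Fin n → Measure Z} [∀ i, IsProbabilityMeasure (𝒟 i)]
  {h : Fin n → Vec d → Z → ℝ} {dh : Fin n → Vec d → Z → Vec d} {L σζ σg σ : ℝ}

theorem FamilyAssumptions.measurable_noise (H : FamilyAssumptions Θ 𝒟 h dh L σζ σg σ)
    (hΘ : MeasurableSet Θ) (γ : ℝ) (i : Fin n) (τ : ℕ) :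
    Measurable fun q : Vec d × (Fin E → Fin B → Z) =>
      localNoise Θ (dh i) (meanGrad 𝒟 dh i) γ q.1 q.2 τ :=
  measurable_localNoise hΘ (H.measurable_grad i) (measurable_meanGrad (H.measurable_grad i)) γ τ

theorem FamilyAssumptions.measurable_clientLin (H : FamilyAssumptions Θ 𝒟 h dh L σζ σg σ)
    (hΘ : MeasurableSet Θ) (γ : ℝ) (v : Vec d) (i : Fin n) :
    Measurable fun q : Vec d × (Fin E → Fin B → Z) => clientLin Θ 𝒟 dh γ v i q.1 q.2 :=
  Finset.measurable_sum _ fun τ _ =>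
    (measurable_const.sub (measurable_localPath (H.measurable_grad i) γ τ)).inner
      (H.measurable_noise hΘ γ i τ)

theorem FamilyAssumptions.measurable_clientQuad (H : FamilyAssumptions Θ 𝒟 h dh L σζ σg σ)
    (hΘ : MeasurableSet Θ) (γ κ : ℝ) (i : Fin n) :
    Measurable fun q : Vec d × (Fin E → Fin B → Z) => clientQuad Θ 𝒟 dh γ κ i q.1 q.2 :=
  Finset.measurable_sum _ fun τ _ =>
    ((((H.measurable_noise hΘ γ i τ).norm.pow_const 2).div_const _).const_mul _).add
      ((((Finset.measurable_sum _ fun j _ =>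
        H.measurable_noise hΘ γ i j).norm.pow_const 2).div_const _).const_mul _)

theorem FamilyAssumptions.lintegral_exp_clientLin_le (H : FamilyAssumptions Θ 𝒟 h dh L σζ σg σ)
    (hΘ : MeasurableSet Θ) (hσ : 0 < σg) (hB : 1 ≤ B) (γ : ℝ) {v : Vec d} {D : ℝ}
    (hD : ∀ w ∈ Θ, ‖v - w‖ ≤ D) (l : ℝ) (i : Fin n) (w : Vec d) :
    ∫⁻ s : Fin E → Fin B → Z, ENNReal.ofReal (Real.exp (l * clientLin Θ 𝒟 dh γ v i w s))
      ∂(Measure.pi fun _ => Measure.pi fun _ => 𝒟 i) ≤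
      ENNReal.ofReal (Real.exp (E * (l ^ 2 * D ^ 2 * (4 * σg / Real.sqrt B) ^ 2))) :=
  (H.subGaussianOracle hσ hΘ i).lintegral_exp_sum_inner_noise_le hσ hB γ w hD l

/-- The exponent is a convex combination, with weights `1/(2E)`, of `2E` normalized squares whose
exponential moments are each at most `2`. Jensen needs no independence among them. -/
theorem FamilyAssumptions.lintegral_exp_clientQuad_le (H : FamilyAssumptions Θ 𝒟 h dh L σζ σg σ)
    (hΘ : MeasurableSet Θ) (hσ : 0 < σg) (hB : 1 ≤ B) (hE : 1 ≤ E) (γ : ℝ)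
    (i : Fin n) (w : Vec d) :
    ∫⁻ s : Fin E → Fin B → Z,
        ENNReal.ofReal (Real.exp ((E : ℝ)⁻¹ * clientQuad Θ 𝒟 dh γ (4 * σg / Real.sqrt B) i w s))
      ∂(Measure.pi fun _ => Measure.pi fun _ => 𝒟 i) ≤ 2 := by
  have O := H.subGaussianOracle hσ hΘ i
  have hE' : (0 : ℝ) < E := by exact_mod_cast hE
  set κ := 4 * σg / Real.sqrt B with hκ
  set a : ℕ → (Fin E → Fin B → Z) → ℝ := fun τ s =>
    ‖localNoise Θ (dh i) (meanGrad 𝒟 dh i) γ w s τ‖ ^ 2 / κ ^ 2 with ha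
  set b : ℕ → (Fin E → Fin B → Z) → ℝ := fun τ s =>
    ‖∑ j ∈ Finset.range τ, localNoise Θ (dh i) (meanGrad 𝒟 dh i) γ w s j‖ ^ 2 /
        (16 * E * κ ^ 2) with hb
  have ham : ∀ τ, Measurable (a τ) := fun τ =>
    ((O.measurable_noise γ w τ).norm.pow_const 2).div_const _
  have hbm : ∀ τ, Measurable (b τ) := fun τ =>
    ((Finset.measurable_sum _ fun j _ => O.measurable_noise γ w j).norm.pow_const 2).div_const _
  have hpt : ∀ s, Real.exp ((E : ℝ)⁻¹ * clientQuad Θ 𝒟 dh γ κ i w s) ≤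
      ∑ τ ∈ Finset.range E, (E : ℝ)⁻¹ *
        (1 / 2 * Real.exp (a τ s) + 1 / 2 * Real.exp (b τ s)) := by
    intro s
    have h1 := convexOn_exp.map_sum_le (t := Finset.range E) (w := fun _ => (E : ℝ)⁻¹)
      (p := fun τ => 1 / 2 * a τ s + 1 / 2 * b τ s) (fun _ _ => by positivity)
      (by simp [hE'.ne']) (fun _ _ => Set.mem_univ _)
    simp only [smul_eq_mul, ← Finset.mul_sum] at h1
    rw [← Finset.mul_sum]
    refine h1.trans ?_
    gcongr with τ hτ
    exact convexOn_exp.2 (Set.mem_univ (a τ s)) (Set.mem_univ (b τ s)) (by norm_num)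
      (by norm_num) (by norm_num)
  calc _ ≤ ∫⁻ s : Fin E → Fin B → Z, ∑ τ ∈ Finset.range E, ENNReal.ofReal ((E : ℝ)⁻¹ * (1 / 2)) *
          (ENNReal.ofReal (Real.exp (a τ s)) + ENNReal.ofReal (Real.exp (b τ s)))
        ∂(Measure.pi fun _ => Measure.pi fun _ => 𝒟 i) := by
        refine lintegral_mono fun s => (ENNReal.ofReal_le_ofReal (hpt s)).trans_eq ?_
        rw [ENNReal.ofReal_sum_of_nonneg fun τ _ => by positivity]
        refine Finset.sum_congr rfl fun τ _ => ?_
        rw [← ENNReal.ofReal_add (Real.exp_pos _).le (Real.exp_pos _).le,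
          ← ENNReal.ofReal_mul (by positivity)]
        ring_nf
    _ = ∑ τ ∈ Finset.range E, ENNReal.ofReal ((E : ℝ)⁻¹ * (1 / 2)) *
          (∫⁻ s : Fin E → Fin B → Z, ENNReal.ofReal (Real.exp (a τ s))
              ∂(Measure.pi fun _ => Measure.pi fun _ => 𝒟 i) +
            ∫⁻ s : Fin E → Fin B → Z, ENNReal.ofReal (Real.exp (b τ s))
              ∂(Measure.pi fun _ => Measure.pi fun _ => 𝒟 i)) := by
        rw [lintegral_finsetSum _ fun τ _ => by
          have := ham τ; have := hbm τ; fun_prop]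
        refine Finset.sum_congr rfl fun τ _ => ?_
        rw [lintegral_const_mul _ (by have := ham τ; have := hbm τ; fun_prop),
          lintegral_add_left (ham τ).exp.ennreal_ofReal]
    _ ≤ ∑ τ ∈ Finset.range E, ENNReal.ofReal ((E : ℝ)⁻¹ * (1 / 2)) * (2 + 2) := by
        refine Finset.sum_le_sum fun τ hτ => ?_
        gcongr
        · exact O.lintegral_exp_norm_noise_le hσ hB γ w (Finset.mem_range.1 hτ)
        · exact O.lintegral_exp_norm_sum_noise_le hσ hB γ w (Finset.mem_range.1 hτ)
    _ = 2 := by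
        rw [Finset.sum_const, Finset.card_range, nsmul_eq_mul]
        have e1 : (2 + 2 : ENNReal) = ENNReal.ofReal 4 := by norm_num
        have e2 : (2 : ENNReal) = ENNReal.ofReal 2 := by norm_num
        rw [e1, e2, ← ENNReal.ofReal_natCast, ← ENNReal.ofReal_mul (by positivity),
          ← ENNReal.ofReal_mul (by positivity)]
        congr 1
        field_simp
        norm_num

end ClientNoise

/-! ### Tail bounds for sums over the rounds -/

namespace FedProblem

variable {n d E Bζ Bg m : ℕ} {Z Ω : Type*} [MeasurableSpace Z] [MeasurableSpace Ω]
  {p : FedProblem n d Z} [∀ i, IsProbabilityMeasure (p.𝒟 i)] {L σζ σg σ : ℝ} {a : AlgParams}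
  {w₀ : Vec d} {P : Measure Ω} [IsProbabilityMeasure P] {X : ℕ → Ω → RoundSample n E Bζ Bg Z}

theorem mul_clientMix {p : FedProblem n d Z} (l : ℝ)
    (Φf Φg : Fin n → Vec d → (Fin E → Fin Bg → Z) → ℝ)
    (w : Vec d) (x : RoundSample n E Bζ Bg Z) :
    l * p.clientMix a Φf Φg w x =
      p.clientMix a (fun i w s => l * Φf i w s) (fun i w s => l * Φg i w s) w x := by
  simp only [clientMix, Finset.mul_sum, smul_eq_mul]
  refine Finset.sum_congr rfl fun i _ => ?_
  split_ifs <;> ring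

theorem isProbabilityMeasure_roundLaw (hmn : m ≤ n) (𝒟 : Fin n → Measure Z)
    [∀ i, IsProbabilityMeasure (𝒟 i)] : IsProbabilityMeasure (roundLaw E Bζ Bg m 𝒟) := by
  have := isProbabilityMeasure_uniformOn_powersetCard hmn
  unfold roundLaw
  infer_instance

theorem measurable_iterate_comp {p : FedProblem n d Z}
    (hstep : Measurable fun q : Vec d × RoundSample n E Bζ Bg Z => p.globalStep a q.2 q.1)
    (hX : ∀ k, Measurable (X k)) (k : ℕ) :
    Measurable fun ω => p.iterate a w₀ (fun j => X j ω) k := by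
  induction k with
  | zero => exact measurable_const
  | succ k ih => exact hstep.comp (ih.prodMk (hX k))

/-- Markov's bound for the exponential of a sum over the rounds of client averages. -/
theorem measure_sum_clientMix_ge_le (hmn : m ≤ n)
    (hf : FamilyAssumptions p.Θ p.𝒟 p.f p.df L σζ σg σ)
    (hg : FamilyAssumptions p.Θ p.𝒟 p.g p.dg L σζ σg σ) (hX : IsIIDRounds P m p.𝒟 X) {K : ℕ}
    (hK : 0 < K) {Φf Φg : Fin n → Vec d → (Fin E → Fin Bg → Z) → ℝ}
    (hΦf : ∀ i, Measurable fun q : Vec d × (Fin E → Fin Bg → Z) => Φf i q.1 q.2)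
    (hΦg : ∀ i, Measurable fun q : Vec d × (Fin E → Fin Bg → Z) => Φg i q.1 q.2)
    {c : ℝ} (hc : 0 ≤ c)
    (hCf : ∀ w i, ∫⁻ s, ENNReal.ofReal (Real.exp (Φf i w s))
      ∂(Measure.pi fun _ => Measure.pi fun _ => p.𝒟 i) ≤ ENNReal.ofReal (Real.exp c))
    (hCg : ∀ w i, ∫⁻ s, ENNReal.ofReal (Real.exp (Φg i w s))
      ∂(Measure.pi fun _ => Measure.pi fun _ => p.𝒟 i) ≤ ENNReal.ofReal (Real.exp c)) (t : ℝ) :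
    P {ω | t ≤ ∑ k ∈ Finset.range K,
      p.clientMix a Φf Φg (p.iterate a w₀ (fun j => X j ω) k) (X k ω)} ≤
      ENNReal.ofReal (Real.exp (K * c - t)) := by
  have := isProbabilityMeasure_roundLaw (E := E) (Bζ := Bζ) (Bg := Bg) hmn p.𝒟
  have hmix := measurable_clientMix (a := a) (Bζ := Bζ) hf.measurable_value hg.measurable_value
    hΦf hΦg
  have hstep : Measurable fun q : Vec d × RoundSample n E Bζ Bg Z => p.globalStep a q.2 q.1 :=
    measurable_globalStep hf.measurable_value hg.measurable_value hf.measurable_grad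
      hg.measurable_grad
  have hit := measurable_iterate_comp (a := a) (w₀ := w₀) hstep hX.measurable
  have hprod := lintegral_prod_recursion_le (μ := roundLaw E Bζ Bg m p.𝒟) hX.measurable hX.indep
    hX.law hstep (it := p.iterate a w₀) (s₀ := w₀) (fun _ => rfl) (fun _ _ => rfl)
    (φ := fun q => ENNReal.ofReal (Real.exp (p.clientMix a Φf Φg q.1 q.2)))
    hmix.exp.ennreal_ofReal (C := ENNReal.ofReal (Real.exp c)) (fun w =>
      lintegral_exp_clientMix_le hmn hf.measurable_value hg.measurable_value hΦf hΦg
        (by simpa using hc) w (hCf w) (hCg w)) hK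
  refine measure_le_of_lintegral_exp_le (Finset.measurable_sum _ fun k _ =>
    hmix.comp ((hit k).prodMk (hX.measurable k))) ?_ t
  rw [Real.exp_nat_mul, ENNReal.ofReal_pow (Real.exp_pos _).le]
  refine le_trans (le_of_eq ?_) hprod
  refine lintegral_congr fun ω => ?_
  rw [Real.exp_sum, ENNReal.ofReal_prod_of_nonneg fun k _ => (Real.exp_pos _).le]
  rfl

/-- The weighted mean over clients of `clientLin` in a round. -/
def roundLin (p : FedProblem n d Z) (a : AlgParams) (v w : Vec d) (x : RoundSample n E Bζ Bg Z) :
    ℝ :=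
  p.clientMix a (clientLin p.Θ p.𝒟 p.df a.γ v) (clientLin p.Θ p.𝒟 p.dg a.γ v) w x

/-- The weighted mean over clients of `clientQuad` in a round. -/
def roundQuad (p : FedProblem n d Z) (a : AlgParams) (κ : ℝ) (w : Vec d)
    (x : RoundSample n E Bζ Bg Z) : ℝ :=
  p.clientMix a (clientQuad p.Θ p.𝒟 p.df a.γ κ) (clientQuad p.Θ p.𝒟 p.dg a.γ κ) w x

theorem measure_sum_roundLin_ge_le (hmn : m ≤ n)
    (hf : FamilyAssumptions p.Θ p.𝒟 p.f p.df L σζ σg σ)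
    (hg : FamilyAssumptions p.Θ p.𝒟 p.g p.dg L σζ σg σ) (hX : IsIIDRounds P m p.𝒟 X)
    (hΘ : MeasurableSet p.Θ) (hσ : 0 < σg) (hBg : 1 ≤ Bg) (hE : 1 ≤ E) {K : ℕ} (hK : 1 ≤ K)
    {v : Vec d} {D : ℝ} (hD0 : 0 < D) (hD : ∀ w ∈ p.Θ, ‖v - w‖ ≤ D) {Λ : ℝ} (hΛ : 0 < Λ) :
    P {ω | 2 * D * (4 * σg / Real.sqrt Bg) * Real.sqrt (K * E * Λ) ≤ ∑ k ∈ Finset.range K,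
      p.roundLin a v (p.iterate a w₀ (fun j => X j ω) k) (X k ω)} ≤
      ENNReal.ofReal (Real.exp (-Λ)) := by
  have hB' : (0 : ℝ) < Bg := by exact_mod_cast hBg
  have hE' : (0 : ℝ) < E := by exact_mod_cast hE
  have hK' : (0 : ℝ) < K := by exact_mod_cast hK
  set κ := 4 * σg / Real.sqrt Bg with hκ
  have hκ0 : 0 < κ := by positivity
  set S := Real.sqrt (K * E * Λ) with hS
  have hS0 : 0 < S := Real.sqrt_pos.2 (by positivity)
  have hS2 : S ^ 2 = K * E * Λ := Real.sq_sqrt (by positivity)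
  -- The Chernoff parameter: the log-moment `K E l² D² κ²` becomes `Λ`, while `l` times the
  -- threshold is `2Λ`.
  set l := S / (K * E * D * κ) with hl
  have hl0 : 0 < l := by positivity
  have key := measure_sum_clientMix_ge_le (a := a) (w₀ := w₀) hmn hf hg hX hK
    (Φf := fun i w s => l * clientLin p.Θ p.𝒟 p.df a.γ v i w s)
    (Φg := fun i w s => l * clientLin p.Θ p.𝒟 p.dg a.γ v i w s)
    (fun i => (hf.measurable_clientLin hΘ a.γ v i).const_mul l)
    (fun i => (hg.measurable_clientLin hΘ a.γ v i).const_mul l)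
    (c := E * (l ^ 2 * D ^ 2 * κ ^ 2)) (by positivity)
    (fun w i => hf.lintegral_exp_clientLin_le hΘ hσ hBg a.γ hD l i w)
    (fun w i => hg.lintegral_exp_clientLin_le hΘ hσ hBg a.γ hD l i w) (2 * Λ)
  have e1 : K * (E * (l ^ 2 * D ^ 2 * κ ^ 2)) - 2 * Λ = -Λ := by
    have : K * (E * (l ^ 2 * D ^ 2 * κ ^ 2)) = S ^ 2 / (K * E) := by rw [hl]; field_simp
    rw [this, hS2]; field_simp; ring
  rw [e1] at key
  refine le_trans (measure_mono fun ω hω => ?_) key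
  simp only [Set.mem_ofPred_eq, ← mul_clientMix, ← Finset.mul_sum] at hω ⊢
  have e2 : 2 * Λ = l * (2 * D * κ * S) := by
    have : l * (2 * D * κ * S) = 2 * S ^ 2 / (K * E) := by rw [hl]; field_simp
    rw [this, hS2]; field_simp
  rw [e2]
  exact mul_le_mul_of_nonneg_left hω hl0.le

/-- With exponential moment `2` per round, the threshold for probability `exp (-Λ)` is `K log 2 +
Λ`, rescaled by `E`; `3 / 4` is an upper bound for `log 2`. -/
theorem measure_sum_roundQuad_ge_le (hmn : m ≤ n)
    (hf : FamilyAssumptions p.Θ p.𝒟 p.f p.df L σζ σg σ)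
    (hg : FamilyAssumptions p.Θ p.𝒟 p.g p.dg L σζ σg σ) (hX : IsIIDRounds P m p.𝒟 X)
    (hΘ : MeasurableSet p.Θ) (hσ : 0 < σg) (hBg : 1 ≤ Bg) (hE : 1 ≤ E) {K : ℕ} (hK : 1 ≤ K)
    (Λ : ℝ) :
    P {ω | E * (K * (3 / 4) + Λ) ≤ ∑ k ∈ Finset.range K,
      p.roundQuad a (4 * σg / Real.sqrt Bg) (p.iterate a w₀ (fun j => X j ω) k) (X k ω)} ≤
      ENNReal.ofReal (Real.exp (-Λ)) := by
  have hE' : (0 : ℝ) < E := by exact_mod_cast hE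
  set κ := 4 * σg / Real.sqrt Bg with hκ
  have h2 : (2 : ENNReal) = ENNReal.ofReal (Real.exp (Real.log 2)) := by
    rw [Real.exp_log (by norm_num)]; norm_num
  have key := measure_sum_clientMix_ge_le (a := a) (w₀ := w₀) hmn hf hg hX hK
    (Φf := fun i w s => (E : ℝ)⁻¹ * clientQuad p.Θ p.𝒟 p.df a.γ κ i w s)
    (Φg := fun i w s => (E : ℝ)⁻¹ * clientQuad p.Θ p.𝒟 p.dg a.γ κ i w s)
    (fun i => (hf.measurable_clientQuad hΘ a.γ κ i).const_mul _)
    (fun i => (hg.measurable_clientQuad hΘ a.γ κ i).const_mul _)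
    (c := Real.log 2) (Real.log_nonneg (by norm_num))
    (fun w i => (hf.lintegral_exp_clientQuad_le hΘ hσ hBg hE a.γ i w).trans_eq h2)
    (fun w i => (hg.lintegral_exp_clientQuad_le hΘ hσ hBg hE a.γ i w).trans_eq h2)
    (K * Real.log 2 + Λ)
  rw [sub_add_cancel_left] at key
  refine le_trans (measure_mono fun ω hω => ?_) key
  simp only [Set.mem_ofPred_eq, ← mul_clientMix, ← Finset.mul_sum] at hω ⊢
  rw [← div_eq_inv_mul, le_div_iff₀ hE']
  refine le_trans ?_ hω
  rw [mul_comm]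
  have hlog : Real.log 2 ≤ 3 / 4 := by linarith [Real.log_two_lt_d9]
  gcongr

open scoped Classical in
/-- The sampling gap of the mean values at `w`, set to `0` outside `Θ`. -/
def gapOn (Θ : Set (Vec d)) (𝒟 : Fin n → Measure Z) (h : Fin n → Vec d → Z → ℝ) (w : Vec d)
    (A : Finset (Fin n)) : ℝ :=
  if w ∈ Θ then samplingGap (fun i => meanValue 𝒟 h i w) A else 0

/-- The sum of exponentials is bounded instead of the exponential of the sum: one Markov bound then
serves every subset of rounds, including the random set `𝒮`, through `sum_le_mul_log_of_sum_exp_le`.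
Each round contributes at most `2` to the mean. -/
theorem measure_sum_exp_gapOn_ge_le (hm : 1 ≤ m) (hmn : m ≤ n)
    (hf : FamilyAssumptions p.Θ p.𝒟 p.f p.df L σζ σg σ)
    (hg : FamilyAssumptions p.Θ p.𝒟 p.g p.dg L σζ σg σ) (hX : IsIIDRounds P m p.𝒟 X)
    (hΘ : MeasurableSet p.Θ) (hσ : 0 < σ) {K : ℕ} (hK : 1 ≤ K)
    {h : Fin n → Vec d → Z → ℝ} {dh : Fin n → Vec d → Z → Vec d}
    (H : FamilyAssumptions p.Θ p.𝒟 h dh L σζ σg σ) {ρ : ℝ} (hρ : 0 < ρ) :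
    P {ω | K * (2 / ρ) ≤ ∑ k ∈ Finset.range K,
      Real.exp (gapOn p.Θ p.𝒟 h (p.iterate a w₀ (fun j => X j ω) k) (X k ω).1 /
        (2 * samplingScale σ m n))} ≤ ENNReal.ofReal ρ := by
  have := isProbabilityMeasure_roundLaw (E := E) (Bζ := Bζ) (Bg := Bg) hmn p.𝒟
  have hU := isProbabilityMeasure_uniformOn_powersetCard hmn
  have hK' : (0 : ℝ) < K := by exact_mod_cast hK
  have hstep : Measurable fun q : Vec d × RoundSample n E Bζ Bg Z => p.globalStep a q.2 q.1 :=
    measurable_globalStep hf.measurable_value hg.measurable_value hf.measurable_grad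
      hg.measurable_grad
  have hit := measurable_iterate_comp (a := a) (w₀ := w₀) hstep hX.measurable
  set c := 2 * samplingScale σ m n with hc
  have hφ : Measurable fun q : Vec d × RoundSample n E Bζ Bg Z =>
      ENNReal.ofReal (Real.exp (gapOn p.Θ p.𝒟 h q.1 q.2.1 / c)) := by
    have h1 : Measurable fun q : Vec d × RoundSample n E Bζ Bg Z => gapOn p.Θ p.𝒟 h q.1 q.2.1 := by
      refine measurable_of_forall_clients (F := fun w x => gapOn p.Θ p.𝒟 h w x.1) fun A => ?_
      refine Measurable.ite (measurable_fst hΘ) ?_ measurable_const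
      exact measurable_samplingGap (fun i =>
        (measurable_meanValue (H.measurable_value i)).comp measurable_fst) A
    exact (h1.div_const c).exp.ennreal_ofReal
  have hone : ∀ w, ∫⁻ x, ENNReal.ofReal (Real.exp (gapOn p.Θ p.𝒟 h w x.1 / c))
      ∂(roundLaw E Bζ Bg m p.𝒟) ≤ 2 := by
    intro w
    have hφw : Measurable fun A : Finset (Fin n) =>
        ENNReal.ofReal (Real.exp (gapOn p.Θ p.𝒟 h w A / c)) := measurable_of_countable _
    have e : ∫⁻ x : RoundSample n E Bζ Bg Z, ENNReal.ofReal (Real.exp (gapOn p.Θ p.𝒟 h w x.1 / c))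
        ∂(roundLaw E Bζ Bg m p.𝒟) = ∫⁻ A, ENNReal.ofReal (Real.exp (gapOn p.Θ p.𝒟 h w A / c))
          ∂(uniformOn (↑(Finset.powersetCard m (Finset.univ : Finset (Fin n))) :
            Set (Finset (Fin n)))) :=
      (measurePreserving_fst (μ := uniformOn (↑(Finset.powersetCard m
        (Finset.univ : Finset (Fin n))) : Set (Finset (Fin n))))).lintegral_comp hφw
    rw [e]
    by_cases hw : w ∈ p.Θ
    · simp only [gapOn, hw, if_true]
      exact lintegral_exp_samplingGap_le hm hmn hσ _ (H.relative_gap w hw)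
    · simp [gapOn, hw]
  have hφk : ∀ k, Measurable fun ω => ENNReal.ofReal (Real.exp
      (gapOn p.Θ p.𝒟 h (p.iterate a w₀ (fun j => X j ω) k) (X k ω).1 / c)) := fun k =>
    hφ.comp ((hit k).prodMk (hX.measurable k))
  have hint : ∫⁻ ω, ∑ k ∈ Finset.range K, ENNReal.ofReal (Real.exp
      (gapOn p.Θ p.𝒟 h (p.iterate a w₀ (fun j => X j ω) k) (X k ω).1 / c)) ∂P ≤ K * 2 := by
    rw [lintegral_finsetSum _ fun k _ => hφk k]
    refine (Finset.sum_le_sum (g := fun _ => 2) fun k _ => ?_).trans_eq (by simp)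
    exact lintegral_recursion_le (μ := roundLaw E Bζ Bg m p.𝒟) hX.measurable hX.indep
      hX.law hstep (it := p.iterate a w₀) (s₀ := w₀) (fun _ => rfl) (fun _ _ => rfl) hφ hone k
  have hset : {ω | K * (2 / ρ) ≤ ∑ k ∈ Finset.range K,
      Real.exp (gapOn p.Θ p.𝒟 h (p.iterate a w₀ (fun j => X j ω) k) (X k ω).1 / c)} =
      {ω | ENNReal.ofReal (K * (2 / ρ)) ≤ ∑ k ∈ Finset.range K, ENNReal.ofReal (Real.exp
        (gapOn p.Θ p.𝒟 h (p.iterate a w₀ (fun j => X j ω) k) (X k ω).1 / c))} := by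
    ext ω
    simp only [Set.mem_ofPred_eq]
    rw [← ENNReal.ofReal_sum_of_nonneg fun k _ => (Real.exp_pos _).le,
      ENNReal.ofReal_le_ofReal_iff (Finset.sum_nonneg fun k _ => (Real.exp_pos _).le)]
  rw [hset]
  have hpos : 0 < (K : ℝ) * (2 / ρ) := by positivity
  refine (meas_ge_le_lintegral_div (Finset.measurable_sum _ fun k _ => hφk k).aemeasurable
    (ENNReal.ofReal_pos.2 hpos).ne' ENNReal.ofReal_ne_top).trans ?_
  refine (ENNReal.div_le_div_right hint _).trans_eq ?_
  have e3 : (K * 2 : ENNReal) = ENNReal.ofReal (K * 2) := by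
    rw [ENNReal.ofReal_mul (by positivity)]; norm_num
  rw [e3, ← ENNReal.ofReal_div_of_pos hpos]
  congr 1
  field_simp

/-- The value estimates of the participating clients are accurate in all rounds. -/
theorem measure_exists_est_ge_le (hmn : m ≤ n)
    (hf : FamilyAssumptions p.Θ p.𝒟 p.f p.df L σζ σg σ)
    (hg : FamilyAssumptions p.Θ p.𝒟 p.g p.dg L σζ σg σ) (hX : IsIIDRounds P m p.𝒟 X)
    (hΘ : MeasurableSet p.Θ) (hσ : 0 < σζ) (hBζ : 1 ≤ Bζ) (K : ℕ)
    {h : Fin n → Vec d → Z → ℝ} {dh : Fin n → Vec d → Z → Vec d}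
    (H : FamilyAssumptions p.Θ p.𝒟 h dh L σζ σg σ) {e : ℝ} (he : 0 ≤ e) :
    P {ω | ∃ k < K, p.iterate a w₀ (fun j => X j ω) k ∈ p.Θ ∧ ∃ i ∈ (X k ω).1,
      e ≤ |batchMean (h i (p.iterate a w₀ (fun j => X j ω) k)) ((X k ω).2.1 i) -
        meanValue p.𝒟 h i (p.iterate a w₀ (fun j => X j ω) k)|} ≤
      ENNReal.ofReal (K * (m * (2 * Real.exp (-(Bζ * e ^ 2 / (4 * σζ ^ 2)))))) := by
  have := isProbabilityMeasure_roundLaw (E := E) (Bζ := Bζ) (Bg := Bg) hmn p.𝒟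
  have hU := isProbabilityMeasure_uniformOn_powersetCard hmn
  have hstep : Measurable fun q : Vec d × RoundSample n E Bζ Bg Z => p.globalStep a q.2 q.1 :=
    measurable_globalStep hf.measurable_value hg.measurable_value hf.measurable_grad
      hg.measurable_grad
  set q₀ := 2 * Real.exp (-(Bζ * e ^ 2 / (4 * σζ ^ 2))) with hq₀
  have hq₀0 : 0 ≤ q₀ := by positivity
  set bad : Fin n → Set (Vec d × (Fin Bζ → Z)) := fun i =>
    {q | q.1 ∈ p.Θ ∧ e ≤ |batchMean (h i q.1) q.2 - meanValue p.𝒟 h i q.1|} with hbad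
  have hbadm : ∀ i, MeasurableSet (bad i) := fun i => by
    have e1 : bad i = (Prod.fst ⁻¹' p.Θ) ∩
        {q | e ≤ |batchMean (h i q.1) q.2 - meanValue p.𝒟 h i q.1|} := by
      ext q; simp [hbad]
    rw [e1]
    refine (measurable_fst hΘ).inter (measurableSet_le measurable_const ?_)
    exact ((measurable_batchMean (H.measurable_value i)).sub
      ((measurable_meanValue (H.measurable_value i)).comp measurable_fst)).abs
  have hbadle : ∀ i w, (Measure.pi fun _ : Fin Bζ => p.𝒟 i) {s | (w, s) ∈ bad i} ≤
      ENNReal.ofReal q₀ := by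
    intro i w
    by_cases hw : w ∈ p.Θ
    · have h1 := (H.centeredSubGaussian_value hσ i hw).measure_abs_batchMean_ge_le hσ hBζ he
      simp only [batchMean_sub_const hBζ] at h1
      have e1 : {s | (w, s) ∈ bad i} =
          {s | e ≤ |batchMean (h i w) s - meanValue p.𝒟 h i w|} := by
        ext s; simp [hbad, hw]
      rw [e1]
      exact h1
    · simp [hbad, hw]
  -- `φ` counts the participating clients with an inaccurate estimate. Client sampling is
  -- independent of the value batches, so its mean is at most `m q₀`: the union bound costs `m`, not
  -- `n`.
  set φ : Vec d × RoundSample n E Bζ Bg Z → ENNReal := fun q =>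
    ∑ i ∈ q.2.1, (bad i).indicator 1 (q.1, q.2.2.1 i) with hφdef
  have hφ : Measurable φ := by
    refine measurable_of_forall_clients
      (F := fun w x => ∑ i ∈ x.1, (bad i).indicator 1 (w, x.2.1 i)) fun A => ?_
    refine Finset.measurable_sum _ fun i _ => ?_
    exact (measurable_one.indicator (hbadm i)).comp
      (measurable_fst.prodMk ((measurable_pi_apply i).comp measurable_snd.fst))
  have hone : ∀ w, ∫⁻ x, φ (w, x) ∂(roundLaw E Bζ Bg m p.𝒟) ≤ ENNReal.ofReal (m * q₀) := by
    intro w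
    have hφw : Measurable fun x => φ (w, x) := hφ.comp measurable_prodMk_left
    rw [roundLaw, lintegral_prod _ hφw.aemeasurable]
    refine (lintegral_mono_ae (g := fun _ => ENNReal.ofReal (m * q₀)) ?_).trans_eq (by simp)
    filter_upwards [ae_card_eq_of_uniformOn_powersetCard n m] with A hA
    have hi : ∀ i, Measurable fun s : Fin Bζ → Z =>
        ((bad i).indicator 1 (w, s) : ENNReal) := fun i =>
      (measurable_one.indicator (hbadm i)).comp measurable_prodMk_left
    have hi2 : ∀ i, Measurable fun y : (Fin n → Fin Bζ → Z) × (Fin n → Fin E → Fin Bg → Z) =>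
        ((bad i).indicator 1 (w, y.1 i) : ENNReal) := fun i =>
      (hi i).comp ((measurable_pi_apply i).comp measurable_fst)
    simp only [hφdef]
    rw [lintegral_finsetSum _ fun i _ => hi2 i]
    refine (Finset.sum_le_sum (g := fun _ => ENNReal.ofReal q₀) fun i _ => ?_).trans_eq ?_
    · have e1 : ∫⁻ y : (Fin n → Fin Bζ → Z) × (Fin n → Fin E → Fin Bg → Z),
          ((bad i).indicator 1 (w, y.1 i) : ENNReal) ∂((Measure.pi fun i => Measure.pi fun _ =>
            p.𝒟 i).prod (Measure.pi fun i => Measure.pi fun _ => Measure.pi fun _ => p.𝒟 i)) =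
          ∫⁻ s, ((bad i).indicator 1 (w, s) : ENNReal) ∂(Measure.pi fun _ : Fin Bζ => p.𝒟 i) :=
        ((measurePreserving_eval (fun i => Measure.pi fun _ : Fin Bζ => p.𝒟 i) i).comp
          measurePreserving_fst).lintegral_comp (hi i)
      rw [e1]
      refine le_trans (le_of_eq ?_) (hbadle i w)
      have e2 : ∀ s, ((bad i).indicator 1 (w, s) : ENNReal) =
          (Prod.mk w ⁻¹' bad i).indicator 1 s := fun s => rfl
      rw [lintegral_congr e2, lintegral_indicator_one (measurable_prodMk_left (hbadm i))]
      rfl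
    · rw [Finset.sum_const, hA, nsmul_eq_mul, ENNReal.ofReal_mul (p := (m : ℝ)) (by positivity),
        ENNReal.ofReal_natCast]
  have hit := measurable_iterate_comp (a := a) (w₀ := w₀) hstep hX.measurable
  have hk : ∀ k, P {ω | 1 ≤ φ (p.iterate a w₀ (fun j => X j ω) k, X k ω)} ≤
      ENNReal.ofReal (m * q₀) := fun k => by
    have h1 := lintegral_recursion_le (μ := roundLaw E Bζ Bg m p.𝒟) hX.measurable hX.indep
      hX.law hstep (it := p.iterate a w₀) (s₀ := w₀) (fun _ => rfl) (fun _ _ => rfl) hφ hone k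
    refine (meas_ge_le_lintegral_div (hφ.comp
      ((hit k).prodMk (hX.measurable k))).aemeasurable one_ne_zero ENNReal.one_ne_top).trans ?_
    simpa using h1
  calc _ ≤ P (⋃ k ∈ Finset.range K, {ω | 1 ≤ φ (p.iterate a w₀ (fun j => X j ω) k, X k ω)}) := by
        refine measure_mono fun ω hω => ?_
        obtain ⟨k, hkK, hw, i, hi, hie⟩ := hω
        simp only [Set.mem_iUnion, Finset.mem_range]
        refine ⟨k, hkK, ?_⟩
        have hmem : (p.iterate a w₀ (fun j => X j ω) k, (X k ω).2.1 i) ∈ bad i := ⟨hw, hie⟩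
        have h2 := Finset.single_le_sum (f := fun i => ((bad i).indicator 1
          (p.iterate a w₀ (fun j => X j ω) k, (X k ω).2.1 i) : ENNReal))
          (fun _ _ => zero_le) hi
        simp only [Set.indicator_of_mem hmem, Pi.one_apply] at h2
        exact h2
    _ ≤ ∑ k ∈ Finset.range K, P {ω | 1 ≤ φ (p.iterate a w₀ (fun j => X j ω) k, X k ω)} :=
        measure_biUnion_finset_le _ _
    _ ≤ ∑ k ∈ Finset.range K, ENNReal.ofReal (m * q₀) := Finset.sum_le_sum fun k _ => hk k
    _ = _ := by
        rw [Finset.sum_const, Finset.card_range, nsmul_eq_mul,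
          ENNReal.ofReal_mul (p := (K : ℝ)) (by positivity), ENNReal.ofReal_natCast]

theorem ae_forall_card_eq {n E Bζ Bg m : ℕ} {Z Ω : Type*} [MeasurableSpace Z] [MeasurableSpace Ω]
    {𝒟 : Fin n → Measure Z} [∀ i, IsProbabilityMeasure (𝒟 i)] {P : Measure Ω}
    {X : ℕ → Ω → RoundSample n E Bζ Bg Z} (hX : IsIIDRounds P m 𝒟 X) :
    ∀ᵐ ω ∂P, ∀ k, (X k ω).1.card = m := by
  rw [ae_all_iff]
  intro k
  have h1 : ∀ᵐ x ∂(roundLaw E Bζ Bg m 𝒟), x.1.card = m := by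
    have := Measure.quasiMeasurePreserving_fst (μ := uniformOn (↑(Finset.powersetCard m
        (Finset.univ : Finset (Fin n))) : Set (Finset (Fin n))))
      (ν := (Measure.pi fun i => Measure.pi fun _ : Fin Bζ => 𝒟 i).prod
      (Measure.pi fun i => Measure.pi fun _ : Fin E => Measure.pi fun _ : Fin Bg => 𝒟 i))
    exact this.ae (ae_card_eq_of_uniformOn_powersetCard n m)
  rw [← hX.law k] at h1
  exact ae_of_ae_map (hX.measurable k).aemeasurable h1

end FedProblem


/-! ### Softmax -/

/-- The Gibbs variational principle: `log z` equals `α` times the softmax mean plus the entropy of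
the weights. The entropy is at most `log |A|`, and `α v_j ≤ log z`. The sign of `α` plays no role.
-/
theorem mul_sub_sum_maskedSoftmax_le {n : ℕ} {A : Finset (Fin n)} (v : Fin n → ℝ) (α : ℝ)
    {j : Fin n} (hj : j ∈ A) :
    α * (v j - ∑ i ∈ A, maskedSoftmax A (fun i => α * v i) i * v i) ≤ Real.log A.card := by
  have hA : A.Nonempty := ⟨j, hj⟩
  set z := ∑ i ∈ A, Real.exp (α * v i) with hz
  have hz0 : 0 < z := Finset.sum_pos (fun i _ => Real.exp_pos _) hA
  set π : Fin n → ℝ := maskedSoftmax A fun i => α * v i with hπ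
  have hc : (0 : ℝ) < A.card := by exact_mod_cast hA.card_pos
  have hπi : ∀ i ∈ A, π i = Real.exp (α * v i) / z := fun i hi => by
    simp [hπ, maskedSoftmax, hi, hz]
  have hsum : ∑ i ∈ A, π i = 1 := sum_maskedSoftmax hA _
  have h1 : α * v j ≤ Real.log z := by
    rw [← Real.log_exp (α * v j)]
    exact Real.log_le_log (Real.exp_pos _)
      (Finset.single_le_sum (f := fun i => Real.exp (α * v i)) (fun i _ => (Real.exp_pos _).le) hj)
  have h2 : ∀ i ∈ A, π i * Real.log z - α * (π i * v i) ≤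
      π i * Real.log A.card + ((A.card : ℝ)⁻¹ - π i) := by
    intro i hi
    have hp : 0 < π i := by rw [hπi i hi]; exact div_pos (Real.exp_pos _) hz0
    have hl : Real.log (π i) = α * v i - Real.log z := by
      rw [hπi i hi, Real.log_div (Real.exp_pos _).ne' hz0.ne', Real.log_exp]
    -- The entropy bound term by term, from `log y ≤ y - 1` at `y = 1/(|A| π_i)`. The remainders
    -- `1/|A| - π_i` cancel in the sum.
    have h3 := Real.log_le_sub_one_of_pos (inv_pos.2 (mul_pos hc hp))
    rw [Real.log_inv, Real.log_mul hc.ne' hp.ne', hl] at h3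
    have h4 := mul_le_mul_of_nonneg_left h3 hp.le
    have h5 : π i * ((A.card * π i)⁻¹ - 1) = (A.card : ℝ)⁻¹ - π i := by field_simp
    rw [h5] at h4
    linarith
  have h3 := Finset.sum_le_sum h2
  rw [Finset.sum_sub_distrib, ← Finset.sum_mul, ← Finset.mul_sum, Finset.sum_add_distrib,
    ← Finset.sum_mul, Finset.sum_sub_distrib, hsum, Finset.sum_const, nsmul_eq_mul,
    mul_inv_cancel₀ hc.ne'] at h3
  linarith

theorem sub_half_le_sum_maskedSoftmax {n : ℕ} {A : Finset (Fin n)} (v : Fin n → ℝ) {α ε : ℝ}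
    (hε : 0 < ε) (hα : 2 * Real.log A.card / ε ≤ α) {j : Fin n} (hj : j ∈ A) :
    v j - ε / 2 ≤ ∑ i ∈ A, maskedSoftmax A (fun i => α * v i) i * v i := by
  have hA : 1 ≤ A.card := Finset.card_pos.2 ⟨j, hj⟩
  -- For a single client `log 1 = 0`, so `α` may be `0` and cannot be divided out; the weighted mean
  -- is then exact.
  rcases hA.eq_or_lt with h1 | h1
  · obtain ⟨b, rfl⟩ := Finset.card_eq_one.1 h1.symm
    have hs := sum_maskedSoftmax (Finset.singleton_nonempty b) fun i => α * v i
    rw [Finset.sum_singleton] at hs ⊢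
    rw [Finset.mem_singleton.1 hj, hs]
    linarith
  · have hlog : 0 < Real.log A.card := Real.log_pos (by exact_mod_cast h1)
    have hα0 : 0 < α := lt_of_lt_of_le (by positivity) hα
    have h2 := mul_sub_sum_maskedSoftmax_le v α hj
    rw [div_le_iff₀ hε] at hα
    have h3 : α * (v j - ∑ i ∈ A, maskedSoftmax A (fun i => α * v i) i * v i) ≤ α * (ε / 2) := by
      linarith
    linarith [le_of_mul_le_mul_left h3 hα0]

/-! ### Descent of perturbed subgradient steps -/

/-- Perturbed subgradient steps for an `L`-Lipschitz convex function with values `H` along the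
iterates `u` and value `Hv` at the reference point `v`. -/
theorem sum_subgradient_steps_le {V : Type*} [NormedAddCommGroup V] [InnerProductSpace ℝ V]
    {E : ℕ} (hE : 1 ≤ E) {u G ξ : ℕ → V} {H : ℕ → ℝ} {Hv γ L : ℝ} {v : V} (hγ : 0 ≤ γ)
    (hL : 0 ≤ L) (hu : ∀ τ < E, u (τ + 1) = u τ - γ • (G τ + ξ τ))
    (hG : ∀ τ < E, ‖G τ‖ ≤ L) (hsub : ∀ τ < E, H τ + inner ℝ (G τ) (v - u τ) ≤ Hv)
    (hlip : ∀ τ < E, |H τ - H 0| ≤ L * ‖u τ - u 0‖) :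
    2 * γ * E * (H 0 - Hv) ≤ ‖u 0 - v‖ ^ 2 - ‖u E - v‖ ^ 2 +
      2 * γ * ∑ τ ∈ Finset.range E, inner ℝ (v - u τ) (ξ τ) + 6 * γ ^ 2 * E ^ 2 * L ^ 2 +
      γ ^ 2 * ∑ τ ∈ Finset.range E,
        (2 * ‖ξ τ‖ ^ 2 + ‖∑ j ∈ Finset.range τ, ξ j‖ ^ 2 / (4 * E)) := by
  have hE' : (1 : ℝ) ≤ E := by exact_mod_cast hE
  have hdrift : ∀ τ ≤ E, u τ - u 0 =
      -(γ • (∑ j ∈ Finset.range τ, G j + ∑ j ∈ Finset.range τ, ξ j)) := by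
    intro τ
    induction τ with
    | zero => simp
    | succ τ ih =>
      intro hτ
      have h1 := ih (by omega)
      rw [hu τ (by omega), Finset.sum_range_succ, Finset.sum_range_succ, sub_right_comm, h1]
      module
  have hnorm : ∀ τ < E, ‖u τ - u 0‖ ≤ γ * (τ * L + ‖∑ j ∈ Finset.range τ, ξ j‖) := by
    intro τ hτ
    rw [hdrift τ hτ.le, norm_neg, norm_smul, Real.norm_of_nonneg hγ]
    refine mul_le_mul_of_nonneg_left ((norm_add_le _ _).trans (add_le_add_left ?_ _)) hγ
    refine (norm_sum_le_of_le _ fun j hj =>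
      hG j ((Finset.mem_range.1 hj).trans hτ)).trans_eq ?_
    simp
  have hstep : ∀ τ ∈ Finset.range E, 2 * γ * (H 0 - Hv) ≤
      (‖u τ - v‖ ^ 2 - ‖u (τ + 1) - v‖ ^ 2) + 2 * γ * inner ℝ (v - u τ) (ξ τ) +
        6 * γ ^ 2 * E * L ^ 2 +
        γ ^ 2 * (2 * ‖ξ τ‖ ^ 2 + ‖∑ j ∈ Finset.range τ, ξ j‖ ^ 2 / (4 * E)) := by
    intro τ hτ
    have hτ' := Finset.mem_range.1 hτ
    have hτE : (τ : ℝ) + 1 ≤ E := by exact_mod_cast hτ'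
    set S := ‖∑ j ∈ Finset.range τ, ξ j‖ with hS
    have e1 : ‖u (τ + 1) - v‖ ^ 2 = ‖u τ - v‖ ^ 2 - 2 * γ * inner ℝ (u τ - v) (G τ) -
        2 * γ * inner ℝ (u τ - v) (ξ τ) + γ ^ 2 * ‖G τ + ξ τ‖ ^ 2 := by
      rw [hu τ hτ', sub_right_comm, norm_sub_sq_real, inner_smul_right, inner_add_right, norm_smul,
        mul_pow, Real.norm_eq_abs, sq_abs]
      ring
    have e2 : inner ℝ (G τ) (v - u τ) = -inner ℝ (u τ - v) (G τ) := by
      rw [← neg_sub, inner_neg_right, real_inner_comm]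
    have e3 : (inner ℝ (v - u τ) (ξ τ) : ℝ) = -inner ℝ (u τ - v) (ξ τ) := by
      rw [← neg_sub, inner_neg_left]
    have h1 := hsub τ hτ'
    rw [e2] at h1
    have h2 : ‖G τ + ξ τ‖ ^ 2 ≤ 2 * L ^ 2 + 2 * ‖ξ τ‖ ^ 2 := by
      have h3 := pow_le_pow_left₀ (norm_nonneg _) (norm_add_le (G τ) (ξ τ)) 2
      have h4 := pow_le_pow_left₀ (norm_nonneg _) (hG τ hτ') 2
      nlinarith [sq_nonneg (‖G τ‖ - ‖ξ τ‖)]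
    have h3 : H 0 - H τ ≤ L * (γ * (τ * L + S)) := by
      have := (abs_le.1 (hlip τ hτ')).1
      have := mul_le_mul_of_nonneg_left (hnorm τ hτ') hL
      linarith
    -- Young's inequality, weighted so that the drift `S²` gets the factor `1/(4E)`. The
    -- coefficients of `γ²L²` then add up to `2 + 2τ + 4E ≤ 6E`.
    have h4 : 2 * L * S ≤ 4 * E * L ^ 2 + S ^ 2 / (4 * E) := by
      have : 4 * E * L ^ 2 + S ^ 2 / (4 * E) - 2 * L * S = (4 * E * L - S) ^ 2 / (4 * E) := by
        field_simp; ring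
      have : 0 ≤ (4 * E * L - S) ^ 2 / (4 * E) := by positivity
      linarith
    have h5 := mul_le_mul_of_nonneg_left h1 hγ
    have h6 := mul_le_mul_of_nonneg_left h2 (sq_nonneg γ)
    have h7 := mul_le_mul_of_nonneg_left h3 hγ
    have h8 := mul_le_mul_of_nonneg_left h4 (sq_nonneg γ)
    have h9 : γ ^ 2 * L ^ 2 * (τ + 1) ≤ γ ^ 2 * L ^ 2 * E :=
      mul_le_mul_of_nonneg_left hτE (by positivity)
    rw [e1, e3]
    nlinarith
  have hsum := Finset.sum_le_sum hstep
  rw [Finset.sum_add_distrib, Finset.sum_add_distrib, Finset.sum_add_distrib,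
    Finset.sum_range_sub', Finset.sum_const, Finset.sum_const, Finset.card_range, nsmul_eq_mul,
    nsmul_eq_mul] at hsum
  rw [Finset.mul_sum, Finset.mul_sum]
  linarith

/-- As long as the path stays in `Θ`, `localNoise` is the true gradient error, so the local run is a
perturbed subgradient method for the mean function of client `i`. -/
theorem FamilyAssumptions.sum_local_steps_le {n d E B : ℕ} {Z : Type*} [MeasurableSpace Z]
    {Θ : Set (Vec d)} {𝒟 : Fin n → Measure Z} {h : Fin n → Vec d → Z → ℝ}
    {dh : Fin n → Vec d → Z → Vec d} {L σζ σg σ : ℝ}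
    (H : FamilyAssumptions Θ 𝒟 h dh L σζ σg σ) (hE : 1 ≤ E) {γ κ : ℝ} (hγ : 0 ≤ γ) (hL : 0 ≤ L)
    (hκ : 0 < κ) {v : Vec d} (hv : v ∈ Θ) (i : Fin n) (w : Vec d) (s : Fin E → Fin B → Z)
    (hs : ∀ τ < E, localPath (dh i) γ w s τ ∈ Θ) :
    2 * γ * E * (meanValue 𝒟 h i w - meanValue 𝒟 h i v) ≤
      ‖w - v‖ ^ 2 - ‖localPath (dh i) γ w s E - v‖ ^ 2 + 2 * γ * clientLin Θ 𝒟 dh γ v i w s +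
        6 * γ ^ 2 * E ^ 2 * L ^ 2 + 8 * γ ^ 2 * κ ^ 2 * clientQuad Θ 𝒟 dh γ κ i w s := by
  have hE' : (1 : ℝ) ≤ E := by exact_mod_cast hE
  have h1 := sum_subgradient_steps_le hE (u := localPath (dh i) γ w s)
    (G := fun τ => meanGrad 𝒟 dh i (localPath (dh i) γ w s τ))
    (ξ := localNoise Θ (dh i) (meanGrad 𝒟 dh i) γ w s)
    (H := fun τ => meanValue 𝒟 h i (localPath (dh i) γ w s τ)) (Hv := meanValue 𝒟 h i v)
    (v := v) hγ hL
    (fun τ hτ => by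
      have h2 : localPath (dh i) γ w s (τ + 1) = localPath (dh i) γ w s τ -
          γ • batchMean (dh i (localPath (dh i) γ w s τ)) (s ⟨τ, hτ⟩) := by
        simp [localPath, hτ]
      simp only [localNoise, hτ, hs τ hτ, dite_true, if_true, h2, add_sub_cancel])
    (fun τ hτ => H.norm_subgradient i _ (hs τ hτ))
    (fun τ hτ => H.subgradient i _ (hs τ hτ) v hv)
    (fun τ hτ => H.lipschitz i _ (hs τ hτ) _ (hs 0 (by omega)))
  refine h1.trans ?_
  have h3 : γ ^ 2 * ∑ τ ∈ Finset.range E,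
        (2 * ‖localNoise Θ (dh i) (meanGrad 𝒟 dh i) γ w s τ‖ ^ 2 +
          ‖∑ j ∈ Finset.range τ, localNoise Θ (dh i) (meanGrad 𝒟 dh i) γ w s j‖ ^ 2 / (4 * E)) ≤
      8 * γ ^ 2 * κ ^ 2 * clientQuad Θ 𝒟 dh γ κ i w s := by
    rw [mul_comm 8, mul_assoc, mul_assoc]
    refine mul_le_mul_of_nonneg_left ?_ (sq_nonneg γ)
    rw [← mul_assoc, clientQuad, Finset.mul_sum]
    refine Finset.sum_le_sum fun τ _ => ?_
    set x := ‖localNoise Θ (dh i) (meanGrad 𝒟 dh i) γ w s τ‖ ^ 2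
    set y := ‖∑ j ∈ Finset.range τ, localNoise Θ (dh i) (meanGrad 𝒟 dh i) γ w s j‖ ^ 2
    have hx : 0 ≤ x := sq_nonneg _
    -- The weights in `clientQuad` make the drift term match exactly, while the factor `4` of the
    -- plain squares leaves room over the required `2`.
    have e : 8 * κ ^ 2 * (1 / 2 * (x / κ ^ 2) + 1 / 2 * (y / (16 * E * κ ^ 2))) =
        4 * x + y / (4 * E) := by
      field_simp; ring
    rw [e]
    linarith
  have e0 : localPath (dh i) γ w s 0 = w := rfl
  simp only [e0, clientLin]
  linarith

namespace FedProblem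

variable {n d E Bζ Bg m : ℕ} {Z : Type*} [MeasurableSpace Z] {p : FedProblem n d Z}
  {L σζ σg σ : ℝ} {a : AlgParams}

/-- The weighted mean over clients of the suboptimality, relative to `v`, of the function used in
the round. -/
def roundGap (p : FedProblem n d Z) (a : AlgParams) (v w : Vec d) (x : RoundSample n E Bζ Bg Z) :
    ℝ :=
  p.clientMix a (fun i w _ => meanValue p.𝒟 p.f i w - meanValue p.𝒟 p.f i v)
    (fun i w _ => meanValue p.𝒟 p.g i w - meanValue p.𝒟 p.g i v) w x

/-- The identity `η = γ E` makes the global step the weighted mean of the final local iterates, so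
convexity of the squared norm lets the client inequalities be averaged with the aggregation weights.
-/
theorem roundGap_le (hf : FamilyAssumptions p.Θ p.𝒟 p.f p.df L σζ σg σ)
    (hg : FamilyAssumptions p.Θ p.𝒟 p.g p.dg L σζ σg σ) (hE : 1 ≤ E) {κ : ℝ} (hγ : 0 < a.γ)
    (hη : a.η = a.γ * E) (hL : 0 ≤ L) (hκ : 0 < κ) {v : Vec d} (hv : v ∈ p.Θ) (w : Vec d)
    (x : RoundSample n E Bζ Bg Z) (hx : x.1.Nonempty)
    (hs : ∀ i ∈ x.1, ∀ τ < E, p.localIterate a x w i τ ∈ p.Θ) :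
    2 * a.γ * E * p.roundGap a v w x ≤ ‖w - v‖ ^ 2 - ‖p.globalStep a x w - v‖ ^ 2 +
      2 * a.γ * p.roundLin a v w x + 6 * a.γ ^ 2 * E ^ 2 * L ^ 2 +
      8 * a.γ ^ 2 * κ ^ 2 * p.roundQuad a κ w x := by
  have hE' : (1 : ℝ) ≤ E := by exact_mod_cast hE
  have hr0 := fun i => roundWeight_nonneg (p := p) (a := a) x w i
  have hr1 := sum_roundWeight (p := p) (a := a) hx w
  set r := p.roundWeight a x w with hr
  have hconv : ‖p.globalStep a x w - v‖ ^ 2 ≤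
      ∑ i ∈ x.1, r i * ‖p.localIterate a x w i E - v‖ ^ 2 := by
    have e1 : p.globalStep a x w - v = ∑ i ∈ x.1, r i • (p.localIterate a x w i E - v) := by
      rw [globalStep_eq_clientMix (by positivity) hη hx]
      simp only [smul_sub, Finset.sum_sub_distrib]
      rw [← Finset.sum_smul, hr1, one_smul]
    have hcv : ConvexOn ℝ Set.univ fun y : Vec d => ‖y‖ ^ 2 :=
      (convexOn_norm convex_univ).pow (fun _ _ => norm_nonneg _) 2
    rw [e1]
    exact hcv.map_sum_le (fun i _ => hr0 i) hr1 fun i _ => Set.mem_univ _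
  have hi : ∀ i ∈ x.1, r i * (2 * a.γ * E *
      (if p.constraintEst a x w ≤ a.ε / 2 then meanValue p.𝒟 p.f i w - meanValue p.𝒟 p.f i v
        else meanValue p.𝒟 p.g i w - meanValue p.𝒟 p.g i v)) ≤
      r i * (‖w - v‖ ^ 2 - ‖p.localIterate a x w i E - v‖ ^ 2 +
        2 * a.γ * (if p.constraintEst a x w ≤ a.ε / 2 then
          clientLin p.Θ p.𝒟 p.df a.γ v i w (x.2.2 i)
          else clientLin p.Θ p.𝒟 p.dg a.γ v i w (x.2.2 i)) + 6 * a.γ ^ 2 * E ^ 2 * L ^ 2 +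
        8 * a.γ ^ 2 * κ ^ 2 * (if p.constraintEst a x w ≤ a.ε / 2 then
          clientQuad p.Θ p.𝒟 p.df a.γ κ i w (x.2.2 i)
          else clientQuad p.Θ p.𝒟 p.dg a.γ κ i w (x.2.2 i))) := by
    intro i hi
    refine mul_le_mul_of_nonneg_left ?_ (hr0 i)
    have hs' := hs i hi
    simp only [localIterate_eq_localPath, roundOracle] at hs' ⊢
    by_cases hc : p.constraintEst a x w ≤ a.ε / 2
    · simp only [hc, if_true] at hs' ⊢
      exact hf.sum_local_steps_le hE hγ.le hL hκ hv i w (x.2.2 i) hs'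
    · simp only [hc, if_false] at hs' ⊢
      exact hg.sum_local_steps_le hE hγ.le hL hκ hv i w (x.2.2 i) hs'
  have hsum := Finset.sum_le_sum hi
  have e2 : ∀ (c : ℝ) (φ : Fin n → ℝ), ∑ i ∈ x.1, r i * (c * φ i) = c * ∑ i ∈ x.1, r i * φ i :=
    fun c φ => by rw [Finset.mul_sum]; exact Finset.sum_congr rfl fun i _ => by ring
  simp only [mul_add, mul_sub, Finset.sum_add_distrib, Finset.sum_sub_distrib, e2] at hsum
  simp only [← Finset.sum_mul, hr1, one_mul] at hsum
  simp only [roundGap, roundLin, roundQuad, clientMix, smul_eq_mul, ← hr]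
  linarith

end FedProblem


/-! ### The optimization error -/

/-- Let `s` be the effective noise and `Λ = log (8/δ)`. Then `4σg/√Bg = 4sL√E`, and the right-hand
side of `h` is at most `D² (7/4 + 12s² + 16s²Λ/K + 2s√(8Λ))`, hence at most `2D²` times the bracket
of `optError`. The step size gives `2γE · K ε'/2` the same value. -/
theorem le_mul_optError {D L σg δ γ gap lin quad : ℝ} {K E Bg : ℕ} (hD : 0 < D) (hL : 0 < L)
    (hσg : 0 < σg) (hK : 1 ≤ K) (hE : 1 ≤ E) (hBg : 1 ≤ Bg) (hΛ : 0 < Real.log (8 / δ))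
    (hγ : γ = D / (L * E * Real.sqrt (8 * K)))
    (h : 2 * γ * E * gap ≤ D ^ 2 + 2 * γ * lin + K * (6 * γ ^ 2 * E ^ 2 * L ^ 2) +
      8 * γ ^ 2 * (4 * σg / Real.sqrt Bg) ^ 2 * quad)
    (hlin : lin ≤ 2 * D * (4 * σg / Real.sqrt Bg) * Real.sqrt (K * E * Real.log (8 / δ)))
    (hquad : quad ≤ E * (K * (3 / 4) + Real.log (8 / δ))) :
    gap ≤ K * (optError D L σg δ K E Bg / 2) := by
  have hK' : (0 : ℝ) < K := by exact_mod_cast hK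
  have hE' : (0 : ℝ) < E := by exact_mod_cast hE
  have hB' : (0 : ℝ) < Bg := by exact_mod_cast hBg
  rw [optError]
  set Λ := Real.log (8 / δ) with hΛdef
  set rE := Real.sqrt E with hrE
  set rK := Real.sqrt K with hrK
  set rΛ := Real.sqrt Λ with hrΛ
  set r8 := Real.sqrt 8 with hr8
  have pE : 0 < rE := Real.sqrt_pos.2 hE'
  have pK : 0 < rK := Real.sqrt_pos.2 hK'
  have pΛ : 0 < rΛ := Real.sqrt_pos.2 hΛ
  have p8 : 0 < r8 := Real.sqrt_pos.2 (by norm_num)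
  have sE : rE ^ 2 = E := Real.sq_sqrt hE'.le
  have sK : rK ^ 2 = K := Real.sq_sqrt hK'.le
  have sΛ : rΛ ^ 2 = Λ := Real.sq_sqrt hΛ.le
  have s8 : r8 ^ 2 = 8 := Real.sq_sqrt (by norm_num)
  have e1 : Real.sqrt (8 * K) = r8 * rK := Real.sqrt_mul (by norm_num) _
  have e2 : Real.sqrt (K * E * Λ) = rK * rE * rΛ := by
    rw [Real.sqrt_mul (by positivity), Real.sqrt_mul (by positivity)]
  have e3 : Real.sqrt (8 * Λ) = r8 * rΛ := Real.sqrt_mul (by norm_num) _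
  have e4 : Real.sqrt (K / 32) = rK / (2 * r8) := by
    rw [Real.sqrt_eq_iff_mul_self_eq (by positivity) (by positivity)]
    field_simp
    rw [s8, sK]; ring
  set sb := effNoise L σg E Bg with hsb
  have psb : 0 ≤ sb := Real.sqrt_nonneg _
  have e5 : 4 * σg / Real.sqrt Bg = 4 * sb * L * rE := by
    have : sb = σg / Real.sqrt Bg / (L * rE) := by
      rw [hsb, effNoise, Real.sqrt_div (by positivity), Real.sqrt_div (by positivity),
        Real.sqrt_mul (by positivity), Real.sqrt_sq hσg.le, Real.sqrt_sq hL.le]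
    rw [this]; field_simp
  rw [e5] at h hlin
  rw [e2] at hlin
  rw [e1, ← sE] at hγ
  rw [e3, e4]
  rw [← sE, ← sK, ← sΛ] at hquad
  rw [← sE, ← sK] at h
  set T := (E : ℝ) / Real.sqrt (6 * K) with hT
  have hT0 : 0 ≤ T := by positivity
  rw [← sK, ← sΛ]
  set Br := 1 + 2 * sb ^ 2 * (3 + 8 * rΛ ^ 2 / rK ^ 2) + sb * (r8 * rΛ) * (1 + T) with hBr
  have pγ : 0 < γ := by rw [hγ]; positivity
  have t1 : 2 * γ * lin ≤ 2 * D ^ 2 * (sb * (r8 * rΛ)) := by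
    refine (mul_le_mul_of_nonneg_left hlin (by positivity)).trans_eq ?_
    have : 2 * γ * (2 * D * (4 * sb * L * rE) * (rK * rE * rΛ)) = 16 * D ^ 2 * sb * rΛ / r8 := by
      rw [hγ]; field_simp; ring
    rw [this, div_eq_iff p8.ne']
    linear_combination (-2 * D ^ 2 * sb * rΛ) * s8
  have t2 : rK ^ 2 * (6 * γ ^ 2 * (rE ^ 2) ^ 2 * L ^ 2) = 3 / 4 * D ^ 2 := by
    have : rK ^ 2 * (6 * γ ^ 2 * (rE ^ 2) ^ 2 * L ^ 2) = 6 * D ^ 2 / r8 ^ 2 := by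
      rw [hγ]; field_simp
    rw [this, s8]; ring
  have t3 : 8 * γ ^ 2 * (4 * sb * L * rE) ^ 2 * quad ≤
      D ^ 2 * sb ^ 2 * (12 + 16 * (rΛ ^ 2 / rK ^ 2)) := by
    refine (mul_le_mul_of_nonneg_left hquad (by positivity)).trans_eq ?_
    have : 8 * γ ^ 2 * (4 * sb * L * rE) ^ 2 * (rE ^ 2 * (rK ^ 2 * (3 / 4) + rΛ ^ 2)) =
        128 / r8 ^ 2 * (D ^ 2 * sb ^ 2 * (3 / 4 + rΛ ^ 2 / rK ^ 2)) := by
      rw [hγ]; field_simp; ring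
    rw [this, s8]; ring
  have t4 : 2 * γ * rE ^ 2 * gap ≤ 2 * D ^ 2 * Br := by
    refine h.trans ?_
    rw [t2, hBr]
    have u1 : 0 ≤ D ^ 2 * sb ^ 2 * (rΛ ^ 2 / rK ^ 2) := by positivity
    have u2 : 0 ≤ D ^ 2 * (sb * (r8 * rΛ)) * T := by positivity
    have u3 : 0 ≤ D ^ 2 := sq_nonneg D
    have u4 : 8 * rΛ ^ 2 / rK ^ 2 = 8 * (rΛ ^ 2 / rK ^ 2) := by ring
    rw [u4]
    linarith
  have t5 : 2 * γ * rE ^ 2 = 2 * D / (L * r8 * rK) := by rw [hγ]; field_simp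
  rw [t5, div_mul_eq_mul_div, div_le_iff₀ (by positivity)] at t4
  have t6 : rK ^ 2 * (D * L / (rK / (2 * r8)) * Br / 2) = D * Br * (L * r8 * rK) := by
    field_simp
  rw [t6]
  refine le_of_mul_le_mul_left (?_ : 2 * D * gap ≤ 2 * D * _) (by positivity)
  linarith

theorem optError_pos {D L σg δ : ℝ} {K E Bg : ℕ} (hD : 0 < D) (hL : 0 < L) (hK : 1 ≤ K)
    (hΛ : 0 < Real.log (8 / δ)) : 0 < optError D L σg δ K E Bg := by
  have hK' : (0 : ℝ) < K := by exact_mod_cast hK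
  have : 0 ≤ effNoise L σg E Bg := Real.sqrt_nonneg _
  unfold optError
  positivity

/-- Bounding a partial sum by the sum of all exponentials. -/
theorem sum_le_mul_log_of_sum_exp_le {K : ℕ} {Y : ℕ → ℝ} {c M : ℝ} (hc : 0 ≤ c)
    (hY : c = 0 → ∀ k < K, Y k = 0)
    (hM : ∑ k ∈ Finset.range K, Real.exp (Y k / (2 * c)) ≤ M) {T : Finset ℕ}
    (hT : T ⊆ Finset.range K) (hT0 : T.Nonempty) :
    ∑ k ∈ T, Y k ≤ T.card * (2 * c * Real.log (M / T.card)) := by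
  have hcard : (0 : ℝ) < T.card := by exact_mod_cast hT0.card_pos
  rcases hc.eq_or_lt with h0 | hpos
  · rw [Finset.sum_eq_zero fun k hk => hY h0.symm k (Finset.mem_range.1 (hT hk)), ← h0]
    simp
  have h1 := convexOn_exp.map_sum_le (t := T) (w := fun _ => (T.card : ℝ)⁻¹)
    (p := fun k => Y k / (2 * c)) (fun _ _ => by positivity) (by simp [hcard.ne'])
    (fun _ _ => Set.mem_univ _)
  simp only [smul_eq_mul, ← Finset.mul_sum] at h1
  have h2 : ∑ k ∈ T, Real.exp (Y k / (2 * c)) ≤ M :=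
    (Finset.sum_le_sum_of_subset_of_nonneg hT fun _ _ _ => (Real.exp_pos _).le).trans hM
  have h3 : Real.exp ((T.card : ℝ)⁻¹ * ∑ k ∈ T, Y k / (2 * c)) ≤ M / T.card := by
    refine h1.trans ?_
    rw [div_eq_inv_mul]
    exact mul_le_mul_of_nonneg_left h2 (by positivity)
  have h4 := (Real.le_log_iff_exp_le (lt_of_lt_of_le (Real.exp_pos _) h3)).2 h3
  rw [← Finset.sum_div, inv_mul_le_iff₀ hcard, div_le_iff₀ (by positivity)] at h4
  linarith

/-! ### Worst-case values against the weighted gaps of a round -/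

theorem sum_mul_le_sum_mul_add {ι : Type*} {A : Finset ι} {r x y : ι → ℝ} {e : ℝ}
    (hr0 : ∀ i, 0 ≤ r i) (hr1 : ∑ i ∈ A, r i = 1) (h : ∀ i ∈ A, x i ≤ y i + e) :
    ∑ i ∈ A, r i * x i ≤ ∑ i ∈ A, r i * y i + e := by
  calc ∑ i ∈ A, r i * x i ≤ ∑ i ∈ A, r i * (y i + e) :=
        Finset.sum_le_sum fun i hi => mul_le_mul_of_nonneg_left (h i hi) (hr0 i)
    _ = ∑ i ∈ A, r i * y i + e := by
        simp only [mul_add, Finset.sum_add_distrib, ← Finset.sum_mul, hr1, one_mul]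

theorem meanValue_le_worstValue {n d : ℕ} {Z : Type*} [MeasurableSpace Z] (𝒟 : Fin n → Measure Z)
    (h : Fin n → Vec d → Z → ℝ) (i : Fin n) (w : Vec d) :
    meanValue 𝒟 h i w ≤ worstValue 𝒟 h w :=
  le_ciSup (f := fun i => meanValue 𝒟 h i w) (Set.finite_range _).bddAbove i

/-- The worst value exceeds the softmax mean of the estimates by at most the softmax error, the
estimation error and the sampling gap. -/
theorem worstValue_le_softmax_add {n d B : ℕ} {Z : Type*} [MeasurableSpace Z]
    {𝒟 : Fin n → Measure Z} {h : Fin n → Vec d → Z → ℝ} {w : Vec d} {A : Finset (Fin n)}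
    (hA : A.Nonempty) {s : Fin n → Fin B → Z} {e ε α : ℝ} (hε : 0 < ε)
    (hα : 2 * Real.log A.card / ε ≤ α)
    (he : ∀ i ∈ A, |batchMean (h i w) (s i) - meanValue 𝒟 h i w| ≤ e) :
    worstValue 𝒟 h w ≤ ∑ i ∈ A, maskedSoftmax A (fun i => α * batchMean (h i w) (s i)) i *
      batchMean (h i w) (s i) + ε / 2 + e + samplingGap (fun i => meanValue 𝒟 h i w) A := by
  obtain ⟨i, hi, h1⟩ := exists_samplingGap_eq (fun i => meanValue 𝒟 h i w) hA
  have h2 := sub_half_le_sum_maskedSoftmax (fun i => batchMean (h i w) (s i)) hε hα hi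
  have h3 := (abs_le.1 (he i hi)).1
  rw [worstValue, h1]
  linarith

/-- The worst value is convex along averages. -/
theorem FamilyAssumptions.worstValue_average_le {n d : ℕ} (hn : 1 ≤ n) {Z : Type*}
    [MeasurableSpace Z] {Θ : Set (Vec d)} {𝒟 : Fin n → Measure Z} {h : Fin n → Vec d → Z → ℝ}
    {dh : Fin n → Vec d → Z → Vec d} {L σζ σg σ : ℝ} (H : FamilyAssumptions Θ 𝒟 h dh L σζ σg σ)
    {T : Finset ℕ} (hT : T.Nonempty) {u : ℕ → Vec d} (hu : ∀ k ∈ T, u k ∈ Θ) :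
    worstValue 𝒟 h ((T.card : ℝ)⁻¹ • ∑ k ∈ T, u k) ≤
      (T.card : ℝ)⁻¹ * ∑ k ∈ T, worstValue 𝒟 h (u k) := by
  have : Nonempty (Fin n) := ⟨⟨0, hn⟩⟩
  have hcard : (0 : ℝ) < T.card := by exact_mod_cast hT.card_pos
  refine ciSup_le fun i => ?_
  have h1 := (H.convex i).map_sum_le (t := T) (w := fun _ => (T.card : ℝ)⁻¹) (p := u)
    (fun _ _ => by positivity) (by simp [hcard.ne']) hu
  rw [← Finset.smul_sum] at h1
  refine h1.trans ?_
  rw [← Finset.smul_sum, smul_eq_mul]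
  gcongr with k hk
  exact meanValue_le_worstValue 𝒟 h i (u k)

namespace FedProblem

variable {n d E Bζ Bg m : ℕ} {Z : Type*} [MeasurableSpace Z] {p : FedProblem n d Z}
  {L σζ σg σ : ℝ} {a : AlgParams}

theorem constraintEst_eq_sum (x : RoundSample n E Bζ Bg Z) (w : Vec d) :
    p.constraintEst a x w = ∑ i ∈ x.1, p.qWeight a x w i * p.gEst x w i := by
  refine (Finset.sum_subset (Finset.subset_univ x.1) fun i _ hi => ?_).symm
  rw [qWeight, maskedSoftmax_of_notMem _ hi, zero_mul]

/-- The same softmax weights approximate the maximum at `w` and aggregate the round. At `v` any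
weighted mean is at most `F v`. The estimation error enters twice: from the best sampled client to
its estimate, and from the estimates back to the means. -/
theorem F_sub_F_le_roundGap {x : RoundSample n E Bζ Bg Z} {w v : Vec d} (hx : x.1.Nonempty)
    (hc : p.constraintEst a x w ≤ a.ε / 2) {e ε : ℝ} (hε : 0 < ε)
    (hα : 2 * Real.log x.1.card / ε ≤ a.α)
    (he : ∀ i ∈ x.1, |batchMean (p.f i w) (x.2.1 i) - meanValue p.𝒟 p.f i w| ≤ e) :
    p.F w - p.F v ≤ p.roundGap a v w x + ε / 2 + 2 * e +
      samplingGap (fun i => meanValue p.𝒟 p.f i w) x.1 := by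
  have h1 := worstValue_le_softmax_add hx hε hα he
  have hr0 : ∀ i, 0 ≤ p.pWeight a x w i := fun i => maskedSoftmax_nonneg _ _ i
  have hr1 : ∑ i ∈ x.1, p.pWeight a x w i = 1 := sum_maskedSoftmax hx _
  have h2 := sum_mul_le_sum_mul_add hr0 hr1
    (x := fun i => batchMean (p.f i w) (x.2.1 i)) (y := fun i => meanValue p.𝒟 p.f i w) (e := e)
    fun i hi => by linarith [(abs_le.1 (he i hi)).2]
  have h3 := sum_mul_le_sum_mul_add hr0 hr1 (x := fun i => meanValue p.𝒟 p.f i v)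
    (y := fun _ => 0) (e := p.F v) fun i _ => by
      rw [zero_add]; exact meanValue_le_worstValue _ _ _ _
  have h4 : p.roundGap a v w x = ∑ i ∈ x.1, p.pWeight a x w i * meanValue p.𝒟 p.f i w -
      ∑ i ∈ x.1, p.pWeight a x w i * meanValue p.𝒟 p.f i v := by
    simp only [roundGap, clientMix, roundWeight, hc, if_true, smul_eq_mul, mul_sub,
      Finset.sum_sub_distrib]
  simp only [mul_zero, Finset.sum_const_zero, zero_add] at h3
  have h5 : p.F w = worstValue p.𝒟 p.f w := rfl
  have h6 : ∑ i ∈ x.1, maskedSoftmax x.1 (fun i => a.α * batchMean (p.f i w) (x.2.1 i)) i *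
      batchMean (p.f i w) (x.2.1 i) =
      ∑ i ∈ x.1, p.pWeight a x w i * batchMean (p.f i w) (x.2.1 i) := rfl
  rw [h6] at h1
  linarith

theorem G_le_of_constraintEst_le {x : RoundSample n E Bζ Bg Z} {w : Vec d} (hx : x.1.Nonempty)
    (hc : p.constraintEst a x w ≤ a.ε / 2) {e ε : ℝ} (hε : 0 < ε)
    (hα : 2 * Real.log x.1.card / ε ≤ a.α)
    (he : ∀ i ∈ x.1, |batchMean (p.g i w) (x.2.1 i) - meanValue p.𝒟 p.g i w| ≤ e) :
    p.G w ≤ a.ε / 2 + ε / 2 + e + samplingGap (fun i => meanValue p.𝒟 p.g i w) x.1 := by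
  have h1 := worstValue_le_softmax_add hx hε hα he
  rw [constraintEst_eq_sum] at hc
  refine h1.trans ?_
  gcongr
  exact hc

/-- In a violated round the weighted constraint estimate exceeds `ε / 2`, while the same weighted
mean at the feasible point `v` is at most `0`. -/
theorem half_sub_lt_roundGap {x : RoundSample n E Bζ Bg Z} {w v : Vec d} (hx : x.1.Nonempty)
    (hc : ¬ p.constraintEst a x w ≤ a.ε / 2) {e : ℝ} (hv : p.G v ≤ 0)
    (he : ∀ i ∈ x.1, |batchMean (p.g i w) (x.2.1 i) - meanValue p.𝒟 p.g i w| ≤ e) :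
    a.ε / 2 - e < p.roundGap a v w x := by
  have hr0 : ∀ i, 0 ≤ p.qWeight a x w i := fun i => maskedSoftmax_nonneg _ _ i
  have hr1 : ∑ i ∈ x.1, p.qWeight a x w i = 1 := sum_maskedSoftmax hx _
  have h2 := sum_mul_le_sum_mul_add hr0 hr1
    (x := fun i => batchMean (p.g i w) (x.2.1 i)) (y := fun i => meanValue p.𝒟 p.g i w) (e := e)
    fun i hi => by linarith [(abs_le.1 (he i hi)).2]
  have h3 := sum_mul_le_sum_mul_add hr0 hr1 (x := fun i => meanValue p.𝒟 p.g i v)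
    (y := fun _ => 0) (e := p.G v) fun i _ => by
      rw [zero_add]; exact meanValue_le_worstValue _ _ _ _
  have h4 : p.roundGap a v w x = ∑ i ∈ x.1, p.qWeight a x w i * meanValue p.𝒟 p.g i w -
      ∑ i ∈ x.1, p.qWeight a x w i * meanValue p.𝒟 p.g i v := by
    simp only [roundGap, clientMix, roundWeight, hc, if_false, smul_eq_mul, mul_sub,
      Finset.sum_sub_distrib]
  simp only [mul_zero, Finset.sum_const_zero, zero_add] at h3
  rw [constraintEst_eq_sum, not_le] at hc
  have h6 : ∑ i ∈ x.1, p.qWeight a x w i * p.gEst x w i =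
      ∑ i ∈ x.1, p.qWeight a x w i * batchMean (p.g i w) (x.2.1 i) := rfl
  rw [h6] at hc
  linarith

/-- The sum of the suboptimality gaps over the rounds. -/
theorem sum_roundGap_le (hf : FamilyAssumptions p.Θ p.𝒟 p.f p.df L σζ σg σ)
    (hg : FamilyAssumptions p.Θ p.𝒟 p.g p.dg L σζ σg σ) (hE : 1 ≤ E) {κ D : ℝ} (hγ : 0 < a.γ)
    (hη : a.η = a.γ * E) (hL : 0 ≤ L) (hκ : 0 < κ) {v : Vec d} (hv : v ∈ p.Θ) {w₀ : Vec d}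
    (hw₀ : ‖w₀ - v‖ ≤ D) {K : ℕ} {x : ℕ → RoundSample n E Bζ Bg Z}
    (hx : ∀ k, (x k).1.Nonempty) (hs : p.StaysIn a w₀ K x) :
    2 * a.γ * E * ∑ k ∈ Finset.range K, p.roundGap a v (p.iterate a w₀ x k) (x k) ≤
      D ^ 2 + 2 * a.γ * ∑ k ∈ Finset.range K, p.roundLin a v (p.iterate a w₀ x k) (x k) +
      K * (6 * a.γ ^ 2 * E ^ 2 * L ^ 2) +
      8 * a.γ ^ 2 * κ ^ 2 * ∑ k ∈ Finset.range K, p.roundQuad a κ (p.iterate a w₀ x k) (x k) := by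
  have hstep : ∀ k ∈ Finset.range K,
      2 * a.γ * E * p.roundGap a v (p.iterate a w₀ x k) (x k) ≤
      (‖p.iterate a w₀ x k - v‖ ^ 2 - ‖p.iterate a w₀ x (k + 1) - v‖ ^ 2) +
      2 * a.γ * p.roundLin a v (p.iterate a w₀ x k) (x k) + 6 * a.γ ^ 2 * E ^ 2 * L ^ 2 +
      8 * a.γ ^ 2 * κ ^ 2 * p.roundQuad a κ (p.iterate a w₀ x k) (x k) := fun k hk =>
    roundGap_le hf hg hE hγ hη hL hκ hv _ (x k) (hx k) (hs k (Finset.mem_range.1 hk)).2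
  have hsum := Finset.sum_le_sum hstep
  rw [Finset.sum_add_distrib, Finset.sum_add_distrib, Finset.sum_add_distrib,
    Finset.sum_range_sub', Finset.sum_const, Finset.card_range, nsmul_eq_mul] at hsum
  rw [Finset.mul_sum, Finset.mul_sum, Finset.mul_sum]
  have h0 : ‖p.iterate a w₀ x 0 - v‖ ^ 2 ≤ D ^ 2 := pow_le_pow_left₀ (norm_nonneg _) hw₀ 2
  have h1 : 0 ≤ ‖p.iterate a w₀ x K - v‖ ^ 2 := sq_nonneg _
  linarith

end FedProblem


/-! ### The guarantee on a trajectory -/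

namespace FedProblem

variable {n d E Bζ Bg : ℕ} {Z : Type*} [MeasurableSpace Z] {p : FedProblem n d Z} {a : AlgParams}
  {L σζ σg σ : ℝ}

theorem sum_samplingGap_le {K m : ℕ} (hm : 1 ≤ m) (hmn : m ≤ n) (hσ : 0 < σ)
    {v : ℕ → Fin n → ℝ} {A : ℕ → Finset (Fin n)} (hA : ∀ k, (A k).card = m) {M : ℝ}
    (hM : ∑ k ∈ Finset.range K, Real.exp (samplingGap (v k) (A k) / (2 * samplingScale σ m n)) ≤ M)
    {T : Finset ℕ} (hT : T ⊆ Finset.range K) (hT0 : T.Nonempty) :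
    ∑ k ∈ T, samplingGap (v k) (A k) ≤
      T.card * (2 * samplingScale σ m n * Real.log (M / T.card)) := by
  refine sum_le_mul_log_of_sum_exp_le (samplingScale_nonneg hσ.le m n) (fun h0 k _ => ?_) hM hT hT0
  rcases hmn.eq_or_lt with rfl | hlt
  · have : A k = Finset.univ := by rw [← Finset.card_eq_iff_eq_univ, hA, Fintype.card_fin]
    rw [this, samplingGap_univ (hm.trans hmn)]
  · exact absurd h0 (samplingScale_pos hσ hm hlt).ne'

/-- The guarantee on a single trajectory along which the noise is controlled. -/
theorem output_guarantee {K m : ℕ} (hK : 1 ≤ K) (hE : 1 ≤ E) (hBg : 1 ≤ Bg) (hm : 1 ≤ m)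
    (hmn : m ≤ n) {D δ e : ℝ} (hD : 0 < D) (hL : 0 < L) (hσg : 0 < σg) (hσ : 0 < σ)
    (hδ₀ : 0 < δ) (hδ₁ : δ < 1)
    (hdiam : ∀ w₁ ∈ p.Θ, ∀ w₂ ∈ p.Θ, ‖w₁ - w₂‖ ≤ D)
    (hf : FamilyAssumptions p.Θ p.𝒟 p.f p.df L σζ σg σ)
    (hg : FamilyAssumptions p.Θ p.𝒟 p.g p.dg L σζ σg σ) {v : Vec d} (hv : v ∈ p.Θ)
    (hGv : p.G v ≤ 0) (hη : a.η = D / (L * Real.sqrt (8 * K)))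
    (hγ : a.γ = D / (L * E * Real.sqrt (8 * K)))
    (hε : a.ε = optError D L σg δ K E Bg + 2 * e + 4 * samplingScale σ m n * Real.log (32 / δ))
    (hα : 2 * Real.log m / optError D L σg δ K E Bg ≤ a.α) {w₀ : Vec d} (hw₀ : w₀ ∈ p.Θ)
    {x : ℕ → RoundSample n E Bζ Bg Z} (hs : p.StaysIn a w₀ K x) (hx : ∀ k, (x k).1.card = m)
    (hlin : ∑ k ∈ Finset.range K, p.roundLin a v (p.iterate a w₀ x k) (x k) ≤
      2 * D * (4 * σg / Real.sqrt Bg) * Real.sqrt (K * E * Real.log (8 / δ)))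
    (hquad : ∑ k ∈ Finset.range K, p.roundQuad a (4 * σg / Real.sqrt Bg) (p.iterate a w₀ x k) (x k) ≤
      E * (K * (3 / 4) + Real.log (8 / δ)))
    (hef : ∀ k < K, ∀ i ∈ (x k).1, |batchMean (p.f i (p.iterate a w₀ x k)) ((x k).2.1 i) -
      meanValue p.𝒟 p.f i (p.iterate a w₀ x k)| ≤ e)
    (heg : ∀ k < K, ∀ i ∈ (x k).1, |batchMean (p.g i (p.iterate a w₀ x k)) ((x k).2.1 i) -
      meanValue p.𝒟 p.g i (p.iterate a w₀ x k)| ≤ e)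
    (hXf : ∑ k ∈ Finset.range K, Real.exp
      (samplingGap (fun i => meanValue p.𝒟 p.f i (p.iterate a w₀ x k)) (x k).1 /
        (2 * samplingScale σ m n)) ≤ K * (32 / δ))
    (hXg : ∑ k ∈ Finset.range K, Real.exp
      (samplingGap (fun i => meanValue p.𝒟 p.g i (p.iterate a w₀ x k)) (x k).1 /
        (2 * samplingScale σ m n)) ≤ K * (8 / δ)) :
    (p.satisfiedRounds a w₀ K x).Nonempty ∧
      p.F (p.output a w₀ K x) - p.F v ≤ a.ε ∧
      p.G (p.output a w₀ K x) ≤ a.ε + 4 * samplingScale σ m n *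
        Real.log (1 / (2 * p.satisfiedRatio a w₀ K x)) := by
  have hK' : (0 : ℝ) < K := by exact_mod_cast hK
  have hE' : (0 : ℝ) < E := by exact_mod_cast hE
  have hB' : (0 : ℝ) < Bg := by exact_mod_cast hBg
  have hn : 1 ≤ n := hm.trans hmn
  have hΛ : 0 < Real.log (8 / δ) := Real.log_pos (by rw [lt_div_iff₀ hδ₀]; linarith)
  -- The `32` leaves `2 log 2` beyond the level `8/δ` of the constraint; this becomes the factor `2`
  -- in `log (1/(2κ))`.
  have hΛ' : Real.log (32 / δ) = Real.log (8 / δ) + 2 * Real.log 2 := by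
    rw [show 32 / δ = 8 / δ * 2 ^ 2 by ring, Real.log_mul (by positivity) (by norm_num),
      Real.log_pow]
    norm_num
  have hlog2 : 0 < Real.log 2 := Real.log_pos (by norm_num)
  have hε' := optError_pos (σg := σg) (E := E) (Bg := Bg) hD hL hK hΛ
  set ε' := optError D L σg δ K E Bg with hε'def
  have hS0 := samplingScale_nonneg hσ.le m n
  set c := samplingScale σ m n with hc
  have hy : 0 ≤ c * Real.log (32 / δ) := mul_nonneg hS0 (by linarith)
  have hne : ∀ k, (x k).1.Nonempty := fun k => Finset.card_pos.1 (by rw [hx]; omega)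
  have hγ0 : 0 < a.γ := by rw [hγ]; positivity
  have hηγ : a.η = a.γ * E := by rw [hη, hγ]; field_simp
  have hgap := le_mul_optError hD hL hσg hK hE hBg hΛ hγ
    (sum_roundGap_le hf hg hE hγ0 hηγ hL.le (by positivity : 0 < 4 * σg / Real.sqrt Bg) hv
      (hdiam _ hw₀ _ hv) hne hs) hlin hquad
  rw [← hε'def] at hgap
  set w := p.iterate a w₀ x with hw
  set gap := fun k => p.roundGap a v (w k) (x k) with hgapdef
  set S := p.satisfiedRounds a w₀ K x with hS
  have hSK : S ⊆ Finset.range K := Finset.filter_subset _ _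
  have hSmem : ∀ k, k ∈ S ↔ k < K ∧ p.constraintEst a (x k) (w k) ≤ a.ε / 2 := fun k => by
    simp [hS, satisfiedRounds, hw]
  have hout : ∀ k ∈ Finset.range K \ S, a.ε / 2 - e < gap k := fun k hk => by
    rw [Finset.mem_sdiff, hSmem, Finset.mem_range] at hk
    exact half_sub_lt_roundGap (hne k) (fun h => hk.2 ⟨hk.1, h⟩) hGv (heg k hk.1)
  have hsplit := Finset.sum_sdiff (f := gap) hSK
  have hcards : ((Finset.range K \ S).card : ℝ) = K - S.card := by
    rw [Finset.cast_card_sdiff hSK, Finset.card_range]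
  have hlow : (K - S.card : ℝ) * (a.ε / 2 - e) ≤ ∑ k ∈ Finset.range K \ S, gap k := by
    rw [← hcards, ← nsmul_eq_mul]
    exact Finset.card_nsmul_le_sum _ _ _ fun k hk => (hout k hk).le
  -- If every round were violated, the gaps would sum to more than `K (ε/2 - e)`. Since `ε/2 - e =
  -- ε'/2 + 2c log (32/δ) ≥ ε'/2`, this contradicts `hgap`.
  have hSne : S.Nonempty := by
    rw [Finset.nonempty_iff_ne_empty]
    intro h0
    rw [h0, Finset.sdiff_empty] at hout
    have hlt := Finset.sum_lt_sum_of_nonempty (s := Finset.range K) (by simp; omega) hout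
    rw [Finset.sum_const, Finset.card_range, nsmul_eq_mul] at hlt
    have : a.ε / 2 - e < ε' / 2 := lt_of_mul_lt_mul_left (hlt.trans_le hgap) hK'.le
    linarith
  have hj : (0 : ℝ) < S.card := by exact_mod_cast hSne.card_pos
  have hjK : (S.card : ℝ) ≤ K := by
    have := Finset.card_le_card hSK
    rw [Finset.card_range] at this
    exact_mod_cast this
  have hmem : ∀ k ∈ S, w k ∈ p.Θ := fun k hk => (hs k ((hSmem k).1 hk).1).1
  have hαx : ∀ k, 2 * Real.log (x k).1.card / ε' ≤ a.α := fun k => by rw [hx]; exact hα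
  refine ⟨hSne, ?_, ?_⟩
  · have h1 : p.F (p.output a w₀ K x) ≤ (S.card : ℝ)⁻¹ * ∑ k ∈ S, p.F (w k) :=
      hf.worstValue_average_le hn hSne hmem
    have h2 : ∑ k ∈ S, (p.F (w k) - p.F v) ≤ ∑ k ∈ S, (gap k + ε' / 2 + 2 * e +
        samplingGap (fun i => meanValue p.𝒟 p.f i (w k)) (x k).1) := by
      refine Finset.sum_le_sum fun k hk => ?_
      obtain ⟨hkK, hck⟩ := (hSmem k).1 hk
      exact F_sub_F_le_roundGap (hne k) hck hε' (hαx k) (hef k hkK)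
    -- Here the gaps of the objective are bounded over all `K` rounds, at cost `2Ky` with `y = c log
    -- (32/δ)`. Each violated round exceeds `ε'/2` by `2y`, which pays `2(K - |S|)y`; only `2|S|y`
    -- remains for the satisfied rounds, within the `4y` contained in `ε`.
    have h3 : ∑ k ∈ S, samplingGap (fun i => meanValue p.𝒟 p.f i (w k)) (x k).1 ≤
        K * (2 * c * Real.log (32 / δ)) := by
      refine (Finset.sum_le_sum_of_subset_of_nonneg hSK fun _ _ _ => samplingGap_nonneg _ _).trans ?_
      have := sum_samplingGap_le hm hmn hσ hx hXf subset_rfl (by simp; omega)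
      rwa [Finset.card_range, mul_div_cancel_left₀ _ hK'.ne'] at this
    simp only [Finset.sum_add_distrib, Finset.sum_sub_distrib, Finset.sum_const, nsmul_eq_mul]
      at h2
    have h4 : ∑ k ∈ S, p.F (w k) ≤ S.card * (a.ε + p.F v) := by
      nlinarith [mul_nonneg hj.le hy]
    have h5 : (S.card : ℝ)⁻¹ * ∑ k ∈ S, p.F (w k) ≤ a.ε + p.F v := by
      rwa [inv_mul_le_iff₀ hj]
    linarith
  · have h1 : p.G (p.output a w₀ K x) ≤ (S.card : ℝ)⁻¹ * ∑ k ∈ S, p.G (w k) :=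
      hg.worstValue_average_le hn hSne hmem
    have h2 : ∑ k ∈ S, p.G (w k) ≤ ∑ k ∈ S, (a.ε / 2 + ε' / 2 + e +
        samplingGap (fun i => meanValue p.𝒟 p.g i (w k)) (x k).1) := by
      refine Finset.sum_le_sum fun k hk => ?_
      obtain ⟨hkK, hck⟩ := (hSmem k).1 hk
      exact G_le_of_constraintEst_le (hne k) hck hε' (hαx k) (heg k hkK)
    -- For the constraint the gaps are averaged over `𝒮` alone, which costs `2c log (8/(δκ))`. The
    -- criterion leaves `2c log (32/δ)` of `ε` to spare, and `log (1/κ) ≥ 0` allows its coefficient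
    -- to be raised from `2c` to `4c`.
    have h3 := sum_samplingGap_le hm hmn hσ hx hXg hSK hSne
    rw [← hc, show (K : ℝ) * (8 / δ) / S.card = 8 / δ * (K / S.card) by ring,
      Real.log_mul (by positivity) (by positivity)] at h3
    have h6 : Real.log (1 / (2 * p.satisfiedRatio a w₀ K x)) =
        Real.log (K / S.card) - Real.log 2 := by
      rw [← Real.log_div (by positivity) (by norm_num), satisfiedRatio, ← hS]
      congr 1
      field_simp
    have h7 : 0 ≤ Real.log (K / S.card) := Real.log_nonneg (by rwa [one_le_div hj])
    have h8 : 0 ≤ c * Real.log (K / S.card) := mul_nonneg hS0 h7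
    rw [h6]
    simp only [Finset.sum_add_distrib, Finset.sum_const, nsmul_eq_mul] at h2
    have h5 : (S.card : ℝ)⁻¹ * ∑ k ∈ S, p.G (w k) ≤ a.ε / 2 + ε' / 2 + e +
        2 * c * (Real.log (8 / δ) + Real.log (K / S.card)) := by
      rw [inv_mul_le_iff₀ hj]
      linarith
    rw [hΛ'] at hε
    linarith

end FedProblem


/-! ### The high-probability guarantee -/

theorem gapOn_of_mem {n d : ℕ} {Z : Type*} [MeasurableSpace Z] {Θ : Set (Vec d)}
    {𝒟 : Fin n → Measure Z} {h : Fin n → Vec d → Z → ℝ} {w : Vec d} (hw : w ∈ Θ)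
    (A : Finset (Fin n)) :
    FedProblem.gapOn Θ 𝒟 h w A = samplingGap (fun i => meanValue 𝒟 h i w) A := if_pos hw

/-- Subadditivity replaces the complement formula, so the event need not be measurable. -/
theorem one_sub_le_measureReal_of_compl_le {Ω : Type*} [MeasurableSpace Ω] {P : Measure Ω}
    [IsProbabilityMeasure P] {S : Set Ω} {δ : ℝ} (hδ : 0 ≤ δ) (h : P Sᶜ ≤ ENNReal.ofReal δ) :
    1 - δ ≤ P.real S := by
  have h1 : (1 : ENNReal) ≤ P S + P Sᶜ := by
    rw [← measure_univ (μ := P), ← Set.union_compl_self S]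
    exact measure_union_le _ _
  have h2 := ENNReal.toReal_mono (by finiteness) (h1.trans (add_le_add_right h (P S)))
  rw [ENNReal.toReal_add (by finiteness) (by finiteness), ENNReal.toReal_ofReal hδ] at h2
  simp only [ENNReal.toReal_one] at h2
  rw [Measure.real]
  linarith

/-- The union bound over the estimates of all rounds and participating clients. -/
theorem estimate_union_bound {σζ δ : ℝ} {K m Bζ : ℕ} (hσζ : 0 < σζ) (hδ₀ : 0 < δ) (hδ₁ : δ < 1)
    (hK : 1 ≤ K) (hm : 1 ≤ m) (hBζ : 1 ≤ Bζ) :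
    K * (m * (2 * Real.exp (-(Bζ * (2 * σζ * Real.sqrt (2 * Real.log (24 * K * m / δ) / Bζ)) ^ 2 /
      (4 * σζ ^ 2))))) ≤ δ / 12 := by
  have hK' : (1 : ℝ) ≤ K := by exact_mod_cast hK
  have hm' : (1 : ℝ) ≤ m := by exact_mod_cast hm
  have hB' : (0 : ℝ) < Bζ := by exact_mod_cast hBζ
  have hKm : 1 ≤ (K : ℝ) * m := one_le_mul_of_one_le_of_one_le hK' hm'
  have hℓ : 0 ≤ Real.log (24 * K * m / δ) := Real.log_nonneg (by
    rw [le_div_iff₀ hδ₀]; nlinarith)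
  set ℓ := Real.log (24 * K * m / δ) with hℓdef
  have h1 : Bζ * (2 * σζ * Real.sqrt (2 * ℓ / Bζ)) ^ 2 / (4 * σζ ^ 2) = 2 * ℓ := by
    rw [mul_pow, Real.sq_sqrt (by positivity)]
    field_simp
    ring
  -- Already `exp (-ℓ)` equals `δ/(24Km)`; the other half of the exponent is spare.
  have h2 : Real.exp (-(2 * ℓ)) ≤ δ / (24 * K * m) := by
    rw [← Real.exp_log (by positivity : 0 < δ / (24 * K * m)), ← inv_div, Real.log_inv, ← hℓdef]
    gcongr
    linarith
  rw [h1]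
  calc (K : ℝ) * (m * (2 * Real.exp (-(2 * ℓ)))) ≤ K * (m * (2 * (δ / (24 * K * m)))) := by gcongr
    _ = δ / 12 := by field_simp; norm_num

end

theorem mainTheorem1
    {n d K E Bζ Bg m : ℕ} (hK : 1 ≤ K) (hE : 1 ≤ E) (hBζ : 1 ≤ Bζ) (hBg : 1 ≤ Bg)
    (hm : 1 ≤ m) (hmn : m ≤ n)
    {Z : Type*} [MeasurableSpace Z] (p : FedProblem n d Z) [∀ i, IsProbabilityMeasure (p.𝒟 i)]
    {D L σζ σg σ δ : ℝ} (hD : 0 < D) (hL : 0 < L) (hσζ : 0 < σζ) (hσg : 0 < σg) (hσ : 0 < σ)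
    (hδ₀ : 0 < δ) (hδ₁ : δ < 1)
    (hΘ : IsCompact p.Θ) (hΘconv : Convex ℝ p.Θ)
    (hdiam : ∀ w₁ ∈ p.Θ, ∀ w₂ ∈ p.Θ, ‖w₁ - w₂‖ ≤ D)
    (hf : FamilyAssumptions p.Θ p.𝒟 p.f p.df L σζ σg σ)
    (hg : FamilyAssumptions p.Θ p.𝒟 p.g p.dg L σζ σg σ)
    (wstar : Vec d) (hwstar : p.IsOptimal wstar)
    (a : AlgParams)
    (hη : a.η = D / (L * Real.sqrt (8 * K)))
    (hγ : a.γ = D / (L * E * Real.sqrt (8 * K)))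
    (hε : a.ε = tolerance D L σζ σg σ δ K E Bζ Bg m n)
    (hα : 2 * Real.log m / optError D L σg δ K E Bg ≤ a.α)
    (w₀ : Vec d) (hw₀ : w₀ ∈ p.Θ)
    {Ω : Type*} [MeasurableSpace Ω] (P : Measure Ω) [IsProbabilityMeasure P]
    (X : ℕ → Ω → RoundSample n E Bζ Bg Z) (hX : IsIIDRounds P m p.𝒟 X) :
    1 - δ ≤ P.real {ω |
      p.StaysIn a w₀ K (fun k => X k ω) →
        (p.satisfiedRounds a w₀ K (fun k => X k ω)).Nonempty ∧
        p.F (p.output a w₀ K (fun k => X k ω)) - p.F wstar ≤ a.ε ∧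
        p.G (p.output a w₀ K (fun k => X k ω)) ≤
          a.ε + 4 * samplingScale σ m n *
            Real.log (1 / (2 * p.satisfiedRatio a w₀ K (fun k => X k ω)))} := by

  have hΘm := hΘ.isClosed.measurableSet
  have hv := hwstar.1
  have hΛ : 0 < Real.log (8 / δ) := Real.log_pos (by rw [lt_div_iff₀ hδ₀]; linarith)
  have hexp : Real.exp (-Real.log (8 / δ)) = δ / 8 := by
    rw [← Real.log_inv, Real.exp_log (by positivity), inv_div]
  set e := 2 * σζ * Real.sqrt (2 * Real.log (24 * K * m / δ) / Bζ) with he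
  have he0 : 0 ≤ e := by positivity
  have hest := estimate_union_bound hσζ hδ₀ hδ₁ hK hm hBζ
  rw [← he] at hest
  have b1 := FedProblem.measure_sum_roundLin_ge_le (a := a) (w₀ := w₀) hmn hf hg hX hΘm hσg hBg hE hK
    hD (hdiam _ hv) hΛ
  have b2 := FedProblem.measure_sum_roundQuad_ge_le (a := a) (w₀ := w₀) hmn hf hg hX hΘm hσg hBg hE
    hK (Real.log (8 / δ))
  -- Markov at levels `δ/16` and `δ/4` gives the bounds `32K/δ` and `8K/δ`. Together with `δ/8`
  -- twice and `δ/12` twice, the failure probabilities add up to `35δ/48`.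
  have b3 := FedProblem.measure_sum_exp_gapOn_ge_le (a := a) (w₀ := w₀) hm hmn hf hg hX hΘm hσ hK hf
    (by positivity : 0 < δ / 16)
  have b4 := FedProblem.measure_sum_exp_gapOn_ge_le (a := a) (w₀ := w₀) hm hmn hf hg hX hΘm hσ hK hg
    (by positivity : 0 < δ / 4)
  have b5 := (FedProblem.measure_exists_est_ge_le (a := a) (w₀ := w₀) hmn hf hg hX hΘm hσζ hBζ K hf
    he0).trans (ENNReal.ofReal_le_ofReal hest)
  have b6 := (FedProblem.measure_exists_est_ge_le (a := a) (w₀ := w₀) hmn hf hg hX hΘm hσζ hBζ K hg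
    he0).trans (ENNReal.ofReal_le_ofReal hest)
  have b7 := FedProblem.ae_forall_card_eq hX
  rw [ae_iff] at b7
  rw [hexp] at b1 b2
  rw [show 2 / (δ / 16) = 32 / δ by field_simp; norm_num] at b3
  rw [show 2 / (δ / 4) = 8 / δ by field_simp; norm_num] at b4
  refine one_sub_le_measureReal_of_compl_le hδ₀.le ?_
  have hsub := (measure_union_le _ _).trans (add_le_add (measure_union_le _ _ |>.trans (add_le_add
    (measure_union_le _ _ |>.trans (add_le_add (measure_union_le _ _ |>.trans (add_le_add
    (measure_union_le _ _ |>.trans (add_le_add (measure_union_le _ _ |>.trans (add_le_add b1 b2))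
    b3)) b4)) b5)) b6)) b7.le)
  refine (measure_mono ?_).trans (hsub.trans ?_)
  · intro ω hω
    -- Outside the six bad events and a null set, the implication defining the good event holds
    -- pathwise.
    by_contra hbad
    simp only [Set.mem_union, Set.mem_ofPred_eq, not_or, not_le, not_exists, not_and, not_not]
      at hbad
    obtain ⟨⟨⟨⟨⟨⟨h1, h2⟩, h3⟩, h4⟩, h5⟩, h6⟩, h7⟩ := hbad
    refine hω fun hs => ?_
    -- The iterates of the first `K` rounds now lie in `Θ`, so the truncated gaps are the true ones.
    have hgapOn : ∀ h : Fin n → Vec d → Z → ℝ, ∑ k ∈ Finset.range K, Real.exp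
        (FedProblem.gapOn p.Θ p.𝒟 h (p.iterate a w₀ (fun j => X j ω) k) (X k ω).1 /
          (2 * samplingScale σ m n)) = ∑ k ∈ Finset.range K, Real.exp
        (samplingGap (fun i => meanValue p.𝒟 h i (p.iterate a w₀ (fun j => X j ω) k)) (X k ω).1 /
          (2 * samplingScale σ m n)) := fun h =>
      Finset.sum_congr rfl fun k hk => by rw [gapOn_of_mem (hs k (Finset.mem_range.1 hk)).1]
    rw [hgapOn] at h3 h4
    refine FedProblem.output_guarantee hK hE hBg hm hmn hD hL hσg hσ hδ₀ hδ₁ hdiam hf hg hv hwstar.2.1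
      hη hγ (e := e) ?_ hα hw₀ hs h7 h1.le h2.le (fun k hk i hi => (h5 k hk (hs k hk).1 i hi).le)
      (fun k hk i hi => (h6 k hk (hs k hk).1 i hi).le) h3.le h4.le
    rw [hε, tolerance, he]
    ring
  · rw [add_zero, ← ENNReal.ofReal_add, ← ENNReal.ofReal_add, ← ENNReal.ofReal_add,
      ← ENNReal.ofReal_add, ← ENNReal.ofReal_add]
    · refine ENNReal.ofReal_le_ofReal ?_
      linarith
    all_goals positivity
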